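/- Let $\mathcal H$ be a separable complex Hilbert space of finite or infinite dimension, $\mathcal T(\mathcal H)$ its trace-class operators, and $\rho>0$ a density operator on $\mathcal H$ (so $\langle x,\rho x\rangle>0$ for all $x\neq0$). Operators $A$ may be unbounded; $RA\in\mathcal T(\mathcal H)$ means that $RA$ on $\operatorname{dom}A$ is the restriction of a trace-class operator, whose trace is written $\operatorname{Tr}[RA]$ when $A$ is densely defined. For self-adjoint $A$ with $\rho A,\rho A^2\in\mathcal T(\mathcal H)$ put $\sigma^2(A)=\operatorname{Tr}[\rho A^2]-\operatorname{Tr}[\rho A]^2$. *SLD Fisher information.* For a positive trace-class operator $\sigma$ and a self-adjoint trace-class operator $\tau$, let $J^{\mathrm S}_\sigma(\tau)=\operatorname{Tr}[\sigma L^2]=\|L\sqrt\sigma\|_{\mathrm{HS}}^2\in[0,\infty]$, where $L$ is a symmetric, possibly unbounded, solution of $\tfrac12(\sigma L+L\sigma)=\tau$. Precisely, $J^{\mathrm S}_\sigma(\tau)$ is the infimum of $\|Y\|_{\mathrm{HS}}^2$ over the bounded operators $Y$ (standing for $L\sqrt\sigma$) such that $\sqrt\sigma\,Y$ is self-adjoint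 and $\tfrac12(Y\sqrt\sigma+\sqrt\sigma\,Y^*)=\tau$; it is $+\infty$ if there is no such $Y$. *Directions.* Let $\Xi_A$ be the real vector space of self-adjoint $\varphi\in\mathcal T(\mathcal H)$ with $\operatorname{Tr}\varphi=0$, $J^{\mathrm S}_\rho(\varphi)<\infty$ and $\varphi A\in\mathcal T(\mathcal H)$ (if $\dim\mathcal H<\infty$, these are all traceless self-adjoint operators), and let $b_A(\varphi)=\operatorname{Tr}[\varphi A]$, the derivative at $\rho$ of the expectation value of $A$ in the direction $\varphi$. *Inverse of a Fisher information.* For a form $J:\Xi_A\to[0,\infty]$ put $$\langle b_A,J^+b_A\rangle=\sup_{\varphi\in\Xi_A}\frac{b_A(\varphi)^2}{J(\varphi)}\qquad(0/0=0,\ c/\infty=0).$$ If $J(\varphi)=(\varphi,\mathsf J\varphi)$ for a positive operator $\mathsf J$ on a real Hilbert space with Moore–Penrose inverse $\mathsf J^+$, and $b_A=(g,\cdot)$ with $g\in(\ker\mathsf J)^\perp$, this is $(g,\mathsf J^+g)$. *Error.* A POVM $M$ on a measurable space $\Omega$ has, at $\rho$ and in the direction $\varphi$, the classical Fisher information $$J^M(\varphi)=\int_\Omega\Big(\frac{d\operatorname{Tr}[\varphi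 M(\cdot)]}{d\operatorname{Tr}[\rho M(\cdot)]}\Big)^2d\operatorname{Tr}[\rho M(\cdot)].$$ Let $\varepsilon(A;\rho,M)=\langle b_A,(J^M)^+b_A\rangle-\sigma^2(A)$ if $b_A$ vanishes on $\{\varphi\in\Xi_A:J^M(\varphi)=0\}$, and $+\infty$ otherwise. *Instruments.* A CP-instrument $\mathcal I$ on $(\mathbb R,\mathfrak B(\mathbb R))$ is a countably additive family of completely positive linear maps $\mathcal I(X):\mathcal T(\mathcal H)\to\mathcal T(\mathcal H)$, $X\in\mathfrak B(\mathbb R)$, with $\mathcal I(\mathbb R)$ trace preserving. Let $\varepsilon(A;\rho,\mathcal I)$ be the error of $A$ for the POVM $X\mapsto\mathcal I(X)^*(I)$. Let $\eta(B;\rho,\mathcal I)=\langle b_B,J^+b_B\rangle-\sigma^2(B)$ with $J(\varphi)=J^{\mathrm S}_{\mathcal I(\mathbb R)(\rho)}\big(\mathcal I(\mathbb R)(\varphi)\big)$ if $b_B$ vanishes on $\{\varphi\in\Xi_B:J(\varphi)=0\}$, and $+\infty$ otherwise. **Theorem.** Let $A,B$ be self-adjoint operators on $\mathcal H$ with $\rho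 A,\ \rho B,\ \rho A^2,\ \rho B^2,\ \rho AB\in\mathcal T(\mathcal H)$, and let $\mathcal I$ be a CP-instrument on $(\mathbb R,\mathfrak B(\mathbb R))$. Then there is a POVM $M$ on $(\mathbb R\times\mathbb R,\mathfrak B(\mathbb R)\otimes\mathfrak B(\mathbb R))$ such that $$\varepsilon(A;\rho,\mathcal I)\ \ge\ \varepsilon(A;\rho,M)\qquad\text{and}\qquad \eta(B;\rho,\mathcal I)\ \ge\ \varepsilon(B;\rho,M).$$ -/

import Mathlib

open scoped InnerProductSpace ComplexOrder ENNReal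

namespace QEst

variable {H : Type*} [NormedAddCommGroup H] [InnerProductSpace ℂ H]

/-- `T = ∑ₙ |xₙ⟩⟨yₙ|` with `∑ₙ ‖xₙ‖ ‖yₙ‖ < ∞`. -/
def NuclearRep (T : H →L[ℂ] H) (x y : ℕ → H) : Prop :=
  Summable (fun n => ‖x n‖ * ‖y n‖) ∧ ∀ z, HasSum (fun n => ⟪y n, z⟫_ℂ • x n) (T z)

/-- Trace-class operators, described as the nuclear operators on a Hilbert space. -/
def IsTraceClass (T : H →L[ℂ] H) : Prop := ∃ x y : ℕ → H, NuclearRep T x y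

theorem IsTraceClass.add {S T : H →L[ℂ] H} (hS : IsTraceClass S) (hT : IsTraceClass T) :
    IsTraceClass (S + T) := by
  obtain ⟨x, y, hs, h⟩ := hS
  obtain ⟨x', y', hs', h'⟩ := hT
  refine ⟨fun n => if n % 2 = 0 then x (n / 2) else x' (n / 2),
    fun n => if n % 2 = 0 then y (n / 2) else y' (n / 2), ?_, fun z => ?_⟩
  · refine (HasSum.even_add_odd (m := ∑' n, ‖x n‖ * ‖y n‖) (m' := ∑' n, ‖x' n‖ * ‖y' n‖)
      ?_ ?_).summable
    · convert hs.hasSum using 2 with n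
      simp
    · convert hs'.hasSum using 2 with n
      have h1 : (2 * n + 1) % 2 = 1 := by omega
      have h2 : (2 * n + 1) / 2 = n := by omega
      simp [h1, h2]
  · change HasSum _ (S z + T z)
    refine HasSum.even_add_odd ?_ ?_
    · convert h z using 2 with n
      simp
    · convert h' z using 2 with n
      have h1 : (2 * n + 1) % 2 = 1 := by omega
      have h2 : (2 * n + 1) / 2 = n := by omega
      simp [h1, h2]

theorem NuclearRep.mul_left {T : H →L[ℂ] H} {x y : ℕ → H} (h : NuclearRep T x y)
    (a : H →L[ℂ] H) : NuclearRep (a * T) (fun n => a (x n)) y := by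
  refine ⟨?_, fun z => ?_⟩
  · refine Summable.of_nonneg_of_le (fun n => by positivity) (fun n => ?_) (h.1.mul_left ‖a‖)
    rw [← mul_assoc]
    gcongr
    exact a.le_opNorm _
  · simpa using (h.2 z).mapL a

theorem NuclearRep.mul_right [CompleteSpace H] {T : H →L[ℂ] H} {x y : ℕ → H}
    (h : NuclearRep T x y) (a : H →L[ℂ] H) :
    NuclearRep (T * a) x (fun n => ContinuousLinearMap.adjoint a (y n)) := by
  refine ⟨?_, fun z => ?_⟩
  · refine Summable.of_nonneg_of_le (fun n => by positivity) (fun n => ?_)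
      (h.1.mul_left ‖ContinuousLinearMap.adjoint a‖)
    calc ‖x n‖ * ‖ContinuousLinearMap.adjoint a (y n)‖
        ≤ ‖x n‖ * (‖ContinuousLinearMap.adjoint a‖ * ‖y n‖) := by
          gcongr
          exact ContinuousLinearMap.le_opNorm _ _
      _ = _ := by ring
  · simpa [ContinuousLinearMap.adjoint_inner_left] using h.2 (a z)

theorem IsTraceClass.mul_left {T : H →L[ℂ] H} (h : IsTraceClass T) (a : H →L[ℂ] H) :
    IsTraceClass (a * T) := by
  obtain ⟨x, y, h⟩ := h
  exact ⟨_, _, h.mul_left a⟩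

theorem IsTraceClass.mul_right [CompleteSpace H] {T : H →L[ℂ] H} (h : IsTraceClass T)
    (a : H →L[ℂ] H) : IsTraceClass (T * a) := by
  obtain ⟨x, y, h⟩ := h
  exact ⟨_, _, h.mul_right a⟩

variable (H) in
/-- The space of trace-class operators on `H`. -/
def traceClass : Submodule ℂ (H →L[ℂ] H) where
  carrier := {T | IsTraceClass T}
  add_mem' := IsTraceClass.add
  zero_mem' := ⟨0, 0, by simp, fun z => by simp⟩
  smul_mem' := fun c T hT => by
    have := hT.mul_left (c • (1 : H →L[ℂ] H))
    simpa using this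

theorem rankOne_nuclear (x y : H) :
    NuclearRep (InnerProductSpace.rankOne ℂ x y) (fun n => if n = 0 then x else 0) (fun n => if n = 0 then y else 0) := by
  refine ⟨summable_of_hasFiniteSupport ((Set.finite_singleton 0).subset ?_), fun z => ?_⟩
  · intro n hn
    by_contra h
    have : n ≠ 0 := h
    simp [this] at hn
  · have := hasSum_single (f := fun n : ℕ => ⟪(if n = 0 then y else 0 : H), z⟫_ℂ • (if n = 0 then x else 0 : H)) 0 (by intro n hn; simp [hn])
    simpa using this

/-- The rank-one operator `|x⟩⟨y|`, as a trace-class operator. -/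
noncomputable def ketBra (x y : H) : traceClass H := ⟨InnerProductSpace.rankOne ℂ x y, _, _, rankOne_nuclear x y⟩

variable [CompleteSpace H]

variable (H) in
/-- A fixed orthonormal (Hilbert) basis of `H`. -/
noncomputable def onb : HilbertBasis (exists_hilbertBasis ℂ H).choose ℂ H :=
  (exists_hilbertBasis ℂ H).choose_spec.choose

/-- The trace `∑ᵢ ⟨eᵢ, T eᵢ⟩`. -/
noncomputable def trace (T : H →L[ℂ] H) : ℂ := ∑' i, ⟪onb H i, T (onb H i)⟫_ℂ

theorem NuclearRep.hasSum_prod {T : H →L[ℂ] H} {x y : ℕ → H} (h : NuclearRep T x y) :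
    Summable (fun p : ℕ × _ => ⟪y p.1, onb H p.2⟫_ℂ * ⟪onb H p.2, x p.1⟫_ℂ) := by
  have key : ∀ n (s : Finset _), ∑ i ∈ s, ‖⟪y n, onb H i⟫_ℂ * ⟪onb H i, x n⟫_ℂ‖ ≤ ‖x n‖ * ‖y n‖ := by
    intro n s
    have h1 := (onb H).orthonormal.sum_inner_products_le (x n) (s := s)
    have h2 := (onb H).orthonormal.sum_inner_products_le (y n) (s := s)
    calc ∑ i ∈ s, ‖⟪y n, onb H i⟫_ℂ * ⟪onb H i, x n⟫_ℂ‖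
        = ∑ i ∈ s, ‖⟪onb H i, x n⟫_ℂ‖ * ‖⟪onb H i, y n⟫_ℂ‖ := by
          refine Finset.sum_congr rfl fun i _ => ?_
          rw [norm_mul, mul_comm, norm_inner_symm (y n)]
      _ ≤ √(∑ i ∈ s, ‖⟪onb H i, x n⟫_ℂ‖ ^ 2) * √(∑ i ∈ s, ‖⟪onb H i, y n⟫_ℂ‖ ^ 2) :=
          Real.sum_mul_le_sqrt_mul_sqrt _ _ _
      _ ≤ √(‖x n‖ ^ 2) * √(‖y n‖ ^ 2) := by gcongr
      _ = _ := by simp [Real.sqrt_sq]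
  apply Summable.of_norm
  rw [summable_prod_of_nonneg (fun _ => norm_nonneg _)]
  refine ⟨fun n => summable_of_sum_le (fun _ => norm_nonneg _) (key n), ?_⟩
  refine Summable.of_nonneg_of_le (fun n => tsum_nonneg fun _ => norm_nonneg _) (fun n => ?_) h.1
  exact Real.tsum_le_of_sum_le (fun _ => norm_nonneg _) (key n)

theorem NuclearRep.hasSum_trace {T : H →L[ℂ] H} {x y : ℕ → H} (h : NuclearRep T x y) :
    HasSum (fun n => ⟪y n, x n⟫_ℂ) (trace T) := by
  have h1 := h.hasSum_prod
  have e1 : ∀ n, ∑' i, ⟪y n, onb H i⟫_ℂ * ⟪onb H i, x n⟫_ℂ = ⟪y n, x n⟫_ℂ :=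
    fun n => ((onb H).hasSum_inner_mul_inner (y n) (x n)).tsum_eq
  have e2 : ∀ i, ∑' n, ⟪y n, onb H i⟫_ℂ * ⟪onb H i, x n⟫_ℂ = ⟪onb H i, T (onb H i)⟫_ℂ := by
    intro i
    have := (h.2 (onb H i)).mapL (innerSL ℂ (onb H i))
    simpa [inner_smul_right] using this.tsum_eq
  have e3 : trace T = ∑' n, ⟪y n, x n⟫_ℂ := by
    unfold trace
    simp_rw [← e1, ← e2]
    exact (Summable.tsum_comm (f := fun n i => ⟪y n, onb H i⟫_ℂ * ⟪onb H i, x n⟫_ℂ) h1)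
  rw [e3]
  apply Summable.hasSum
  simpa [e1] using h1.prod

theorem trace_add {S T : H →L[ℂ] H} (hS : IsTraceClass S) (hT : IsTraceClass T) : trace (S + T) = trace S + trace T := by
  have hs : ∀ {R : H →L[ℂ] H}, IsTraceClass R → Summable fun i => ⟪onb H i, R (onb H i)⟫_ℂ := by
    rintro R ⟨x, y, h⟩
    have e2 : ∀ i, ∑' n, ⟪y n, onb H i⟫_ℂ * ⟪onb H i, x n⟫_ℂ = ⟪onb H i, R (onb H i)⟫_ℂ := by
      intro i
      have := (h.2 (onb H i)).mapL (innerSL ℂ (onb H i))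
      simpa [inner_smul_right] using this.tsum_eq
    simpa [e2] using (h.hasSum_prod.prod_symm).prod
  simp only [trace, add_apply, inner_add_right]
  exact (hs hS).tsum_add (hs hT)

theorem trace_smul (c : ℂ) (T : H →L[ℂ] H) : trace (c • T) = c * trace T := by
  simp only [trace, smul_apply, inner_smul_right]
  exact tsum_mul_left

theorem trace_mul_comm {T : H →L[ℂ] H} (hT : IsTraceClass T) (a : H →L[ℂ] H) :
    trace (T * a) = trace (a * T) := by
  obtain ⟨x, y, h⟩ := hT
  refine (h.mul_right a).hasSum_trace.unique ?_
  simpa [ContinuousLinearMap.adjoint_inner_left] using (h.mul_left a).hasSum_trace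

theorem trace_nonneg {T : H →L[ℂ] H} (hT : 0 ≤ T) : 0 ≤ trace T :=
  tsum_nonneg fun _ => ((ContinuousLinearMap.nonneg_iff_isPositive T).1 hT).inner_nonneg_right _

theorem trace_mul_nonneg {T a : H →L[ℂ] H} (hT : IsTraceClass T) (h : 0 ≤ T) (ha : 0 ≤ a) :
    0 ≤ trace (T * a) := by
  have h1 : trace (T * a) = trace (CFC.sqrt a * T * CFC.sqrt a) := by
    rw [trace_mul_comm (hT.mul_left _), ← mul_assoc, CFC.sqrt_mul_sqrt_self a ha, trace_mul_comm hT]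
  rw [h1]
  refine trace_nonneg ?_
  have := star_left_conjugate_nonneg h (CFC.sqrt a)
  rwa [(IsSelfAdjoint.of_nonneg (CFC.sqrt_nonneg a)).star_eq] at this

theorem trace_ketBra (x y : H) : trace (ketBra x y : H →L[ℂ] H) = ⟪y, x⟫_ℂ := by
  have h := (rankOne_nuclear x y).hasSum_trace
  refine h.unique ?_
  have := hasSum_single (f := fun n : ℕ => ⟪(if n = 0 then y else 0 : H), (if n = 0 then x else 0 : H)⟫_ℂ) 0 (by intro n hn; simp [hn])
  simpa using this


/-- A positive operator-valued measure on `Ω`: positive, normalized and countably additive in the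
weak operator topology. Only the values on measurable sets matter. -/
structure POVM (Ω : Type*) [MeasurableSpace Ω] (H : Type*) [NormedAddCommGroup H]
    [InnerProductSpace ℂ H] [CompleteSpace H] where
  toFun : Set Ω → (H →L[ℂ] H)
  nonneg' : ∀ s, MeasurableSet s → 0 ≤ toFun s
  univ' : toFun Set.univ = 1
  iUnion' : ∀ f : ℕ → Set Ω, (∀ i, MeasurableSet (f i)) → Pairwise (Function.onFun Disjoint f) →
    ∀ x y : H, HasSum (fun i => ⟪x, toFun (f i) y⟫_ℂ) ⟪x, toFun (⋃ i, f i) y⟫_ℂ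

section POVM

variable {Ω : Type*} [MeasurableSpace Ω]

theorem POVM.empty (M : POVM Ω H) : M.toFun ∅ = 0 := by
  ext y
  refine ext_inner_left ℂ fun x => ?_
  have h := M.iUnion' (fun _ => ∅) (fun _ => .empty) (fun _ _ _ => by simp [Function.onFun]) x y
  have h1 : Summable fun _ : ℕ => ⟪x, M.toFun ∅ y⟫_ℂ := by simpa using h.summable
  simpa using (summable_const_iff _).1 h1

/-- The sequence `s, sᶜ, ∅, ∅, …`. -/
def splitSeq {Ω : Type*} (s : Set Ω) : ℕ → Set Ω := fun n => if n = 0 then s else if n = 1 then sᶜ else ∅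

theorem splitSeq_measurable {s : Set Ω} (hs : MeasurableSet s) (n : ℕ) :
    MeasurableSet (splitSeq s n) := by
  unfold splitSeq
  split_ifs
  exacts [hs, hs.compl, .empty]

theorem splitSeq_disjoint {Ω : Type*} (s : Set Ω) : Pairwise (Function.onFun Disjoint (splitSeq s)) := by
  intro i j hij
  rw [Function.onFun, Set.disjoint_left]
  intro x hi hj
  unfold splitSeq at hi hj
  split_ifs at hi hj <;> simp_all

theorem splitSeq_iUnion {Ω : Type*} (s : Set Ω) : ⋃ i, splitSeq s i = Set.univ := by
  refine Set.eq_univ_of_forall fun x => Set.mem_iUnion.2 ?_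
  by_cases h : x ∈ s
  · exact ⟨0, by simpa [splitSeq] using h⟩
  · exact ⟨1, by simpa [splitSeq] using h⟩

theorem POVM.sum_inner_le (M : POVM Ω H) {f : ℕ → Set Ω} (hf : ∀ i, MeasurableSet (f i))
    (hd : Pairwise (Function.onFun Disjoint f)) (F : Finset ℕ) (x : H) :
    ∑ i ∈ F, (⟪x, M.toFun (f i) x⟫_ℂ).re ≤ (⟪x, M.toFun (⋃ i, f i) x⟫_ℂ).re := by
  have h := (M.iUnion' f hf hd x x).mapL Complex.reCLM
  exact sum_le_hasSum F (fun i _ => ((ContinuousLinearMap.nonneg_iff_isPositive _).1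
    (M.nonneg' _ (hf i))).re_inner_nonneg_right x) h

theorem POVM.norm_sum_le (M : POVM Ω H) {f : ℕ → Set Ω} (hf : ∀ i, MeasurableSet (f i))
    (hd : Pairwise (Function.onFun Disjoint f)) (F : Finset ℕ) :
    ‖∑ i ∈ F, M.toFun (f i)‖ ≤ 1 := by
  have h0 : 0 ≤ ∑ i ∈ F, M.toFun (f i) := Finset.sum_nonneg fun i _ => M.nonneg' _ (hf i)
  rw [CStarAlgebra.norm_le_one_iff_of_nonneg _ h0, ContinuousLinearMap.le_def,
    ContinuousLinearMap.isPositive_iff_complex]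
  intro x
  have hsa : IsSelfAdjoint (1 - ∑ i ∈ F, M.toFun (f i)) :=
    (IsSelfAdjoint.one _).sub (IsSelfAdjoint.of_nonneg h0)
  have hsym := (ContinuousLinearMap.isSelfAdjoint_iff_isSymmetric.1 hsa)
  refine ⟨?_, ?_⟩
  · simpa using hsym.coe_re_inner_apply_self x
  · have h1 := M.sum_inner_le hf hd F x
    have hU : MeasurableSet (⋃ i, f i) := .iUnion hf
    have h2 := M.sum_inner_le (splitSeq_measurable hU) (splitSeq_disjoint _) {0} x
    rw [splitSeq_iUnion, M.univ'] at h2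
    simp only [Finset.sum_singleton, splitSeq, if_true] at h2
    have h3 : (⟪(1 - ∑ i ∈ F, M.toFun (f i)) x, x⟫_ℂ).re
        = (⟪x, (1 : H →L[ℂ] H) x⟫_ℂ).re - ∑ i ∈ F, (⟪x, M.toFun (f i) x⟫_ℂ).re := by
      have : ⟪(1 - ∑ i ∈ F, M.toFun (f i)) x, x⟫_ℂ = ⟪x, (1 - ∑ i ∈ F, M.toFun (f i)) x⟫_ℂ :=
        hsym x x
      rw [this]
      rw [sub_apply, inner_sub_right, Complex.sub_re, sum_apply, inner_sum, Complex.re_sum]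
    change 0 ≤ (⟪(1 - ∑ i ∈ F, M.toFun (f i)) x, x⟫_ℂ).re
    rw [h3]
    linarith

theorem POVM.hasSum_trace (M : POVM Ω H) {T : H →L[ℂ] H} (hT : IsTraceClass T)
    {f : ℕ → Set Ω} (hf : ∀ i, MeasurableSet (f i))
    (hd : Pairwise (Function.onFun Disjoint f)) :
    HasSum (fun i => trace (T * M.toFun (f i))) (trace (T * M.toFun (⋃ i, f i))) := by
  obtain ⟨x, y, h⟩ := id hT
  have key : ∀ a : H →L[ℂ] H, HasSum (fun n => ⟪y n, a (x n)⟫_ℂ) (trace (T * a)) := by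
    intro a
    rw [trace_mul_comm hT]
    exact (h.mul_left a).hasSum_trace
  have e : ∀ F : Finset ℕ, ∑ i ∈ F, trace (T * M.toFun (f i))
      = ∑' n, ⟪y n, (∑ i ∈ F, M.toFun (f i)) (x n)⟫_ℂ := by
    intro F
    simp only [sum_apply, inner_sum]
    rw [Summable.tsum_finsetSum fun i _ => (key _).summable]
    exact Finset.sum_congr rfl fun i _ => (key _).tsum_eq.symm
  unfold HasSum
  simp only [SummationFilter.unconditional_filter, e]
  rw [← (key _).tsum_eq]
  refine tendsto_tsum_of_dominated_convergence h.1 (fun n => ?_) (.of_forall fun F n => ?_)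
  · have := M.iUnion' f hf hd (y n) (x n)
    simp only [sum_apply, inner_sum]
    exact this
  · calc _ ≤ ‖y n‖ * ‖(∑ i ∈ F, M.toFun (f i)) (x n)‖ := norm_inner_le_norm _ _
      _ ≤ ‖y n‖ * (1 * ‖x n‖) := by
        gcongr
        exact ContinuousLinearMap.le_of_opNorm_le _ (M.norm_sum_le hf hd F) _
      _ = _ := by ring

open Classical in
/-- The signed measure `s ↦ Tr[T M(s)]` for a self-adjoint trace-class operator `T`; it is the
derivative in the direction `T` of the outcome law of `M`. -/
noncomputable def POVM.signedLaw (M : POVM Ω H) (T : traceClass H) :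
    MeasureTheory.SignedMeasure Ω where
  measureOf' s := if MeasurableSet s then (trace ((T : H →L[ℂ] H) * M.toFun s)).re else 0
  empty' := by simp [M.empty, trace]
  not_measurable' := fun _ hs => if_neg hs
  m_iUnion' := fun f hf hd => by
    simp only [hf, MeasurableSet.iUnion hf, if_true]
    exact (M.hasSum_trace T.2 hf hd).mapL Complex.reCLM

end POVM

/-- A density operator `ρ > 0`: a strictly positive trace-class operator of trace one. -/
structure FaithfulState (H : Type*) [NormedAddCommGroup H] [InnerProductSpace ℂ H]
    [CompleteSpace H] where
  op : traceClass H
  nonneg' : 0 ≤ (op : H →L[ℂ] H)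
  pos' : ∀ x : H, x ≠ 0 → 0 < ⟪x, (op : H →L[ℂ] H) x⟫_ℂ
  trace' : trace (op : H →L[ℂ] H) = 1

section Fisher

variable {Ω : Type*} [MeasurableSpace Ω]

/-- The outcome law `s ↦ Tr[ρ M(s)]` of the measurement `M` in the state `ρ`. -/
noncomputable def POVM.law (M : POVM Ω H) (ρ : FaithfulState H) : MeasureTheory.Measure Ω :=
  MeasureTheory.Measure.ofMeasurable
    (fun s _ => ENNReal.ofReal (trace ((ρ.op : H →L[ℂ] H) * M.toFun s)).re)
    (by simp [M.empty, trace])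
    (fun f hf hd => by
      have h := (M.hasSum_trace ρ.op.2 hf hd).mapL Complex.reCLM
      have h0 : ∀ i, 0 ≤ (trace ((ρ.op : H →L[ℂ] H) * M.toFun (f i))).re := fun i =>
        (Complex.nonneg_iff.1 (trace_mul_nonneg ρ.op.2 ρ.nonneg' (M.nonneg' _ (hf i)))).1
      rw [← ENNReal.ofReal_tsum_of_nonneg h0 h.summable]
      exact congrArg ENNReal.ofReal h.tsum_eq.symm)

/-- The classical Fisher information `(φ, J φ) = 𝔼[l(X; φ)²]` of the outcome law of `M` at the
state `ρ` in the direction `φ`; the logarithmic derivative `l(·; φ)` is the Radon-Nikodym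
derivative of `s ↦ Tr[φ M(s)]` with respect to `s ↦ Tr[ρ M(s)]`. -/
noncomputable def fisherInfo (M : POVM Ω H) (ρ : FaithfulState H) (φ : traceClass H) : ℝ≥0∞ :=
  ∫⁻ x, ENNReal.ofReal ((M.signedLaw φ).rnDeriv (M.law ρ) x ^ 2) ∂(M.law ρ)

end Fisher

/-- The squared Hilbert-Schmidt norm. -/
noncomputable def hsNormSq (Y : H →L[ℂ] H) : ℝ≥0∞ := ∑' i, ‖Y (onb H i)‖ₑ ^ 2

/-- `Y = L √σ` for a symmetric logarithmic derivative `L` of `σ` in the direction `τ`. The (possibly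
unbounded) `L` is only relevant on the range of `√σ`: it is symmetric there iff `√σ Y = √σ L √σ` is
self-adjoint, and the equation `½ (L σ + σ L) = τ` reads `½ (Y √σ + √σ Y*) = τ`. -/
def IsSLD (σ τ Y : H →L[ℂ] H) : Prop :=
  IsSelfAdjoint (CFC.sqrt σ * Y) ∧ (2⁻¹ : ℂ) • (Y * CFC.sqrt σ + CFC.sqrt σ * star Y) = τ

/-- The SLD Fisher information `Tr[σ L²] = ‖L √σ‖²_HS` of `σ` in the direction `τ`, infinite if there
is no square-integrable symmetric logarithmic derivative `L`. The infimum only discards the part of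
`L` on the kernel of `σ`, which is not determined by the equation. -/
noncomputable def sldInfo (σ τ : H →L[ℂ] H) : ℝ≥0∞ := ⨅ (Y : H →L[ℂ] H) (_ : IsSLD σ τ Y), hsNormSq Y

/-- `R A ∈ 𝒯(H)`: the operator `R A`, defined on the domain of `A`, is given by a trace-class
operator. -/
def MulMemTraceClass (R : H →L[ℂ] H) (A : H →ₗ.[ℂ] H) : Prop :=
  ∃ T : traceClass H, ∀ x : A.domain, (T : H →L[ℂ] H) x = R (A x)

open Classical in
/-- `Tr[R A]`, for a densely defined operator `A` with `R A ∈ 𝒯(H)`. -/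
noncomputable def expVal (R : H →L[ℂ] H) (A : H →ₗ.[ℂ] H) : ℂ :=
  if h : MulMemTraceClass R A then trace (h.choose : H →L[ℂ] H) else 0

/-- The product `A B` of two unbounded operators, on `{x ∈ dom B | B x ∈ dom A}`. -/
def opMul (A B : H →ₗ.[ℂ] H) : H →ₗ.[ℂ] H where
  domain := (A.domain.comap B.toFun).map B.domain.subtype
  toFun :=
    { toFun := fun x => A ⟨B ⟨x, by obtain ⟨z, -, hz⟩ := x.2; exact hz ▸ z.2⟩, by
        obtain ⟨_, z, hz, rfl⟩ := x
        exact hz⟩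
      map_add' := fun x y => by
        rw [← A.map_add]
        congr 1
        ext
        simp only [Submodule.coe_add]
        rw [← B.map_add]
        rfl
      map_smul' := fun c x => by
        rw [RingHom.id_apply, ← A.map_smul]
        congr 1
        ext
        simp only [Submodule.coe_smul]
        rw [← B.map_smul]
        rfl }

/-- `𝒪_ρ`: the (possibly unbounded) self-adjoint operators with finite expectation value in `ρ`. -/
def IsObservable (ρ : FaithfulState H) (A : H →ₗ.[ℂ] H) : Prop :=
  IsSelfAdjoint A ∧ MulMemTraceClass (ρ.op : H →L[ℂ] H) A

/-- The variance `⟨A²⟩ - ⟨A⟩²`. -/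
noncomputable def variance (ρ : FaithfulState H) (A : H →ₗ.[ℂ] H) : ℝ :=
  (expVal (ρ.op : H →L[ℂ] H) (opMul A A)).re - (expVal (ρ.op : H →L[ℂ] H) A).re ^ 2

/-- The directions in which `⟨A⟩` is differentiated at `ρ`: self-adjoint trace-class operators `φ` of
trace zero for which the symmetric logarithmic derivative of the model exists and is square-integrable
and for which `φ A` is trace-class. If `H` is finite-dimensional, the last two conditions are void. -/
def directions (ρ : FaithfulState H) (A : H →ₗ.[ℂ] H) : Set (traceClass H) :=
  {φ | IsSelfAdjoint (φ : H →L[ℂ] H) ∧ trace (φ : H →L[ℂ] H) = 0 ∧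
    sldInfo (ρ.op : H →L[ℂ] H) φ < ⊤ ∧ MulMemTraceClass (φ : H →L[ℂ] H) A}

/-- The derivative of `⟨A⟩` in the direction `φ`, that is `Tr[φ A]`: the states are parametrized
affinely, by `ρ(θ) = ρ₀ + θ`. -/
noncomputable def expDeriv (A : H →ₗ.[ℂ] H) (φ : traceClass H) : ℝ := (expVal (φ : H →L[ℂ] H) A).re

section InverseForm

/-- For a Fisher information form `J` on the directions `D` and a linear functional `b`, the value
`(∇b, J⁺ ∇b)` of the Moore-Penrose inverse of the form `J`. It does not depend on an inner product on
`D`, so that it also makes sense where `b` has no gradient and `J` is not given by an operator;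
`excessError_eq_moorePenrose` is the comparison with the operator expression. -/
noncomputable def inverseForm {V : Type*} (D : Set V) (J : V → ℝ≥0∞) (b : V → ℝ) : ℝ≥0∞ :=
  ⨆ φ ∈ D, ENNReal.ofReal (b φ ^ 2) / J φ

open Classical in
/-- `(∇b, J⁺ ∇b) - v` if `b` vanishes on the kernel of `J`, and `+∞` otherwise. -/
noncomputable def excessError {V : Type*} (D : Set V) (J : V → ℝ≥0∞) (b : V → ℝ) (v : ℝ) : EReal :=
  if ∀ φ ∈ D, J φ = 0 → b φ = 0 then (inverseForm D J b : EReal) - (v : EReal) else ⊤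

/-- `K` is the Moore-Penrose inverse of `J`. -/
structure IsMoorePenrose {Ξ : Type*} [NormedAddCommGroup Ξ] [InnerProductSpace ℝ Ξ]
    [CompleteSpace Ξ] (J K : Ξ →L[ℝ] Ξ) : Prop where
  mul_mul_self : J * K * J = J
  inv_mul_mul : K * J * K = K
  isSelfAdjoint_mul : IsSelfAdjoint (J * K)
  isSelfAdjoint_inv_mul : IsSelfAdjoint (K * J)

open Classical in
/-- If the form is `φ ↦ (φ, J φ)` for a positive operator `J` on a real Hilbert space that has a
Moore-Penrose inverse `K`, and `b = (g, ·)`, then `excessError` is the expected expression. -/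
theorem excessError_eq_moorePenrose {Ξ : Type*} [NormedAddCommGroup Ξ] [InnerProductSpace ℝ Ξ]
    [CompleteSpace Ξ] {J K : Ξ →L[ℝ] Ξ} (hJ : J.IsPositive) (hK : IsMoorePenrose J K)
    (g : Ξ) (v : ℝ) :
    excessError Set.univ (fun φ => ENNReal.ofReal ⟪φ, J φ⟫_ℝ) (fun φ => ⟪g, φ⟫_ℝ) v =
      if g ∈ (LinearMap.ker (J : Ξ →ₗ[ℝ] Ξ))ᗮ then ((⟪g, K g⟫_ℝ - v : ℝ) : EReal) else ⊤ := by
  have hsym : ∀ x y, ⟪J x, y⟫_ℝ = ⟪x, J y⟫_ℝ := fun x y =>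
    (ContinuousLinearMap.isSelfAdjoint_iff_isSymmetric.1 hJ.isSelfAdjoint) x y
  have hpos : ∀ x, 0 ≤ ⟪x, J x⟫_ℝ := fun x => hJ.inner_nonneg_right x
  have hcs : ∀ x y, ⟪x, J y⟫_ℝ ^ 2 ≤ ⟪x, J x⟫_ℝ * ⟪y, J y⟫_ℝ := by
    intro x y
    have hq : ∀ t : ℝ, 0 ≤ ⟪y, J y⟫_ℝ * (t * t) + 2 * ⟪x, J y⟫_ℝ * t + ⟪x, J x⟫_ℝ := by
      intro t
      have := hpos (x + t • y)
      have h1 : ⟪y, J x⟫_ℝ = ⟪x, J y⟫_ℝ := by rw [← hsym, real_inner_comm]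
      simp only [map_add, map_smul, inner_add_left, inner_add_right, inner_smul_left,
        inner_smul_right, h1] at this
      simp at this
      linarith
    have := discrim_le_zero hq
    unfold discrim at this
    nlinarith
  have hker : ∀ x, ⟪x, J x⟫_ℝ = 0 → J x = 0 := by
    intro x hx
    have := hcs (J x) x
    rw [hx, mul_zero] at this
    have h2 : ⟪J x, J x⟫_ℝ = 0 := by nlinarith [sq_nonneg ⟪J x, J x⟫_ℝ]
    simpa using h2
  have hcond : (∀ φ ∈ (Set.univ : Set Ξ), ENNReal.ofReal ⟪φ, J φ⟫_ℝ = 0 → ⟪g, φ⟫_ℝ = 0) ↔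
      g ∈ (LinearMap.ker (J : Ξ →ₗ[ℝ] Ξ))ᗮ := by
    rw [Submodule.mem_orthogonal]
    constructor
    · intro h u hu
      have hu' : J u = 0 := hu
      rw [real_inner_comm]
      exact h u trivial (by simp [hu'])
    · intro h φ _ hφ
      rw [real_inner_comm]
      exact h φ (hker φ (le_antisymm (ENNReal.ofReal_eq_zero.1 hφ) (hpos φ)))
  unfold excessError
  simp only [hcond]
  split_ifs with hg
  · have hg1 : J (K g) = g := by
      have h1 : g - K (J g) ∈ LinearMap.ker (J : Ξ →ₗ[ℝ] Ξ) := by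
        have := congrArg (fun T : Ξ →L[ℝ] Ξ => T g) hK.mul_mul_self
        simp at this
        simp [this]
      have hKJ : ∀ x y, ⟪K (J x), y⟫_ℝ = ⟪x, K (J y)⟫_ℝ := fun x y =>
        (ContinuousLinearMap.isSelfAdjoint_iff_isSymmetric.1 hK.isSelfAdjoint_inv_mul) x y
      have hJK : ∀ x y, ⟪J (K x), y⟫_ℝ = ⟪x, J (K y)⟫_ℝ := fun x y =>
        (ContinuousLinearMap.isSelfAdjoint_iff_isSymmetric.1 hK.isSelfAdjoint_mul) x y
      have hJJK : ∀ x, J (J (K x)) = J x := by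
        intro x
        refine ext_inner_right ℝ fun y => ?_
        have h3 : J (K (J y)) = J y := by
          simpa using congrArg (fun T : Ξ →L[ℝ] Ξ => T y) hK.mul_mul_self
        rw [hsym, hJK, h3, ← hsym]
      have h2 : g - J (K g) ∈ LinearMap.ker (J : Ξ →ₗ[ℝ] Ξ) := by
        simp [hJJK]
      have h3 := (Submodule.mem_orthogonal _ _).1 hg _ h2
      have h4 : ⟪g - J (K g), J (K g)⟫_ℝ = 0 := by
        rw [← hsym]
        have : J (g - J (K g)) = 0 := h2
        simp [this]
      have h5 : ⟪g - J (K g), g - J (K g)⟫_ℝ = 0 := by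
        rw [inner_sub_right, h3, h4, sub_zero]
      have h6 : g - J (K g) = 0 := by simpa using h5
      exact (sub_eq_zero.1 h6).symm
    have hv : ⟪g, K g⟫_ℝ = ⟪K g, J (K g)⟫_ℝ := by rw [hg1, real_inner_comm]
    have hI : inverseForm Set.univ (fun φ => ENNReal.ofReal ⟪φ, J φ⟫_ℝ) (fun φ => ⟪g, φ⟫_ℝ) =
        ENNReal.ofReal ⟪g, K g⟫_ℝ := by
      unfold inverseForm
      refine le_antisymm (iSup₂_le fun φ _ => ?_) ?_
      · refine ENNReal.div_le_of_le_mul ?_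
        rw [hv, ← ENNReal.ofReal_mul (hpos _)]
        refine ENNReal.ofReal_le_ofReal ?_
        have := hcs (K g) φ
        rw [← hsym (K g) φ, hg1] at this
        rwa [hg1]
      · rcases (hpos (K g)).eq_or_lt with h0 | h0
        · rw [hv, ← h0]
          simp
        · refine le_trans ?_ (le_iSup₂_of_le (K g) trivial le_rfl)
          rw [ENNReal.le_div_iff_mul_le (Or.inl (by simpa using h0)) (Or.inl ENNReal.ofReal_ne_top),
            hv, ← ENNReal.ofReal_mul (hpos _), ← hv, ← sq]
    rw [hI, EReal.coe_sub, EReal.coe_ennreal_ofReal, max_eq_left (hv ▸ hpos _)]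
  · rfl

end InverseForm

/-- The measurement error `ε(A; ρ, M)`. -/
noncomputable def POVM.error {Ω : Type*} [MeasurableSpace Ω] (M : POVM Ω H) (ρ : FaithfulState H)
    (A : H →ₗ.[ℂ] H) : EReal :=
  excessError (directions ρ A) (fisherInfo M ρ) (expDeriv A) (variance ρ A)

/-- The disturbance `η(A; ρ, ℰ)` by a map `ℰ` of states. -/
noncomputable def disturbance (E : traceClass H →ₗ[ℂ] traceClass H) (ρ : FaithfulState H)
    (A : H →ₗ.[ℂ] H) : EReal :=
  excessError (directions ρ A) (fun φ => sldInfo (E ρ.op : H →L[ℂ] H) (E φ)) (expDeriv A)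
    (variance ρ A)

/-- Complete positivity: `ℰ ⊗ id` preserves positivity of `n × n` matrices over `𝒯(H)`. -/
def IsCompletelyPositive (E : traceClass H →ₗ[ℂ] traceClass H) : Prop :=
  ∀ (n : ℕ) (T : Fin n → Fin n → traceClass H),
    (∀ v : Fin n → H, 0 ≤ ∑ i, ∑ j, ⟪v i, (T i j : H →L[ℂ] H) (v j)⟫_ℂ) →
    ∀ v : Fin n → H, 0 ≤ ∑ i, ∑ j, ⟪v i, (E (T i j) : H →L[ℂ] H) (v j)⟫_ℂ

/-- A completely positive instrument on `Ω`: a countably additive family of completely positive maps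
on `𝒯(H)` whose total map is trace preserving. -/
structure CPInstrument (Ω : Type*) [MeasurableSpace Ω] (H : Type*) [NormedAddCommGroup H]
    [InnerProductSpace ℂ H] [CompleteSpace H] where
  toFun : Set Ω → (traceClass H →ₗ[ℂ] traceClass H)
  completelyPositive' : ∀ s, MeasurableSet s → IsCompletelyPositive (toFun s)
  trace_univ' : ∀ T, trace (toFun Set.univ T : H →L[ℂ] H) = trace (T : H →L[ℂ] H)
  iUnion' : ∀ f : ℕ → Set Ω, (∀ i, MeasurableSet (f i)) → Pairwise (Function.onFun Disjoint f) →
    ∀ (T : traceClass H) (a : H →L[ℂ] H),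
      HasSum (fun i => trace (a * (toFun (f i) T : H →L[ℂ] H)))
        (trace (a * (toFun (⋃ i, f i) T : H →L[ℂ] H)))

/-- `b = ℰ^*(a)`: the dual map evaluated at `a`, determined by `Tr[ℰ^*(a) T] = Tr[a ℰ(T)]` for the
rank-one operators `T = |y⟩⟨x|`. -/
def IsDual (E : traceClass H →ₗ[ℂ] traceClass H) (a b : H →L[ℂ] H) : Prop :=
  ∀ x y : H, ⟪x, b y⟫_ℂ = trace (a * (E (ketBra y x) : H →L[ℂ] H))

open Classical in
/-- The dual map `ℰ^*` on bounded operators. -/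
noncomputable def dualMap (E : traceClass H →ₗ[ℂ] traceClass H) (a : H →L[ℂ] H) : H →L[ℂ] H :=
  if h : ∃ b, IsDual E a b then h.choose else 0

namespace CPInstrument

variable {Ω : Type*} [MeasurableSpace Ω] (I : CPInstrument Ω H)

theorem ketBra_nonneg {s : Set Ω} (hs : MeasurableSet s) (x : H) :
    0 ≤ trace (I.toFun s (ketBra x x) : H →L[ℂ] H) := by
  have h := I.completelyPositive' s hs 1 (fun _ _ => ketBra x x) (fun v => by
    simp only [Finset.univ_unique, Finset.sum_singleton]
    change 0 ≤ ⟪v _, InnerProductSpace.rankOne ℂ x x (v _)⟫_ℂ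
    rw [InnerProductSpace.rankOne_apply, inner_smul_right, ← inner_conj_symm x, mul_comm,
      Complex.mul_conj]
    exact_mod_cast Complex.normSq_nonneg _)
  refine tsum_nonneg fun i => ?_
  simpa using h (fun _ => onb H i)

theorem ketBra_le {s : Set Ω} (hs : MeasurableSet s) (x : H) :
    (trace (I.toFun s (ketBra x x) : H →L[ℂ] H)).re ≤ ‖x‖ ^ 2 := by
  have h := (I.iUnion' _ (splitSeq_measurable hs) (splitSeq_disjoint s) (ketBra x x) 1).mapL
    Complex.reCLM
  rw [splitSeq_iUnion, one_mul, I.trace_univ', trace_ketBra] at h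
  have h1 := le_hasSum h 0 (fun j _ => by
    simpa using (Complex.nonneg_iff.1 (I.ketBra_nonneg (splitSeq_measurable hs j) x)).1)
  simpa [splitSeq, inner_self_eq_norm_sq_to_K, ← Complex.ofReal_pow] using h1

theorem exists_dual_one {s : Set Ω} (hs : MeasurableSet s) : ∃ L, IsDual (I.toFun s) 1 L := by
  have add_l : ∀ x x' y : H, ketBra (x + x') y = ketBra x y + ketBra x' y := fun x x' y =>
    Subtype.ext (by simp [ketBra])
  have add_r : ∀ x y y' : H, ketBra x (y + y') = ketBra x y + ketBra x y' := fun x y y' =>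
    Subtype.ext (by simp [ketBra])
  have smul_l : ∀ (c : ℂ) (x y : H), ketBra (c • x) y = c • ketBra x y := fun c x y =>
    Subtype.ext (by simp [ketBra])
  have smul_r : ∀ (c : ℂ) (x y : H), ketBra x (c • y) = (starRingEnd ℂ c) • ketBra x y :=
    fun c x y => Subtype.ext (by simp [ketBra])
  have tr_add : ∀ S T : traceClass H, trace (I.toFun s (S + T) : H →L[ℂ] H) =
      trace (I.toFun s S : H →L[ℂ] H) + trace (I.toFun s T : H →L[ℂ] H) := fun S T => by
    rw [map_add]
    exact trace_add (I.toFun s S).2 (I.toFun s T).2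
  have tr_smul : ∀ (c : ℂ) (S : traceClass H), trace (I.toFun s (c • S) : H →L[ℂ] H) =
      c * trace (I.toFun s S : H →L[ℂ] H) := fun c S => by
    rw [map_smul]
    exact trace_smul c _
  let f : H →ₗ⋆[ℂ] H →ₗ[ℂ] ℂ := LinearMap.mk₂'ₛₗ (starRingEnd ℂ) (RingHom.id ℂ)
    (fun x y => trace (I.toFun s (ketBra y x) : H →L[ℂ] H))
    (fun x x' y => by rw [add_r, tr_add])
    (fun c x y => by rw [smul_r, tr_smul]; rfl)
    (fun x y y' => by rw [add_l, tr_add])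
    (fun c x y => by rw [smul_l, tr_smul]; rfl)
  have hq : ∀ x, ‖f x x‖ ≤ ‖x‖ ^ 2 := by
    intro x
    have h0 : 0 ≤ f x x := I.ketBra_nonneg hs x
    have h1 : (f x x).re ≤ ‖x‖ ^ 2 := I.ketBra_le hs x
    have h2 : ‖f x x‖ = (f x x).re := by
      have := Complex.eq_re_of_ofReal_le (r := 0) (by simpa using h0)
      rw [this, Complex.norm_real, Complex.ofReal_re, Real.norm_of_nonneg (Complex.nonneg_iff.1 h0).1]
    rwa [h2]
  have hpol : ∀ x y, 4 * f x y = f (x + y) (x + y) - f (x - y) (x - y)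
      - Complex.I * (f (x + Complex.I • y) (x + Complex.I • y)
        - f (x - Complex.I • y) (x - Complex.I • y)) := by
    intro x y
    simp only [map_add, map_sub, LinearMap.add_apply, LinearMap.sub_apply, map_smul,
      LinearMap.map_smulₛₗ, LinearMap.smul_apply, smul_eq_mul, Complex.conj_I]
    linear_combination (2 * f x y - 2 * f y x) * Complex.I_sq
  have hb : ∀ x y, ‖x‖ ≤ 1 → ‖y‖ ≤ 1 → ‖f x y‖ ≤ 4 := by
    intro x y hx hy
    have hn : ∀ z : H, ‖z‖ ≤ 2 → ‖f z z‖ ≤ 4 := fun z hz => (hq z).trans (by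
      nlinarith [norm_nonneg z])
    have hI : ‖Complex.I • y‖ ≤ 1 := by simpa [norm_smul] using hy
    have h1 := hn (x + y) ((norm_add_le _ _).trans (by linarith))
    have h2 := hn (x - y) ((norm_sub_le _ _).trans (by linarith))
    have h3 := hn (x + Complex.I • y) ((norm_add_le _ _).trans (by linarith))
    have h4 := hn (x - Complex.I • y) ((norm_sub_le _ _).trans (by linarith))
    have h5 : ‖4 * f x y‖ ≤ 16 := by
      rw [hpol]
      refine (norm_sub_le _ _).trans ?_
      rw [norm_mul, Complex.norm_I, one_mul]
      have h6 := norm_sub_le (f (x + y) (x + y)) (f (x - y) (x - y))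
      have h7 := norm_sub_le (f (x + Complex.I • y) (x + Complex.I • y))
        (f (x - Complex.I • y) (x - Complex.I • y))
      linarith
    rw [norm_mul] at h5
    norm_num at h5
    linarith
  have hC : ∀ x y, ‖f x y‖ ≤ 4 * ‖x‖ * ‖y‖ := by
    intro x y
    rcases eq_or_ne x 0 with rfl | hx
    · simp
    rcases eq_or_ne y 0 with rfl | hy
    · simp
    have hx' : (0 : ℝ) < ‖x‖ := norm_pos_iff.2 hx
    have hy' : (0 : ℝ) < ‖y‖ := norm_pos_iff.2 hy
    have h := hb (((‖x‖⁻¹ : ℝ) : ℂ) • x) (((‖y‖⁻¹ : ℝ) : ℂ) • y)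
      (by simp [norm_smul, hx]) (by simp [norm_smul, hy])
    simp only [LinearMap.map_smulₛₗ, LinearMap.smul_apply, map_smul, norm_smul] at h
    simp at h
    rw [inv_mul_le_iff₀ hy', inv_mul_le_iff₀ hx'] at h
    linarith
  refine ⟨ContinuousLinearMap.adjoint
    (InnerProductSpace.continuousLinearMapOfBilin (f.mkContinuous₂ 4 hC)), fun x y => ?_⟩
  rw [ContinuousLinearMap.adjoint_inner_right,
    InnerProductSpace.continuousLinearMapOfBilin_apply, one_mul]
  rfl

theorem isDual_dualMap {s : Set Ω} (hs : MeasurableSet s) :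
    IsDual (I.toFun s) 1 (dualMap (I.toFun s) 1) := by
  unfold dualMap
  rw [dif_pos (I.exists_dual_one hs)]
  exact (I.exists_dual_one hs).choose_spec

/-- The POVM `s ↦ ℐ(s)^*(1)` induced by the instrument. -/
noncomputable def inducedPOVM : POVM Ω H where
  toFun s := dualMap (I.toFun s) 1
  nonneg' s hs := by
    rw [ContinuousLinearMap.nonneg_iff_isPositive, ContinuousLinearMap.isPositive_iff_complex]
    intro x
    have h1 := I.isDual_dualMap hs x x
    rw [one_mul] at h1
    have h2 := I.ketBra_nonneg hs x
    rw [← h1] at h2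
    have h3 := Complex.nonneg_iff.1 h2
    have h4 : ⟪dualMap (I.toFun s) 1 x, x⟫_ℂ = ⟪x, dualMap (I.toFun s) 1 x⟫_ℂ := by
      rw [← inner_conj_symm, Complex.conj_eq_iff_im.2 h3.2.symm]
    rw [h4]
    exact ⟨Complex.ext (by simp) (by simpa using h3.2), h3.1⟩
  univ' := by
    ext y
    refine ext_inner_left ℂ fun x => ?_
    rw [I.isDual_dualMap .univ x y, one_mul, I.trace_univ', trace_ketBra]
    rfl
  iUnion' f hf hd x y := by
    simp only [I.isDual_dualMap (hf _) x y, I.isDual_dualMap (.iUnion hf) x y]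
    exact I.iUnion' f hf hd _ 1

/-- The measurement error `ε(A; ρ, ℐ)`. -/
noncomputable def error (ρ : FaithfulState H) (A : H →ₗ.[ℂ] H) : EReal := I.inducedPOVM.error ρ A

/-- The disturbance `η(A; ρ, ℐ)`, caused by the average evolution `ℐ(Ω)`. -/
noncomputable def disturbance (ρ : FaithfulState H) (A : H →ₗ.[ℂ] H) : EReal :=
  QEst.disturbance (I.toFun Set.univ) ρ A

end CPInstrument

end QEst

/-! The POVM `M` is, up to a limit, the instrument followed by a measurement of its output that is
optimal for `b_B`. The first marginal of `M` is the POVM of the instrument, so the inequality for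
`A` is data processing: forgetting the second outcome cannot raise the classical Fisher information
(`fisherInfo_le_of_preimage`).

For `B`, let ℰ = ℐ(ℝ), σ = ℰ(ρ), J the output SLD information and c₀ = sup b²/J. Complete positivity
(in fact 2-positivity, `IsCompletelyPositive.sq_re_trace_le`) gives each direction φ a
Hilbert-Schmidt vector Z_φ in the closure U of {X√σ : X bounded self-adjoint} with (Z_φ, X√σ) = Re
Tr[X ℰ(φ)]. It stands for L√σ, and J(φ) ≤ ‖Z_φ‖² (`sldInfo_le_of_riesz`). Hence |b(φ)| ≤ √c₀ ‖Z_φ‖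
when c₀ is finite, and Riesz yields Z₀ in U with (Z₀, Z_φ) = b(φ) and ‖Z₀‖² ≤ c₀. The vector Z₀ is
X√σ for an ideal estimator X that need not exist as a self-adjoint operator. Approximating Z₀ in U
gives bounded Xₙ with Re Tr[Xₙ ℰ(φ)] → b(φ) and Tr[Xₙ σ Xₙ] → c = ‖Z₀‖²
(`exists_tendsto_of_inverseForm_ne_top`). Each Xₙ is the mean of a finitely valued observable with
almost the same second moment (`exists_finiteObservable`).

Bounded second moments make the joint laws of the two outcomes tight in ρ and, ρ being faithful, in
every positive trace-class operator. An ultrafilter limit of these laws comes from a POVM with the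
same first marginal (`CPInstrument.exists_limit_povm`). The means in the direction φ survive the
limit although the second outcome is unbounded: Tr[a ℰ(φ)]² ≤ Tr[a ℰ(YY*)] Tr[a ℰ(ρ)], where Y is an
SLD at ρ, controls truncation uniformly in n. The classical Cauchy-Schwarz inequality then gives
b(φ)² ≤ c J^M(φ) (`CPInstrument.ofReal_sq_le_mul_fisherInfo`), so sup b²/J^M ≤ c ≤ c₀; the same
variance is subtracted on both sides. If c₀ = ∞ or the kernel condition fails, the disturbance is +∞
and only the first marginal matters. -/

namespace QEst

/-! ### Trace-class and Hilbert-Schmidt operators -/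

section TraceClass

variable {H : Type*} [NormedAddCommGroup H] [InnerProductSpace ℂ H]

/-- Nuclear representations are indexed by `ℕ`; a countable family is transported along an injection
and padded with zeros. The index set of interest is that of the orthonormal basis. -/
theorem isTraceClass_of_hasSum {ι : Type*} [Countable ι] {T : H →L[ℂ] H} {v w : ι → H}
    (hs : Summable fun i => ‖v i‖ * ‖w i‖) (h : ∀ z, HasSum (fun i => ⟪w i, z⟫_ℂ • v i) (T z)) :
    IsTraceClass T := by
  obtain ⟨e, he⟩ := exists_injective_nat ι
  refine ⟨Function.extend e v 0, Function.extend e w 0, ?_, fun z => ?_⟩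
  · rw [← he.summable_iff]
    · simpa [Function.comp_def, he.extend_apply] using hs
    · intro n hn
      simp [Function.extend_apply' _ _ _ (by simpa using hn)]
  · rw [← he.hasSum_iff]
    · simpa [Function.comp_def, he.extend_apply] using h z
    · intro n hn
      simp [Function.extend_apply' _ _ _ (by simpa using hn)]

theorem re_inner_rankOne (x y : H) :
    (⟪y, (InnerProductSpace.rankOne ℂ x x : H →L[ℂ] H) y⟫_ℂ).re = ‖⟪x, y⟫_ℂ‖ ^ 2 := by
  rw [InnerProductSpace.rankOne_apply, inner_smul_right, ← inner_conj_symm y, Complex.mul_conj,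
    Complex.normSq_eq_norm_sq, Complex.ofReal_re]

variable [CompleteSpace H]

theorem IsTraceClass.summable_inner {T : H →L[ℂ] H} (hT : IsTraceClass T) :
    Summable fun i => ⟪onb H i, T (onb H i)⟫_ℂ := by
  obtain ⟨x, y, h⟩ := hT
  have e2 : ∀ i, ∑' n, ⟪y n, onb H i⟫_ℂ * ⟪onb H i, x n⟫_ℂ = ⟪onb H i, T (onb H i)⟫_ℂ := by
    intro i
    have := (h.2 (onb H i)).mapL (innerSL ℂ (onb H i))
    simpa [inner_smul_right] using this.tsum_eq
  simpa [e2] using (h.hasSum_prod.prod_symm).prod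

theorem IsTraceClass.hasSum_inner {T : H →L[ℂ] H} (hT : IsTraceClass T) :
    HasSum (fun i => ⟪onb H i, T (onb H i)⟫_ℂ) (trace T) :=
  hT.summable_inner.hasSum

theorem IsTraceClass.hasSum_re_inner {T : H →L[ℂ] H} (hT : IsTraceClass T) :
    HasSum (fun i => (⟪onb H i, T (onb H i)⟫_ℂ).re) (trace T).re :=
  hT.hasSum_inner.mapL Complex.reCLM

/-- Orthonormal vectors are √2 apart, so the balls of radius 1/2 around them are disjoint.
Separability of `H` enters the proof through this instance. -/
instance countable_onb [TopologicalSpace.SeparableSpace H] :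
    Countable (exists_hilbertBasis ℂ H).choose := by
  have hd : Pairwise fun i j => 1 ≤ dist (onb H i) (onb H j) := by
    intro i j hij
    have h1 : ⟪onb H i, onb H j⟫_ℂ = 0 := (onb H).orthonormal.2 hij
    have h2 := norm_sub_sq (𝕜 := ℂ) (onb H i) (onb H j)
    rw [h1, (onb H).orthonormal.1, (onb H).orthonormal.1] at h2
    rw [dist_eq_norm]
    simp at h2
    nlinarith [norm_nonneg (onb H i - onb H j)]
  have : (Set.univ : Set (exists_hilbertBasis ℂ H).choose).Countable := by
    refine Set.PairwiseDisjoint.countable_of_isOpen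
      (s := fun i => Metric.ball (onb H i) (1 / 2)) ?_ (fun i _ => Metric.isOpen_ball)
      (fun i _ => ⟨onb H i, Metric.mem_ball_self (by norm_num)⟩)
    intro i _ j _ hij
    refine Metric.ball_disjoint_ball ?_
    have := hd hij
    linarith
  exact Set.countable_univ_iff.1 this

theorem hsNormSq_ne_top_iff {Z : H →L[ℂ] H} :
    hsNormSq Z ≠ ⊤ ↔ Summable fun i => ‖Z (onb H i)‖ ^ 2 := by
  unfold hsNormSq
  have : ∀ i, ‖Z (onb H i)‖ₑ ^ 2 = ((‖Z (onb H i)‖₊ ^ 2 : NNReal) : ℝ≥0∞) := fun i => by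
    simp [enorm_eq_nnnorm]
  simp_rw [this]
  rw [ENNReal.tsum_coe_ne_top_iff_summable, ← NNReal.summable_coe]
  simp

theorem hsNormSq_eq_ofReal {Z : H →L[ℂ] H} (hZ : hsNormSq Z ≠ ⊤) :
    hsNormSq Z = ENNReal.ofReal (∑' i, ‖Z (onb H i)‖ ^ 2) := by
  rw [ENNReal.ofReal_tsum_of_nonneg (fun _ => by positivity) (hsNormSq_ne_top_iff.1 hZ)]
  refine tsum_congr fun i => ?_
  rw [ENNReal.ofReal_pow (norm_nonneg _), ofReal_norm]

theorem enorm_sq_eq_tsum (x : H) : ‖x‖ₑ ^ 2 = ∑' i, ‖⟪onb H i, x⟫_ℂ‖ₑ ^ 2 := by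
  have h := ((onb H).hasSum_inner_mul_inner x x).mapL Complex.reCLM
  have h1 : ∀ i, Complex.reCLM (⟪x, onb H i⟫_ℂ * ⟪onb H i, x⟫_ℂ) = ‖⟪onb H i, x⟫_ℂ‖ ^ 2 := by
    intro i
    rw [← inner_conj_symm, mul_comm, Complex.mul_conj, Complex.normSq_eq_norm_sq]
    exact Complex.ofReal_re _
  simp_rw [h1] at h
  have h2 : Complex.reCLM ⟪x, x⟫_ℂ = ‖x‖ ^ 2 := by
    rw [inner_self_eq_norm_sq_to_K]
    simp [← Complex.ofReal_pow]
  rw [h2] at h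
  have h3 : ‖x‖ₑ ^ 2 = ENNReal.ofReal (‖x‖ ^ 2) := by
    rw [ENNReal.ofReal_pow (norm_nonneg _), ofReal_norm]
  rw [h3, ← h.tsum_eq, ENNReal.ofReal_tsum_of_nonneg (fun _ => by positivity) h.summable]
  refine tsum_congr fun i => ?_
  rw [ENNReal.ofReal_pow (norm_nonneg _), ofReal_norm]

/-- By Parseval, both sides are the double sum of |⟨eⱼ, Z eᵢ⟩|², summed in different orders. -/
theorem hsNormSq_star (Z : H →L[ℂ] H) : hsNormSq (star Z) = hsNormSq Z := by
  unfold hsNormSq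
  rw [tsum_congr fun i => enorm_sq_eq_tsum (star Z (onb H i)),
    tsum_congr fun i => enorm_sq_eq_tsum (Z (onb H i)), ENNReal.tsum_comm]
  refine tsum_congr fun i => tsum_congr fun j => ?_
  rw [ContinuousLinearMap.star_eq_adjoint, ContinuousLinearMap.adjoint_inner_right,
    ← inner_conj_symm, enorm_eq_nnnorm, enorm_eq_nnnorm, RCLike.nnnorm_conj]

/-- Expanding W*z in the basis gives Z W* = ∑ |Z eᵢ⟩⟨W eᵢ|, which is nuclear because ‖Z eᵢ‖ ‖W eᵢ‖ ≤
‖Z eᵢ‖² + ‖W eᵢ‖². -/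
theorem isTraceClass_mul_star [TopologicalSpace.SeparableSpace H] {Z W : H →L[ℂ] H}
    (hZ : hsNormSq Z ≠ ⊤) (hW : hsNormSq W ≠ ⊤) : IsTraceClass (Z * star W) := by
  rw [hsNormSq_ne_top_iff] at hZ hW
  refine isTraceClass_of_hasSum (v := fun i => Z (onb H i)) (w := fun i => W (onb H i)) ?_ ?_
  · refine Summable.of_nonneg_of_le (fun i => by positivity) (fun i => ?_) (hZ.add hW)
    nlinarith [sq_nonneg (‖Z (onb H i)‖ - ‖W (onb H i)‖), sq_nonneg ‖Z (onb H i)‖,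
      sq_nonneg ‖W (onb H i)‖]
  · intro z
    have h := ((onb H).hasSum_repr (star W z)).mapL Z
    simpa [HilbertBasis.repr_apply_apply, ContinuousLinearMap.star_eq_adjoint,
      ContinuousLinearMap.adjoint_inner_right] using h

theorem hsNormSq_mul_left (a : H →L[ℂ] H) {Z : H →L[ℂ] H} (hZ : hsNormSq Z ≠ ⊤) :
    hsNormSq (a * Z) ≠ ⊤ := by
  rw [hsNormSq_ne_top_iff] at hZ ⊢
  refine Summable.of_nonneg_of_le (fun i => by positivity) (fun i => ?_) (hZ.mul_left (‖a‖ ^ 2))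
  rw [← mul_pow]
  gcongr
  exact a.le_opNorm _

theorem hsNormSq_add {Z W : H →L[ℂ] H} (hZ : hsNormSq Z ≠ ⊤) (hW : hsNormSq W ≠ ⊤) :
    hsNormSq (Z + W) ≠ ⊤ := by
  rw [hsNormSq_ne_top_iff] at hZ hW ⊢
  refine Summable.of_nonneg_of_le (fun i => by positivity) (fun i => ?_)
    ((hZ.mul_left 2).add (hW.mul_left 2))
  have := norm_add_le (Z (onb H i)) (W (onb H i))
  rw [add_apply]
  nlinarith [sq_nonneg (‖Z (onb H i)‖ - ‖W (onb H i)‖), norm_nonneg (Z (onb H i) + W (onb H i))]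

theorem hsNormSq_smul (c : ℂ) {Z : H →L[ℂ] H} (hZ : hsNormSq Z ≠ ⊤) : hsNormSq (c • Z) ≠ ⊤ := by
  simpa using hsNormSq_mul_left (c • (1 : H →L[ℂ] H)) hZ

/-- `‖Z‖²_HS = Tr[Z Z*]`. -/
theorem tsum_norm_sq_eq_trace {Z : H →L[ℂ] H} (hZ : hsNormSq Z ≠ ⊤) :
    ∑' i, ‖Z (onb H i)‖ ^ 2 = (trace (Z * star Z)).re := by
  have hZ' : hsNormSq (star Z) ≠ ⊤ := by rwa [hsNormSq_star]
  have h1 : ∑' i, ‖Z (onb H i)‖ ^ 2 = ∑' i, ‖star Z (onb H i)‖ ^ 2 := by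
    have := hsNormSq_star Z
    rw [hsNormSq_eq_ofReal hZ, hsNormSq_eq_ofReal hZ',
      ENNReal.ofReal_eq_ofReal_iff (tsum_nonneg fun _ => by positivity)
        (tsum_nonneg fun _ => by positivity)] at this
    exact this.symm
  have h2 : ∀ i, ⟪onb H i, (Z * star Z) (onb H i)⟫_ℂ = ((‖star Z (onb H i)‖ ^ 2 : ℝ) : ℂ) := by
    intro i
    rw [mul_apply_eq_comp, ← ContinuousLinearMap.adjoint_inner_left,
      ← ContinuousLinearMap.star_eq_adjoint, inner_self_eq_norm_sq_to_K]
    simp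
  rw [h1, trace]
  simp_rw [h2]
  rw [← Complex.ofReal_tsum, Complex.ofReal_re]

theorem sqrt_mul_sqrt_apply {T : H →L[ℂ] H} (hT : 0 ≤ T) (x : H) :
    CFC.sqrt T (CFC.sqrt T x) = T x :=
  congrArg (fun a : H →L[ℂ] H => a x) (CFC.sqrt_mul_sqrt_self T hT)

theorem star_sqrt (T : H →L[ℂ] H) : star (CFC.sqrt T) = CFC.sqrt T :=
  (IsSelfAdjoint.of_nonneg (CFC.sqrt_nonneg T)).star_eq

theorem inner_sqrt_left (T : H →L[ℂ] H) (x y : H) :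
    ⟪CFC.sqrt T x, y⟫_ℂ = ⟪x, CFC.sqrt T y⟫_ℂ := by
  conv_lhs => rw [← star_sqrt, ContinuousLinearMap.star_eq_adjoint]
  rw [ContinuousLinearMap.adjoint_inner_left]

theorem norm_sqrt_sq {T : H →L[ℂ] H} (hT : 0 ≤ T) (x : H) :
    ‖CFC.sqrt T x‖ ^ 2 = (⟪x, T x⟫_ℂ).re := by
  rw [← sqrt_mul_sqrt_apply hT x, ← inner_sqrt_left, inner_self_eq_norm_sq_to_K]
  simp [← Complex.ofReal_pow]

theorem IsTraceClass.hasSum_norm_sqrt {T : H →L[ℂ] H} (h : IsTraceClass T) (hT : 0 ≤ T) :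
    HasSum (fun i => ‖CFC.sqrt T (onb H i)‖ ^ 2) (trace T).re := by
  simpa [norm_sqrt_sq hT] using h.hasSum_re_inner

theorem IsTraceClass.hsNormSq_sqrt {T : H →L[ℂ] H} (h : IsTraceClass T) (hT : 0 ≤ T) :
    hsNormSq (CFC.sqrt T) ≠ ⊤ :=
  hsNormSq_ne_top_iff.2 (h.hasSum_norm_sqrt hT).summable

theorem nonneg_iff_re_inner {T : H →L[ℂ] H} :
    0 ≤ T ↔ IsSelfAdjoint T ∧ ∀ x, 0 ≤ (⟪x, T x⟫_ℂ).re := by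
  rw [ContinuousLinearMap.nonneg_iff_isPositive, ContinuousLinearMap.isPositive_def']
  refine and_congr_right fun h => forall_congr' fun x => ?_
  rw [ContinuousLinearMap.reApplyInnerSelf_apply, inner_re_symm]
  rfl

theorem isSelfAdjoint_rankOne (x : H) :
    IsSelfAdjoint (InnerProductSpace.rankOne ℂ x x : H →L[ℂ] H) := by
  rw [ContinuousLinearMap.isSelfAdjoint_iff_isSymmetric]
  intro y z
  simp [inner_smul_left, inner_smul_right, mul_comm]

theorem ketBra_self_nonneg (x : H) : 0 ≤ (ketBra x x : H →L[ℂ] H) :=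
  nonneg_iff_re_inner.2 ⟨isSelfAdjoint_rankOne x, fun y => by
    change 0 ≤ (⟪y, (InnerProductSpace.rankOne ℂ x x : H →L[ℂ] H) y⟫_ℂ).re
    rw [re_inner_rankOne]
    positivity⟩

theorem trace_sub {S T : H →L[ℂ] H} (hS : IsTraceClass S) (hT : IsTraceClass T) :
    trace (S - T) = trace S - trace T := by
  have h1 : IsTraceClass ((-1 : ℂ) • T) := (traceClass H).smul_mem _ hT
  have h := trace_add hS h1
  rw [trace_smul] at h
  rw [sub_eq_add_neg, ← neg_one_smul ℂ T, h]
  ring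

theorem trace_sum {ι : Type*} (s : Finset ι) {f : ι → H →L[ℂ] H} (hf : ∀ i ∈ s, IsTraceClass (f i)) :
    trace (∑ i ∈ s, f i) = ∑ i ∈ s, trace (f i) := by
  classical
  induction s using Finset.induction_on with
  | empty => simp [trace]
  | insert a s ha ih =>
    rw [Finset.sum_insert ha, Finset.sum_insert ha, trace_add (hf a (Finset.mem_insert_self a s)),
      ih fun i hi => hf i (Finset.mem_insert_of_mem hi)]
    exact (traceClass H).sum_mem fun i hi => hf i (Finset.mem_insert_of_mem hi)

/-- The Bessel inequality for the square root: `∑_{i ∈ F} |√T eᵢ⟩⟨√T eᵢ| ≤ T`. -/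
theorem sum_ketBra_sqrt_le {T : H →L[ℂ] H} (hT : 0 ≤ T) (F : Finset (exists_hilbertBasis ℂ H).choose) :
    ((∑ i ∈ F, ketBra (CFC.sqrt T (onb H i)) (CFC.sqrt T (onb H i)) : traceClass H) : H →L[ℂ] H)
      ≤ T := by
  rw [← sub_nonneg, nonneg_iff_re_inner]
  have hc : ((∑ i ∈ F, ketBra (CFC.sqrt T (onb H i)) (CFC.sqrt T (onb H i)) : traceClass H) :
      H →L[ℂ] H) = ∑ i ∈ F, InnerProductSpace.rankOne ℂ (CFC.sqrt T (onb H i))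
        (CFC.sqrt T (onb H i)) := by
    rw [Submodule.coe_sum]
    rfl
  rw [hc]
  refine ⟨(IsSelfAdjoint.of_nonneg hT).sub (isSelfAdjoint_sum F fun i _ => isSelfAdjoint_rankOne _),
    fun x => ?_⟩
  rw [sub_apply, inner_sub_right, Complex.sub_re, ← norm_sqrt_sq hT, sum_apply, inner_sum,
    Complex.re_sum, sub_nonneg]
  simp_rw [re_inner_rankOne, inner_sqrt_left]
  exact (onb H).orthonormal.sum_inner_products_le _

end TraceClass

/-! ### Functionals on positive trace-class operators, and domination by a faithful state -/

section Effect

variable {H : Type*} [NormedAddCommGroup H] [InnerProductSpace ℂ H]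

theorem ketBra_smul_smul (c : ℂ) (x : H) :
    ketBra (c • x) (c • x) = ((‖c‖ ^ 2 : ℝ) : ℂ) • ketBra x x := by
  refine Subtype.ext ?_
  simp only [ketBra, map_smul, Submodule.coe_smul, smul_apply, map_smulₛₗ]
  rw [smul_smul, Complex.conj_mul', Complex.ofReal_pow]

/-- Every term carries a plus sign, so that a functional which is additive only on positive
operators can be applied to both sides. -/
theorem ketBra_polar (x y z : H) :
    ketBra (x + y + z) (x + y + z) + (ketBra x x + ketBra y y + ketBra z z) =
      ketBra (x + y) (x + y) + (ketBra (y + z) (y + z) + ketBra (x + z) (x + z)) := by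
  refine Subtype.ext ?_
  simp only [ketBra, map_add, Submodule.coe_add, add_apply]
  abel

variable [CompleteSpace H]

/-- A functional on the positive cone of `𝒯(H)` that is additive, positively homogeneous and lies
between `0` and the trace. -/
structure IsEffect (p : traceClass H → ℝ) : Prop where
  add : ∀ S T : traceClass H, 0 ≤ (S : H →L[ℂ] H) → 0 ≤ (T : H →L[ℂ] H) → p (S + T) = p S + p T
  smul : ∀ (c : ℝ) (T : traceClass H), 0 ≤ c → 0 ≤ (T : H →L[ℂ] H) → p ((c : ℂ) • T) = c * p T
  nonneg : ∀ T : traceClass H, 0 ≤ (T : H →L[ℂ] H) → 0 ≤ p T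
  le_trace : ∀ T : traceClass H, 0 ≤ (T : H →L[ℂ] H) → p T ≤ (trace (T : H →L[ℂ] H)).re

theorem smul_ofReal_nonneg {c : ℝ} (hc : 0 ≤ c) {T : H →L[ℂ] H} (hT : 0 ≤ T) :
    0 ≤ (c : ℂ) • T := by
  rw [nonneg_iff_re_inner] at hT ⊢
  refine ⟨by simpa using (IsSelfAdjoint.all c).smul hT.1, fun x => ?_⟩
  rw [smul_apply, inner_smul_right, Complex.re_ofReal_mul]
  exact mul_nonneg hc (hT.2 x)

namespace IsEffect

variable {p : traceClass H → ℝ}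

theorem mono (hp : IsEffect p) {S T : traceClass H} (hS : 0 ≤ (S : H →L[ℂ] H))
    (h : (S : H →L[ℂ] H) ≤ T) : p S ≤ p T := by
  have h1 : 0 ≤ ((T - S : traceClass H) : H →L[ℂ] H) := sub_nonneg.2 h
  have h2 := hp.add S (T - S) hS h1
  rw [add_sub_cancel] at h2
  linarith [hp.nonneg _ h1]

theorem zero (hp : IsEffect p) : p 0 = 0 := by
  have := hp.add 0 0 le_rfl le_rfl
  simpa using this

theorem sum (hp : IsEffect p) {ι : Type*} (s : Finset ι) (f : ι → traceClass H)
    (hf : ∀ i, 0 ≤ (f i : H →L[ℂ] H)) : p (∑ i ∈ s, f i) = ∑ i ∈ s, p (f i) := by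
  classical
  induction s using Finset.induction_on with
  | empty => simpa using hp.zero
  | insert a s ha ih =>
    rw [Finset.sum_insert ha, Finset.sum_insert ha, hp.add _ _ (hf a), ih]
    rw [Submodule.coe_sum]
    exact Finset.sum_nonneg fun i _ => hf i

/-- By the Bessel inequality the remainder of `T` after finitely many terms |√T eᵢ⟩⟨√T eᵢ| is
positive, so `p` of it lies between 0 and its trace. The bound does not depend on `p`, which gives
uniformity in `IsEffect.tendsto_zero`. -/
theorem sub_sum_le (hp : IsEffect p) {T : traceClass H} (hT : 0 ≤ (T : H →L[ℂ] H))
    (F : Finset (exists_hilbertBasis ℂ H).choose) :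
    0 ≤ p T - ∑ i ∈ F, p (ketBra (CFC.sqrt (T : H →L[ℂ] H) (onb H i))
        (CFC.sqrt (T : H →L[ℂ] H) (onb H i))) ∧
      p T - ∑ i ∈ F, p (ketBra (CFC.sqrt (T : H →L[ℂ] H) (onb H i))
        (CFC.sqrt (T : H →L[ℂ] H) (onb H i))) ≤ (trace (T : H →L[ℂ] H)).re -
        ∑ i ∈ F, ‖CFC.sqrt (T : H →L[ℂ] H) (onb H i)‖ ^ 2 := by
  set v := fun i => CFC.sqrt (T : H →L[ℂ] H) (onb H i)
  set S : traceClass H := ∑ i ∈ F, ketBra (v i) (v i) with hS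
  have hS0 : 0 ≤ (S : H →L[ℂ] H) := by
    rw [hS, Submodule.coe_sum]
    exact Finset.sum_nonneg fun i _ => ketBra_self_nonneg _
  have hle : (S : H →L[ℂ] H) ≤ T := sum_ketBra_sqrt_le hT F
  have h1 : 0 ≤ ((T - S : traceClass H) : H →L[ℂ] H) := sub_nonneg.2 hle
  have h2 := hp.add S (T - S) hS0 h1
  rw [add_sub_cancel, hS, hp.sum F _ fun i => ketBra_self_nonneg _, ← hS] at h2
  have h3 := hp.nonneg _ h1
  have h4 := hp.le_trace _ h1
  have h5 : (trace (S : H →L[ℂ] H)).re = ∑ i ∈ F, ‖v i‖ ^ 2 := by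
    rw [hS, Submodule.coe_sum, trace_sum F fun i _ => (ketBra (v i) (v i)).2, Complex.re_sum]
    refine Finset.sum_congr rfl fun i _ => ?_
    rw [trace_ketBra, inner_self_eq_norm_sq_to_K]
    simp [← Complex.ofReal_pow]
  rw [Submodule.coe_sub, trace_sub T.2 S.2, Complex.sub_re, h5] at h4
  constructor <;> linarith

/-- Domination by the trace forces normality: `p` is determined by its values on rank-one operators.
-/
theorem hasSum (hp : IsEffect p) {T : traceClass H} (hT : 0 ≤ (T : H →L[ℂ] H)) :
    HasSum (fun i => p (ketBra (CFC.sqrt (T : H →L[ℂ] H) (onb H i))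
      (CFC.sqrt (T : H →L[ℂ] H) (onb H i)))) (p T) := by
  have h := (T.2.hasSum_norm_sqrt hT)
  unfold HasSum at h ⊢
  have h1 : Filter.Tendsto (fun F => (trace (T : H →L[ℂ] H)).re -
      ∑ i ∈ F, ‖CFC.sqrt (T : H →L[ℂ] H) (onb H i)‖ ^ 2)
      (SummationFilter.unconditional _).filter (nhds 0) := by
    simpa using h.const_sub (trace (T : H →L[ℂ] H)).re
  have h2 := squeeze_zero (fun F => (hp.sub_sum_le hT F).1) (fun F => (hp.sub_sum_le hT F).2) h1
  simpa using h2.const_sub (p T)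

end IsEffect

/-- The difference of the two sides is |x - 2y⟩⟨x - 2y|. -/
theorem ketBra_le_two (x y : H) :
    (ketBra x x : H →L[ℂ] H) ≤
      (((2 : ℝ) : ℂ) • ketBra y y + ((2 : ℝ) : ℂ) • ketBra (x - y) (x - y) : traceClass H) := by
  have h : (((2 : ℝ) : ℂ) • ketBra y y + ((2 : ℝ) : ℂ) • ketBra (x - y) (x - y) : traceClass H)
      = ketBra x x + ketBra (x - (2 : ℂ) • y) (x - (2 : ℂ) • y) := by
    refine Subtype.ext ?_
    simp only [ketBra, map_sub, map_smulₛₗ, Submodule.coe_add, Submodule.coe_smul, sub_apply,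
      smul_apply]
    push_cast
    simp only [map_ofNat, id_eq]
    module
  rw [h, Submodule.coe_add]
  exact le_add_of_nonneg_right (ketBra_self_nonneg _)

/-- Cauchy-Schwarz: |⟨√T u, x⟩|² = |⟨u, √T x⟩|² ≤ ‖u‖² ⟨x, T x⟩. Vectors in the range of √T are thus
controlled by `T`. -/
theorem ketBra_sqrt_le {T : traceClass H} (hT : 0 ≤ (T : H →L[ℂ] H)) (u : H) :
    (ketBra (CFC.sqrt (T : H →L[ℂ] H) u) (CFC.sqrt (T : H →L[ℂ] H) u) : H →L[ℂ] H) ≤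
      (((‖u‖ ^ 2 : ℝ) : ℂ) • T : traceClass H) := by
  rw [← sub_nonneg, nonneg_iff_re_inner]
  refine ⟨?_, fun x => ?_⟩
  · refine IsSelfAdjoint.sub ?_ (isSelfAdjoint_rankOne _)
    exact IsSelfAdjoint.of_nonneg (smul_ofReal_nonneg (by positivity) hT)
  · have h1 : (⟪x, (ketBra (CFC.sqrt (T : H →L[ℂ] H) u) (CFC.sqrt (T : H →L[ℂ] H) u) : H →L[ℂ] H)
        x⟫_ℂ).re = ‖⟪u, CFC.sqrt (T : H →L[ℂ] H) x⟫_ℂ‖ ^ 2 := by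
      rw [← inner_sqrt_left]
      exact re_inner_rankOne _ _
    rw [sub_apply, inner_sub_right, Complex.sub_re, h1, Submodule.coe_smul, smul_apply,
      inner_smul_right, Complex.re_ofReal_mul, ← norm_sqrt_sq hT, ← mul_pow, sub_nonneg]
    gcongr
    exact norm_inner_le_norm _ _

/-- The range of `√ρ` is dense. -/
theorem FaithfulState.dense_range_sqrt (ρ : FaithfulState H) :
    DenseRange fun x => CFC.sqrt (ρ.op : H →L[ℂ] H) x := by
  have h : (LinearMap.range (CFC.sqrt (ρ.op : H →L[ℂ] H)).toLinearMap)ᗮ = ⊥ := by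
    rw [Submodule.eq_bot_iff]
    intro x hx
    by_contra hne
    have h1 := (Submodule.mem_orthogonal _ _).1 hx _ ⟨CFC.sqrt (ρ.op : H →L[ℂ] H) x, rfl⟩
    have h2 := ρ.pos' x hne
    rw [← sqrt_mul_sqrt_apply ρ.nonneg' x, ← inner_conj_symm] at h2
    erw [h1] at h2
    simp at h2
  have := Submodule.topologicalClosure_eq_top_iff.2 h
  have h3 := Submodule.dense_iff_topologicalClosure_eq_top.2 this
  exact h3

/-- Smallness in the faithful state `ρ` implies smallness in every state. -/
theorem IsEffect.tendsto_zero (ρ : FaithfulState H) {α : Type*} {l : Filter α}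
    {p : α → traceClass H → ℝ} (hp : ∀ a, IsEffect (p a))
    (h : Filter.Tendsto (fun a => p a ρ.op) l (nhds 0)) {T : traceClass H}
    (hT : 0 ≤ (T : H →L[ℂ] H)) : Filter.Tendsto (fun a => p a T) l (nhds 0) := by
  -- Smallness is extended in three stages: to vectors in the range of √ρ, which ρ dominates; to all
  -- vectors, by density of that range; and to `T`, by cutting its rank-one expansion at a finite
  -- set chosen independently of `a`.
  have h1 : ∀ u : H, Filter.Tendsto (fun a => p a (ketBra (CFC.sqrt (ρ.op : H →L[ℂ] H) u)
      (CFC.sqrt (ρ.op : H →L[ℂ] H) u))) l (nhds 0) := by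
    intro u
    have h2 := h.const_mul (‖u‖ ^ 2)
    rw [mul_zero] at h2
    refine squeeze_zero (fun a => (hp a).nonneg _ (ketBra_self_nonneg _)) (fun a => ?_) h2
    rw [← (hp a).smul _ _ (by positivity) ρ.nonneg']
    exact (hp a).mono (ketBra_self_nonneg _) (ketBra_sqrt_le ρ.nonneg' u)
  have h2 : ∀ x : H, Filter.Tendsto (fun a => p a (ketBra x x)) l (nhds 0) := by
    intro x
    rw [Metric.tendsto_nhds]
    intro ε hε
    obtain ⟨u, hu⟩ := ρ.dense_range_sqrt.exists_dist_lt x (ε := √(ε / 4)) (by positivity)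
    set y := CFC.sqrt (ρ.op : H →L[ℂ] H) u
    have h3 := (h1 u)
    rw [Metric.tendsto_nhds] at h3
    filter_upwards [h3 (ε / 4) (by positivity)] with a ha
    rw [Real.dist_0_eq_abs, abs_of_nonneg ((hp a).nonneg _ (ketBra_self_nonneg _))] at ha ⊢
    have h4 := (hp a).mono (ketBra_self_nonneg _) (ketBra_le_two x y)
    rw [(hp a).add _ _ (smul_ofReal_nonneg zero_le_two (ketBra_self_nonneg _))
      (smul_ofReal_nonneg zero_le_two (ketBra_self_nonneg _)),
      (hp a).smul _ _ zero_le_two (ketBra_self_nonneg _),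
      (hp a).smul _ _ zero_le_two (ketBra_self_nonneg _)] at h4
    have h5 := (hp a).le_trace _ (ketBra_self_nonneg (x - y))
    rw [trace_ketBra, inner_self_eq_norm_sq_to_K] at h5
    have h6 : ‖x - y‖ ^ 2 < ε / 4 := by
      rw [dist_eq_norm] at hu
      have := pow_lt_pow_left₀ hu (norm_nonneg _) two_ne_zero
      rwa [Real.sq_sqrt (by positivity)] at this
    simp [← Complex.ofReal_pow] at h5
    linarith
  rw [Metric.tendsto_nhds]
  intro ε hε
  have h3 := T.2.hasSum_norm_sqrt hT
  rw [HasSum, SummationFilter.unconditional_filter, Metric.tendsto_nhds] at h3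
  obtain ⟨F, hF⟩ := (h3 (ε / 2) (by positivity)).exists
  have h4 : Filter.Tendsto (fun a => ∑ i ∈ F, p a (ketBra (CFC.sqrt (T : H →L[ℂ] H) (onb H i))
        (CFC.sqrt (T : H →L[ℂ] H) (onb H i)))) l (nhds 0) := by
    simpa using tendsto_finsetSum F fun i _ => h2 (CFC.sqrt (T : H →L[ℂ] H) (onb H i))
  rw [Metric.tendsto_nhds] at h4
  filter_upwards [h4 (ε / 2) (by positivity)] with a ha
  have h5 := ((hp a).sub_sum_le hT F).2
  rw [Real.dist_eq] at ha hF ⊢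
  have := (hp a).nonneg _ hT
  rw [abs_lt] at ha hF ⊢
  constructor <;> linarith [ha.1, ha.2, hF.1, hF.2]

end Effect

/-! ### Effect functionals are given by bounded operators -/

section EffectOperator

variable {H : Type*} [NormedAddCommGroup H] [InnerProductSpace ℂ H]

/-- Homogeneity of the polar form, again arranged so that for a ≥ 0 all terms are positive. -/
theorem ketBra_smul_add {a : ℝ} (x y : H) :
    ketBra (a • x + y) (a • x + y) + (a : ℂ) • (ketBra x x + ketBra y y) =
      (a : ℂ) • ketBra (x + y) (x + y) + (((a ^ 2 : ℝ) : ℂ) • ketBra x x + ketBra y y) := by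
  refine Subtype.ext ?_
  rw [← Complex.coe_smul a x]
  simp only [ketBra, map_add, map_smul, Submodule.coe_smul, Submodule.coe_add, add_apply, smul_apply,
    map_smulₛₗ, Complex.conj_ofReal]
  push_cast
  module

variable [CompleteSpace H]

theorem re_trace_ketBra_mul (x : H) (N : H →L[ℂ] H) :
    (trace ((ketBra x x : H →L[ℂ] H) * N)).re = (⟪x, N x⟫_ℂ).re := by
  rw [trace_mul_comm (ketBra x x).2]
  have : N * (ketBra x x : H →L[ℂ] H) = ketBra (N x) x := by
    ext z
    simp [ketBra]
  rw [this, trace_ketBra]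

theorem isEffect_trace_mul {N : H →L[ℂ] H} (h0 : 0 ≤ N) (h1 : N ≤ 1) :
    IsEffect fun T : traceClass H => (trace ((T : H →L[ℂ] H) * N)).re where
  add S T _ _ := by
    rw [Submodule.coe_add, add_mul, trace_add (S.2.mul_right N) (T.2.mul_right N), Complex.add_re]
  smul c T _ _ := by
    rw [Submodule.coe_smul, smul_mul_assoc, trace_smul, Complex.re_ofReal_mul]
  nonneg T hT := (Complex.nonneg_iff.1 (trace_mul_nonneg T.2 hT h0)).1
  le_trace T hT := by
    have h := (Complex.nonneg_iff.1 (trace_mul_nonneg T.2 hT (sub_nonneg.2 h1))).1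
    rw [mul_sub, mul_one, trace_sub T.2 (T.2.mul_right N), Complex.sub_re] at h
    linarith

/-- A bounded real symmetric bilinear form that is invariant under `i` is the real part of the
sesquilinear form of a bounded operator. -/
theorem exists_operator_of_bilin (B : H → H → ℝ) (Bcomm : ∀ x y, B x y = B y x)
    (Badd : ∀ x y z, B x (y + z) = B x y + B x z) (Bsm : ∀ (a : ℝ) x y, B x (a • y) = a * B x y)
    (BI : ∀ x y, B (Complex.I • x) (Complex.I • y) = B x y)
    (Bcs : ∀ x y, |B x y| ≤ ‖x‖ * ‖y‖) :
    ∃ N : H →L[ℂ] H, ∀ x, ⟪x, N x⟫_ℂ = (B x x : ℂ) := by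
  have Bneg : ∀ x y, B x (-y) = -B x y := fun x y => by
    have := Bsm (-1) x y
    rwa [neg_one_smul, neg_one_mul] at this
  have BI' : ∀ x y, B (Complex.I • x) y = -B x (Complex.I • y) := fun x y => by
    have h := BI (Complex.I • x) y
    rw [smul_smul, Complex.I_mul_I, neg_one_smul, Bcomm, Bneg, Bcomm] at h
    exact h.symm
  have csm : ∀ (c : ℂ) (y : H), c • y = c.re • y + c.im • (Complex.I • y) := fun c y => by
    rw [← Complex.coe_smul, ← Complex.coe_smul, smul_smul, ← add_smul, Complex.re_add_im]
  -- The correction term makes the form complex linear in `y`: replacing `y` by iy multiplies the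
  -- value by i.
  let f : H →ₗ⋆[ℂ] H →ₗ[ℂ] ℂ := LinearMap.mk₂'ₛₗ (starRingEnd ℂ) (RingHom.id ℂ)
    (fun x y => (B x y : ℂ) - Complex.I * (B x (Complex.I • y) : ℂ))
    (fun x x' y => by
      rw [Bcomm (x + x'), Badd, Bcomm (x + x'), Badd]
      simp only [Bcomm y, Bcomm (Complex.I • y)]
      push_cast
      ring)
    (fun c x y => by
      have h1 : ∀ z, B (c • x) z = c.re * B x z - c.im * B x (Complex.I • z) := fun z => by
        rw [csm c x, Bcomm, Badd, Bsm, Bsm, Bcomm z x, Bcomm z, BI']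
        ring
      rw [h1, h1, smul_smul, Complex.I_mul_I, neg_one_smul, Bneg]
      apply Complex.ext <;> simp <;> ring)
    (fun x y y' => by
      rw [smul_add, Badd, Badd]
      push_cast
      ring)
    (fun c x y => by
      have h1 : B x (c • y) = c.re * B x y + c.im * B x (Complex.I • y) := by
        rw [csm c y, Badd, Bsm, Bsm]
      have h2 : B x (Complex.I • c • y) = c.re * B x (Complex.I • y) - c.im * B x y := by
        rw [smul_comm, csm c, Badd, Bsm, Bsm, smul_smul Complex.I, Complex.I_mul_I, neg_one_smul,
          Bneg]
        ring
      rw [h1, h2]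
      apply Complex.ext <;> simp <;> ring)
  have hf : ∀ x y, f x y = (B x y : ℂ) - Complex.I * (B x (Complex.I • y) : ℂ) := fun _ _ => rfl
  have hC : ∀ x y, ‖f x y‖ ≤ 2 * ‖x‖ * ‖y‖ := by
    intro x y
    rw [hf]
    refine (norm_sub_le _ _).trans ?_
    rw [norm_mul, Complex.norm_I, one_mul, Complex.norm_real, Complex.norm_real, Real.norm_eq_abs,
      Real.norm_eq_abs]
    have h1 := Bcs x y
    have h2 := Bcs x (Complex.I • y)
    rw [norm_smul, Complex.norm_I, one_mul] at h2
    linarith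
  set N : H →L[ℂ] H := ContinuousLinearMap.adjoint
    (InnerProductSpace.continuousLinearMapOfBilin (f.mkContinuous₂ 2 hC)) with hN
  refine ⟨N, fun x => ?_⟩
  -- The imaginary part vanishes on the diagonal, by symmetry and invariance under i.
  have h1 : B x (Complex.I • x) = 0 := by
    have := BI' x x
    rw [Bcomm] at this
    linarith
  rw [hN, ContinuousLinearMap.adjoint_inner_right,
    InnerProductSpace.continuousLinearMapOfBilin_apply]
  change f x x = _
  rw [hf, h1]
  simp

/-- A quadratic form bounded by `‖x‖²` is given by a bounded operator. -/
theorem exists_operator_of_quadratic (q : H → ℝ) (q0 : ∀ x, 0 ≤ q x) (q1 : ∀ x, q x ≤ ‖x‖ ^ 2)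
    (qc : ∀ (c : ℂ) x, q (c • x) = ‖c‖ ^ 2 * q x)
    (qpol : ∀ x y z, q (x + y + z) + (q x + q y + q z) = q (x + y) + (q (y + z) + q (x + z)))
    (qsm : ∀ (a : ℝ) x y, 0 ≤ a → q (a • x + y) + a * (q x + q y) =
      a * q (x + y) + (a ^ 2 * q x + q y)) :
    ∃ N : H →L[ℂ] H, ∀ x, ⟪x, N x⟫_ℂ = (q x : ℂ) := by
  have qr : ∀ (a : ℝ) x, q (a • x) = a ^ 2 * q x := fun a x => by
    rw [← Complex.coe_smul, qc]
    simp
  have qzero : q 0 = 0 := by simpa using qr 0 0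
  set B : H → H → ℝ := fun x y => (q (x + y) - q x - q y) / 2 with hB
  have Bcomm : ∀ x y, B x y = B y x := fun x y => by simp only [hB, add_comm x y]; ring
  have Badd : ∀ x y z, B x (y + z) = B x y + B x z := fun x y z => by
    have := qpol x y z
    simp only [hB, ← add_assoc]
    linarith
  have B0 : ∀ x, B x 0 = 0 := fun x => by simp [hB, qzero]
  have Bneg : ∀ x y, B x (-y) = -B x y := fun x y => by
    have := Badd x y (-y)
    rw [add_neg_cancel, B0] at this
    linarith
  have Bsm' : ∀ (a : ℝ) x y, 0 ≤ a → B x (a • y) = a * B x y := fun a x y ha => by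
    rw [Bcomm, Bcomm x y]
    have := qsm a y x ha
    simp only [hB, qr]
    linarith
  have Bsm : ∀ (a : ℝ) x y, B x (a • y) = a * B x y := fun a x y => by
    rcases le_total 0 a with ha | ha
    · exact Bsm' a x y ha
    · have := Bsm' (-a) x y (by linarith)
      rw [neg_smul, Bneg] at this
      linarith
  have BI : ∀ x y, B (Complex.I • x) (Complex.I • y) = B x y := fun x y => by
    simp only [hB, ← smul_add, qc, Complex.norm_I]
    ring
  -- Cauchy-Schwarz for the positive form, from the discriminant of t ↦ q(tx + y), combined with q ≤
  -- ‖·‖².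
  have Bcs : ∀ x y, |B x y| ≤ ‖x‖ * ‖y‖ := by
    intro x y
    have hd : ∀ t : ℝ, 0 ≤ q x * (t * t) + 2 * B x y * t + q y := fun t => by
      have h1 := q0 (t • x + y)
      have h2 := Bsm t y x
      rw [Bcomm, Bcomm y x] at h2
      have h3 := qr t x
      have h4 : q (t • x + y) = 2 * B (t • x) y + q (t • x) + q y := by simp only [hB]; ring
      rw [h4, h2, h3] at h1
      linarith
    have h1 := discrim_le_zero hd
    unfold discrim at h1
    refine abs_le_of_sq_le_sq ?_ (by positivity)
    have h2 := mul_le_mul (q1 x) (q1 y) (q0 y) (by positivity)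
    nlinarith
  obtain ⟨N, hN⟩ := exists_operator_of_bilin B Bcomm Badd Bsm BI Bcs
  refine ⟨N, fun x => ?_⟩
  have h2 : B x x = q x := by
    have := qr 2 x
    simp only [hB]
    rw [← two_smul ℝ x, this]
    ring
  rw [hN, h2]

theorem nonneg_of_inner_eq {M : H →L[ℂ] H} (hM : ∀ x, ∃ r : ℝ, 0 ≤ r ∧ ⟪x, M x⟫_ℂ = r) :
    0 ≤ M := by
  rw [ContinuousLinearMap.nonneg_iff_isPositive, ContinuousLinearMap.isPositive_iff_complex]
  intro x
  obtain ⟨r, hr, h⟩ := hM x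
  have h4 : ⟪M x, x⟫_ℂ = r := by
    rw [← inner_conj_symm, h, Complex.conj_ofReal]
  rw [h4]
  simp [hr]

theorem IsEffect.polar {p : traceClass H → ℝ} (hp : IsEffect p) (x y z : H) :
    p (ketBra (x + y + z) (x + y + z)) +
        (p (ketBra x x) + p (ketBra y y) + p (ketBra z z)) =
      p (ketBra (x + y) (x + y)) +
        (p (ketBra (y + z) (y + z)) + p (ketBra (x + z) (x + z))) := by
  have kb := ketBra_self_nonneg (H := H)
  have kb2 : ∀ x y : H, 0 ≤ ((ketBra x x + ketBra y y : traceClass H) : H →L[ℂ] H) := fun x y => by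
    rw [Submodule.coe_add]
    exact add_nonneg (kb x) (kb y)
  have kb3 : 0 ≤ ((ketBra x x + ketBra y y + ketBra z z : traceClass H) : H →L[ℂ] H) := by
    rw [Submodule.coe_add]
    exact add_nonneg (kb2 x y) (kb z)
  rw [← hp.add _ _ (kb x) (kb y), ← hp.add _ _ (kb2 x y) (kb z), ← hp.add _ _ (kb _) kb3,
    ← hp.add _ _ (kb (y + z)) (kb (x + z)), ← hp.add _ _ (kb (x + y)) (kb2 _ _), ketBra_polar]

theorem IsEffect.smul_add {p : traceClass H → ℝ} (hp : IsEffect p) {a : ℝ} (ha : 0 ≤ a) (x y : H) :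
    p (ketBra (a • x + y) (a • x + y)) + a * (p (ketBra x x) + p (ketBra y y)) =
      a * p (ketBra (x + y) (x + y)) + (a ^ 2 * p (ketBra x x) + p (ketBra y y)) := by
  have kb := ketBra_self_nonneg (H := H)
  have kb2 : 0 ≤ ((ketBra x x + ketBra y y : traceClass H) : H →L[ℂ] H) := by
    rw [Submodule.coe_add]
    exact add_nonneg (kb x) (kb y)
  have kb3 : ∀ {c : ℝ} (_ : 0 ≤ c) (x : H), 0 ≤ (((c : ℂ) • ketBra x x : traceClass H) : H →L[ℂ] H) :=
    fun hc x => smul_ofReal_nonneg hc (kb x)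
  have kb4 : 0 ≤ (((a : ℂ) • (ketBra x x + ketBra y y) : traceClass H) : H →L[ℂ] H) :=
    smul_ofReal_nonneg ha kb2
  have ha2 : 0 ≤ a ^ 2 := by positivity
  have kb5 : 0 ≤ ((((a ^ 2 : ℝ) : ℂ) • ketBra x x + ketBra y y : traceClass H) : H →L[ℂ] H) := by
    rw [Submodule.coe_add]
    exact add_nonneg (kb3 ha2 x) (kb y)
  rw [← hp.add _ _ (kb x) (kb y), ← hp.smul _ _ ha kb2, ← hp.add _ _ (kb _) kb4,
    ← hp.smul _ _ ha (kb (x + y)), ← hp.smul _ _ ha2 (kb x), ← hp.add _ _ (kb3 ha2 x) (kb y),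
    ← hp.add _ _ (kb3 ha _) kb5, ketBra_smul_add]

/-- An effect functional is `T ↦ Tr[T N]` for an operator `0 ≤ N ≤ 1`. -/
theorem IsEffect.exists_operator {p : traceClass H → ℝ} (hp : IsEffect p) :
    ∃ N : H →L[ℂ] H, 0 ≤ N ∧ N ≤ 1 ∧
      ∀ T : traceClass H, 0 ≤ (T : H →L[ℂ] H) → p T = (trace ((T : H →L[ℂ] H) * N)).re := by
  have kb := ketBra_self_nonneg (H := H)
  have q1 : ∀ x, p (ketBra x x) ≤ ‖x‖ ^ 2 := fun x => by
    have := hp.le_trace _ (kb x)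
    rw [trace_ketBra, inner_self_eq_norm_sq_to_K] at this
    simpa [← Complex.ofReal_pow] using this
  obtain ⟨N, hN⟩ := exists_operator_of_quadratic (fun x => p (ketBra x x))
    (fun x => hp.nonneg _ (kb x)) q1
    (fun c x => by
      rw [ketBra_smul_smul]
      exact hp.smul _ _ (by positivity) (kb x))
    hp.polar (fun a x y ha => hp.smul_add ha x y)
  have hN0 : 0 ≤ N := nonneg_of_inner_eq fun x => ⟨_, hp.nonneg _ (kb x), hN x⟩
  have hN1 : N ≤ 1 := sub_nonneg.1 <| nonneg_of_inner_eq fun x => ⟨_, sub_nonneg.2 (q1 x), by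
    rw [sub_apply, inner_sub_right, hN, one_apply_eq_self, inner_self_eq_norm_sq_to_K]
    push_cast
    rfl⟩
  refine ⟨N, hN0, hN1, fun T hT => ?_⟩
  -- Both functionals are effects, hence normal, so agreement on rank-one operators suffices.
  refine (hp.hasSum hT).unique ?_
  convert (isEffect_trace_mul hN0 hN1).hasSum hT using 2 with i
  rw [re_trace_ketBra_mul, hN]
  rfl

end EffectOperator

/-! ### Classical Fisher information as a variational quantity -/

section ClassicalFisher

open MeasureTheory

variable {Ω : Type*} [MeasurableSpace Ω] {μ ν₁ ν₂ : Measure Ω} {s : SignedMeasure Ω}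

/-- Hölder's inequality is used in `ℝ≥0∞`, so no integrability is needed: the Bochner integral of a
non-integrable product is 0. -/
theorem sq_integral_mul_le {g l : Ω → ℝ} (hg : Measurable g) (hl : Measurable l) :
    ENNReal.ofReal ((∫ x, g x * l x ∂μ) ^ 2) ≤
      (∫⁻ x, ENNReal.ofReal (g x ^ 2) ∂μ) * ∫⁻ x, ENNReal.ofReal (l x ^ 2) ∂μ := by
  have h1 := ENNReal.lintegral_mul_le_Lp_mul_Lq μ Real.HolderConjugate.two_two
    (f := fun x => ‖g x‖ₑ) (g := fun x => ‖l x‖ₑ) hg.enorm.aemeasurable hl.enorm.aemeasurable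
  have h2 : ‖∫ x, g x * l x ∂μ‖ₑ ≤ ∫⁻ x, ((fun x => ‖g x‖ₑ) * fun x => ‖l x‖ₑ) x ∂μ := by
    refine (enorm_integral_le_lintegral_enorm _).trans_eq ?_
    simp [enorm_mul]
  have h3 : ∀ r : ℝ, ENNReal.ofReal (r ^ 2) = ‖r‖ₑ ^ (2 : ℝ) := fun r => by
    rw [← sq_abs, ENNReal.ofReal_pow (abs_nonneg r), ← Real.norm_eq_abs, ofReal_norm]
    simp
  simp_rw [h3]
  calc _ ≤ (((∫⁻ x, ‖g x‖ₑ ^ (2 : ℝ) ∂μ) ^ (1 / (2 : ℝ)) *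
        (∫⁻ x, ‖l x‖ₑ ^ (2 : ℝ) ∂μ) ^ (1 / (2 : ℝ)))) ^ (2 : ℝ) := by
        gcongr
        exact h2.trans h1
    _ = _ := by
        rw [ENNReal.mul_rpow_of_nonneg _ _ zero_le_two, ← ENNReal.rpow_mul, ← ENNReal.rpow_mul]
        norm_num

variable [IsFiniteMeasure μ] [IsFiniteMeasure ν₁] [IsFiniteMeasure ν₂]

theorem setIntegral_rnDeriv (hs : s ≪ᵥ μ.toENNRealVectorMeasure) {S : Set Ω}
    (hS : MeasurableSet S) : ∫ x in S, s.rnDeriv μ x ∂μ = s S := by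
  have h := SignedMeasure.withDensityᵥ_rnDeriv_eq s μ hs
  conv_rhs => rw [← h, withDensityᵥ_apply (SignedMeasure.integrable_rnDeriv s μ) hS]

/-- This evaluates the test integrals in the variational formula without mentioning the density. Any
decomposition of `s` into finite positive measures is allowed, not only the Jordan one. -/
theorem integral_mul_rnDeriv (hs : s ≪ᵥ μ.toENNRealVectorMeasure)
    (h : ∀ S, MeasurableSet S → s S = ν₁.real S - ν₂.real S) {g : Ω → ℝ} (hg : Measurable g)
    {C : ℝ} (hC : ∀ x, |g x| ≤ C) :
    ∫ x, g x * s.rnDeriv μ x ∂μ = ∫ x, g x ∂ν₁ - ∫ x, g x ∂ν₂ := by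
  set l := s.rnDeriv μ with hl
  have hlm : Measurable l := SignedMeasure.measurable_rnDeriv s μ
  have hli : Integrable l μ := SignedMeasure.integrable_rnDeriv s μ
  have hgi : ∀ ν : Measure Ω, IsFiniteMeasure ν → Integrable g ν := fun ν _ =>
    Integrable.of_bound hg.aestronglyMeasurable C (.of_forall hC)
  have hp : IsFiniteMeasure (μ.withDensity fun x => ENNReal.ofReal (l x)) :=
    isFiniteMeasure_withDensity_ofReal hli.2
  have hn : IsFiniteMeasure (μ.withDensity fun x => ENNReal.ofReal (-l x)) :=
    isFiniteMeasure_withDensity_ofReal hli.neg.2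
  -- With l = l⁺ - l⁻, the signed identity lμ = ν₁ - ν₂ becomes one between positive measures, where
  -- integrals are additive in the measure.
  have key : μ.withDensity (fun x => ENNReal.ofReal (l x)) + ν₂ =
      μ.withDensity (fun x => ENNReal.ofReal (-l x)) + ν₁ := by
    refine Measure.ext fun S hS => ?_
    rw [← measureReal_eq_measureReal_iff]
    have h1 := setIntegral_rnDeriv hs hS
    rw [h S hS, integral_eq_lintegral_pos_part_sub_lintegral_neg_part hli.integrableOn] at h1
    rw [measureReal_add_apply, measureReal_add_apply]
    simp only [measureReal_def, withDensity_apply _ hS] at h1 ⊢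
    linarith
  have h1 := congrArg (fun ν => ∫ x, g x ∂ν) key
  rw [integral_add_measure (hgi _ hp) (hgi _ inferInstance),
    integral_add_measure (hgi _ hn) (hgi _ inferInstance),
    integral_withDensity_eq_integral_toReal_smul (by fun_prop) (.of_forall fun _ => by simp),
    integral_withDensity_eq_integral_toReal_smul (by fun_prop) (.of_forall fun _ => by simp)] at h1
  have hi : ∀ k : Ω → ℝ, Integrable k μ → Integrable (fun x => (ENNReal.ofReal (k x)).toReal • g x) μ := by
    intro k hk
    have h3 : Integrable (fun x => max (k x) 0) μ := hk.pos_part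
    simp only [smul_eq_mul, ENNReal.toReal_ofReal']
    exact h3.mul_bdd hg.aestronglyMeasurable (.of_forall hC)
  have h2 : ∫ x, g x * l x ∂μ = ∫ x, (ENNReal.ofReal (l x)).toReal • g x ∂μ -
      ∫ x, (ENNReal.ofReal (-l x)).toReal • g x ∂μ := by
    rw [← integral_sub (hi l hli) (hi (fun x => -l x) hli.neg)]
    refine integral_congr_ae (.of_forall fun x => ?_)
    simp only [ENNReal.toReal_ofReal', smul_eq_mul]
    rw [← sub_mul, max_zero_sub_max_neg_zero_eq_self, mul_comm]
  rw [h2]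
  linarith

/-- The converse of Cauchy-Schwarz. The truncation g = l·1_{|l| ≤ n} satisfies ∫ g l = ∫ g², which
is finite, so one factor can be cancelled; monotone convergence removes the truncation. Bounded test
functions therefore suffice to bound a Fisher information. -/
theorem lintegral_sq_le_of_forall {l : Ω → ℝ} (hl : Measurable l) {K : ℝ≥0∞}
    (h : ∀ g : Ω → ℝ, Measurable g → (∃ C, ∀ x, |g x| ≤ C) →
      ENNReal.ofReal ((∫ x, g x * l x ∂μ) ^ 2) ≤ (∫⁻ x, ENNReal.ofReal (g x ^ 2) ∂μ) * K) :
    ∫⁻ x, ENNReal.ofReal (l x ^ 2) ∂μ ≤ K := by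
  let g : ℕ → Ω → ℝ := fun n => {x | |l x| ≤ n}.indicator l
  have hgm : ∀ n, Measurable (g n) := fun n =>
    hl.indicator (measurableSet_le hl.abs measurable_const)
  have hgb : ∀ n x, |g n x| ≤ n := by
    intro n x
    simp only [g, Set.indicator_apply, Set.mem_ofPred_eq]
    split_ifs with hx
    · exact hx
    · simp
  have hgl : ∀ n x, g n x * l x = g n x ^ 2 := by
    intro n x
    simp only [g, Set.indicator_apply]
    split_ifs <;> ring
  have hgi : ∀ n, Integrable (fun x => g n x ^ 2) μ := fun n =>
    Integrable.of_bound ((hgm n).pow_const 2).aestronglyMeasurable ((n : ℝ) ^ 2)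
      (.of_forall fun x => by
        rw [Real.norm_eq_abs, abs_pow]
        gcongr
        exact hgb n x)
  have hle : ∀ n, ∫⁻ x, ENNReal.ofReal (g n x ^ 2) ∂μ ≤ K := by
    intro n
    have h1 := h (g n) (hgm n) ⟨n, hgb n⟩
    simp_rw [hgl] at h1
    rw [← ofReal_integral_eq_lintegral_ofReal (hgi n) (.of_forall fun x => sq_nonneg _)] at h1 ⊢
    have ha : 0 ≤ ∫ x, g n x ^ 2 ∂μ := integral_nonneg fun x => sq_nonneg _
    rcases ha.eq_or_lt with h0 | h0
    · rw [← h0]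
      simp
    · rw [sq, ENNReal.ofReal_mul ha] at h1
      exact (ENNReal.mul_le_mul_iff_right (by simpa using h0) ENNReal.ofReal_ne_top).1 h1
  refine le_of_tendsto' (lintegral_tendsto_of_tendsto_of_monotone
    (fun n => ((hgm n).pow_const 2).ennreal_ofReal.aemeasurable) ?_ ?_) hle
  · refine .of_forall fun x m n hmn => ENNReal.ofReal_le_ofReal ?_
    simp only [g, Set.indicator_apply, Set.mem_ofPred_eq]
    have : (m : ℝ) ≤ n := by exact_mod_cast hmn
    split_ifs with h1 h2
    · rfl
    · exact absurd (h1.trans this) h2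
    · simpa using sq_nonneg (l x)
    · rfl
  · refine .of_forall fun x => tendsto_const_nhds.congr' ?_
    obtain ⟨N, hN⟩ := exists_nat_ge |l x|
    filter_upwards [Filter.eventually_ge_atTop N] with n hn
    have : |l x| ≤ n := hN.trans (by exact_mod_cast hn)
    simp [g, this]

end ClassicalFisher

/-! ### Monotonicity of the error in the Fisher information -/

section ExcessError

theorem inverseForm_anti {V : Type*} {D : Set V} {J J' : V → ℝ≥0∞} (b : V → ℝ)
    (h : ∀ φ ∈ D, J' φ ≤ J φ) : inverseForm D J b ≤ inverseForm D J' b :=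
  iSup₂_mono fun φ hφ => ENNReal.div_le_div_left (h φ hφ) _

/-- The error decreases if the Fisher information increases. -/
theorem excessError_anti {V : Type*} {D : Set V} {J J' : V → ℝ≥0∞} (b : V → ℝ) (v : ℝ)
    (h : ∀ φ ∈ D, J' φ ≤ J φ) : excessError D J b v ≤ excessError D J' b v := by
  unfold excessError
  split_ifs with h1 h2 h2
  · refine EReal.sub_le_sub ?_ le_rfl
    exact_mod_cast inverseForm_anti b h
  · exact le_top
  · exact absurd (fun φ hφ h0 => h2 φ hφ (le_antisymm ((h φ hφ).trans h0.le) zero_le)) h1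
  · rfl

end ExcessError

/-! ### Outcome laws of POVMs, coarse graining, and POVMs from families of measures -/

section POVMLaws

open MeasureTheory

variable {H : Type*} [NormedAddCommGroup H] [InnerProductSpace ℂ H] [CompleteSpace H]
  {Ω Ω' : Type*} [MeasurableSpace Ω] [MeasurableSpace Ω']

theorem POVM.law_apply (M : POVM Ω H) (ρ : FaithfulState H) {S : Set Ω} (hS : MeasurableSet S) :
    M.law ρ S = ENNReal.ofReal (trace ((ρ.op : H →L[ℂ] H) * M.toFun S)).re :=
  Measure.ofMeasurable_apply S hS

instance (M : POVM Ω H) (ρ : FaithfulState H) : IsFiniteMeasure (M.law ρ) :=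
  ⟨by simp [M.law_apply ρ .univ]⟩

theorem POVM.signedLaw_apply (M : POVM Ω H) (T : traceClass H) {S : Set Ω} (hS : MeasurableSet S) :
    M.signedLaw T S = (trace ((T : H →L[ℂ] H) * M.toFun S)).re :=
  if_pos hS

/-- An effect that vanishes in a faithful state is zero. -/
theorem FaithfulState.eq_zero_of_trace_mul (ρ : FaithfulState H) {N : H →L[ℂ] H} (hN : 0 ≤ N)
    (h : (trace ((ρ.op : H →L[ℂ] H) * N)).re = 0) : N = 0 := by
  have hsa := star_sqrt N
  have h1 : trace ((ρ.op : H →L[ℂ] H) * N)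
      = trace (CFC.sqrt N * (ρ.op : H →L[ℂ] H) * CFC.sqrt N) := by
    rw [trace_mul_comm (ρ.op.2.mul_left _), ← mul_assoc, CFC.sqrt_mul_sqrt_self N hN,
      trace_mul_comm ρ.op.2]
  have h2 := ((ρ.op.2.mul_left (CFC.sqrt N)).mul_right (CFC.sqrt N)).hasSum_re_inner
  rw [← h1, h] at h2
  have h3 : ∀ x : H, ⟪x, (CFC.sqrt N * (ρ.op : H →L[ℂ] H) * CFC.sqrt N) x⟫_ℂ =
      ⟪CFC.sqrt N x, (ρ.op : H →L[ℂ] H) (CFC.sqrt N x)⟫_ℂ := fun x => by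
    rw [inner_sqrt_left]
    rfl
  simp_rw [h3] at h2
  have h4 : ∀ i, CFC.sqrt N (onb H i) = 0 := by
    intro i
    by_contra hne
    have h5 := (hasSum_zero_iff_of_nonneg (fun j => by
      have := ((ContinuousLinearMap.nonneg_iff_isPositive _).1 ρ.nonneg').re_inner_nonneg_right
        (CFC.sqrt N (onb H j))
      exact this)).1 h2
    have h6 := (Complex.pos_iff.1 (ρ.pos' _ hne)).1
    exact h6.ne' (congrFun h5 i)
  have h5 : CFC.sqrt N = 0 := by
    refine ContinuousLinearMap.ext_on (s := Set.range (onb H))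
      (Submodule.dense_iff_topologicalClosure_eq_top.2 (onb H).dense_span) ?_
    rintro _ ⟨i, rfl⟩
    exact h4 i
  rw [← CFC.sqrt_mul_sqrt_self N hN, h5, mul_zero]

/-- An effect of probability zero in the faithful state vanishes, so no direction has a singular
part that the Radon-Nikodym derivative would miss. -/
theorem POVM.signedLaw_absolutelyContinuous (M : POVM Ω H) (ρ : FaithfulState H)
    (T : traceClass H) : M.signedLaw T ≪ᵥ (M.law ρ).toENNRealVectorMeasure := by
  refine VectorMeasure.AbsolutelyContinuous.mk fun S hS h => ?_
  rw [Measure.toENNRealVectorMeasure_apply_measurable hS, M.law_apply ρ hS,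
    ENNReal.ofReal_eq_zero] at h
  have h0 := (Complex.nonneg_iff.1 (trace_mul_nonneg ρ.op.2 ρ.nonneg' (M.nonneg' S hS))).1
  rw [M.signedLaw_apply T hS, ρ.eq_zero_of_trace_mul (M.nonneg' S hS) (le_antisymm h h0)]
  simp [trace]

/-- Coarse graining decreases the classical Fisher information. -/
theorem fisherInfo_le_of_preimage {M : POVM Ω H} {M' : POVM Ω' H} {g : Ω → Ω'} (hg : Measurable g)
    (h : ∀ S, MeasurableSet S → M'.toFun S = M.toFun (g ⁻¹' S)) (ρ : FaithfulState H)
    (φ : traceClass H) : fisherInfo M' ρ φ ≤ fisherInfo M ρ φ := by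
  set s := M.signedLaw φ with hs
  set j := s.toJordanDecomposition with hj
  have hsj : ∀ S, MeasurableSet S → s S = j.posPart.real S - j.negPart.real S := fun S hS => by
    rw [← s.toSignedMeasure_toJordanDecomposition, JordanDecomposition.toSignedMeasure,
      sub_apply, Measure.toSignedMeasure_apply_measurable hS,
      Measure.toSignedMeasure_apply_measurable hS]
  -- The images of the Jordan parts represent the coarse-grained law; they need not be mutually
  -- singular any more.
  have hsj' : ∀ S, MeasurableSet S →
      M'.signedLaw φ S = (j.posPart.map g).real S - (j.negPart.map g).real S := fun S hS => by
    rw [map_measureReal_apply hg hS, map_measureReal_apply hg hS, ← hsj _ (hg hS), hs,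
      M.signedLaw_apply φ (hg hS), M'.signedLaw_apply φ hS, h S hS]
  have hlaw : M'.law ρ = (M.law ρ).map g := by
    refine Measure.ext fun S hS => ?_
    rw [Measure.map_apply hg hS, M'.law_apply ρ hS, M.law_apply ρ (hg hS), h S hS]
  -- A test function `k` of the coarse outcome is the test function k ∘ g of the fine one, with the
  -- same mean and second moment.
  refine lintegral_sq_le_of_forall (SignedMeasure.measurable_rnDeriv _ _) fun k hk hC => ?_
  obtain ⟨C, hC⟩ := hC
  have h1 := integral_mul_rnDeriv (M.signedLaw_absolutelyContinuous ρ φ) hsj (hk.comp hg)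
    (fun x => hC (g x))
  simp only [Function.comp_apply] at h1
  rw [integral_mul_rnDeriv (M'.signedLaw_absolutelyContinuous ρ φ) hsj' hk hC,
    integral_map hg.aemeasurable hk.aestronglyMeasurable,
    integral_map hg.aemeasurable hk.aestronglyMeasurable, ← h1, hlaw,
    lintegral_map (by fun_prop) hg]
  exact sq_integral_mul_le (hk.comp hg) (SignedMeasure.measurable_rnDeriv _ _)

/-- The image of a POVM under a measurable map. -/
def POVM.map (M : POVM Ω H) {g : Ω → Ω'} (hg : Measurable g) : POVM Ω' H where
  toFun S := M.toFun (g ⁻¹' S)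
  nonneg' S hS := M.nonneg' _ (hg hS)
  univ' := M.univ'
  iUnion' f hf hd x y := by
    rw [Set.preimage_iUnion]
    exact M.iUnion' _ (fun i => hg (hf i)) (fun i j hij => (hd hij).preimage g) x y

/-- A family of measures `m T = Tr[T M(·)]`, additive and homogeneous in the positive trace-class
operator `T` and of total mass `Tr T`, comes from a POVM. -/
theorem exists_povm_of_measures (m : traceClass H → Measure Ω)
    (hfin : ∀ T, IsFiniteMeasure (m T))
    (hadd : ∀ S T : traceClass H, 0 ≤ (S : H →L[ℂ] H) → 0 ≤ (T : H →L[ℂ] H) →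
      m (S + T) = m S + m T)
    (hsmul : ∀ (c : ℝ) (T : traceClass H), 0 ≤ c → 0 ≤ (T : H →L[ℂ] H) →
      m ((c : ℂ) • T) = ENNReal.ofReal c • m T)
    (huniv : ∀ T : traceClass H, 0 ≤ (T : H →L[ℂ] H) →
      (m T).real Set.univ = (trace (T : H →L[ℂ] H)).re) :
    ∃ M : POVM Ω H, ∀ T : traceClass H, 0 ≤ (T : H →L[ℂ] H) → ∀ S, MeasurableSet S →
      (trace ((T : H →L[ℂ] H) * M.toFun S)).re = (m T).real S := by
  have heff : ∀ S, IsEffect fun T => (m T).real S := fun S =>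
    { add := fun U T hU hT => by rw [hadd U T hU hT, measureReal_add_apply]
      smul := fun c T hc hT => by
        rw [hsmul c T hc hT, measureReal_ennreal_smul_apply, ENNReal.toReal_ofReal hc]
      nonneg := fun T _ => measureReal_nonneg
      le_trace := fun T hT => by
        rw [← huniv T hT]
        exact measureReal_mono (Set.subset_univ S) }
  choose N hN0 hN1 hN using fun S => (heff S).exists_operator
  have hNx : ∀ S x, ⟪N S x, x⟫_ℂ = ((m (ketBra x x)).real S : ℂ) := by
    intro S x
    have h1 := hN S (ketBra x x) (ketBra_self_nonneg x)
    rw [re_trace_ketBra_mul] at h1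
    have h2 := (ContinuousLinearMap.isSelfAdjoint_iff_isSymmetric.1
      (IsSelfAdjoint.of_nonneg (hN0 S))).coe_re_inner_apply_self x
    rw [h1]
    refine h2.symm.trans ?_
    congr 1
    exact inner_re_symm (𝕜 := ℂ) _ _
  have hsym : ∀ S x y, ⟪N S x, y⟫_ℂ = ⟪x, N S y⟫_ℂ := fun S =>
    ContinuousLinearMap.isSelfAdjoint_iff_isSymmetric.1 (IsSelfAdjoint.of_nonneg (hN0 S))
  have hsum : ∀ f : ℕ → Set Ω, (∀ i, MeasurableSet (f i)) →
      Pairwise (Function.onFun Disjoint f) → ∀ x,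
      HasSum (fun i => ⟪N (f i) x, x⟫_ℂ) ⟪N (⋃ i, f i) x, x⟫_ℂ := by
    intro f hf hd x
    simp_rw [hNx]
    have h1 := measure_iUnion (μ := m (ketBra x x)) hd hf
    have h2 : HasSum (fun i => (m (ketBra x x)).real (f i)) ((m (ketBra x x)).real (⋃ i, f i)) := by
      simp only [measureReal_def]
      have h3 : ∑' i, m (ketBra x x) (f i) ≠ ⊤ := by
        rw [← h1]
        exact measure_ne_top _ _
      rw [h1, ENNReal.tsum_toReal_eq fun i => measure_ne_top _ _]
      exact ENNReal.hasSum_toReal h3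
    exact h2.mapL Complex.ofRealCLM
  refine ⟨⟨N, fun S _ => hN0 S, ?_, fun f hf hd x y => ?_⟩, fun T hT S _ => (hN S T hT).symm⟩
  · have : (N Set.univ : H →ₗ[ℂ] H) = ((1 : H →L[ℂ] H) : H →ₗ[ℂ] H) := by
      refine (ext_inner_map _ _).1 fun x => ?_
      have h1 := huniv _ (ketBra_self_nonneg x)
      rw [trace_ketBra] at h1
      change ⟪N Set.univ x, x⟫_ℂ = ⟪x, x⟫_ℂ
      rw [hNx, h1, inner_self_eq_norm_sq_to_K]
      simp [← Complex.ofReal_pow]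
    ext x
    exact congrArg (fun L : H →ₗ[ℂ] H => L x) this
  -- The measures determine only the diagonal matrix elements; polarization transfers countable
  -- additivity to the others.
  · have hp : ∀ S, ⟪x, N S y⟫_ℂ = (⟪N S (y + x), y + x⟫_ℂ - ⟪N S (y - x), y - x⟫_ℂ +
        Complex.I * ⟪N S (y + Complex.I • x), y + Complex.I • x⟫_ℂ -
        Complex.I * ⟪N S (y - Complex.I • x), y - Complex.I • x⟫_ℂ) / 4 := fun S => by
      rw [← hsym]
      exact inner_map_polarization (N S : H →ₗ[ℂ] H) y x
    simp_rw [hp]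
    refine HasSum.div_const ?_ 4
    exact (((hsum f hf hd _).sub (hsum f hf hd _)).add ((hsum f hf hd _).mul_left _)).sub
      ((hsum f hf hd _).mul_left _)

end POVMLaws

/-! ### Riesz representation with respect to a seminorm -/

section Riesz

/-- A linear functional dominated by `‖K ·‖` is represented by a vector in the closed range of `K`. -/
theorem exists_riesz_of_le_norm {V F : Type*} [AddCommGroup V] [Module ℝ V] [NormedAddCommGroup F]
    [InnerProductSpace ℝ F] [CompleteSpace F] (K : V →ₗ[ℝ] F) (l : V →ₗ[ℝ] ℝ) {C : ℝ} (hC : 0 ≤ C)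
    (h : ∀ v, |l v| ≤ C * ‖K v‖) :
    ∃ Z ∈ (LinearMap.range K).topologicalClosure, ‖Z‖ ≤ C ∧ ∀ v, ⟪Z, K v⟫_ℝ = l v := by
  have hker : LinearMap.ker K ≤ LinearMap.ker l := by
    intro v hv
    have hv' : K v = 0 := hv
    have := h v
    rw [hv', norm_zero, mul_zero] at this
    exact abs_nonpos_iff.1 this
  -- The domination makes `l` vanish on ker K, so it descends to the range.
  let f₀ : LinearMap.range K →ₗ[ℝ] ℝ :=
    ((LinearMap.ker K).liftQ l hker).comp K.quotKerEquivRange.symm.toLinearMap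
  have hf₀ : ∀ v, f₀ ⟨K v, v, rfl⟩ = l v := by
    intro v
    have h1 : K.quotKerEquivRange.symm ⟨K v, v, rfl⟩ = (LinearMap.ker K).mkQ v := by
      rw [LinearEquiv.symm_apply_eq]
      rfl
    change (LinearMap.ker K).liftQ l hker (K.quotKerEquivRange.symm ⟨K v, v, rfl⟩) = l v
    rw [h1]
    exact Submodule.liftQ_apply _ _ _
  have hb : ∀ x : LinearMap.range K, ‖f₀ x‖ ≤ C * ‖x‖ := by
    rintro ⟨_, v, rfl⟩
    rw [hf₀]
    exact h v
  obtain ⟨g, hg, hgn⟩ := exists_extension_norm_eq (LinearMap.range K) (f₀.mkContinuous C hb)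
  set Z' := (InnerProductSpace.toDual ℝ F).symm g with hZ'
  set U := (LinearMap.range K).topologicalClosure with hU
  have : CompleteSpace U := (Submodule.isClosed_topologicalClosure _).completeSpace_coe
  -- Projecting onto the closed range changes no inner product with the range and does not increase
  -- the norm.
  refine ⟨U.starProjection Z', U.starProjection_apply_mem Z', ?_, fun v => ?_⟩
  · calc ‖U.starProjection Z'‖ ≤ ‖U.starProjection‖ * ‖Z'‖ := ContinuousLinearMap.le_opNorm _ _
      _ ≤ 1 * ‖Z'‖ := by
        gcongr
        exact U.starProjection_norm_le
      _ = ‖g‖ := by rw [one_mul, hZ', LinearIsometryEquiv.norm_map]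
      _ ≤ C := by
        rw [hgn]
        exact LinearMap.mkContinuous_norm_le _ hC _
  · have hmem : K v ∈ U := Submodule.le_topologicalClosure _ ⟨v, rfl⟩
    rw [Submodule.inner_starProjection_left_eq_right, Submodule.starProjection_eq_self_iff.2 hmem,
      hZ', InnerProductSpace.toDual_symm_apply, hg ⟨K v, v, rfl⟩]
    exact hf₀ v

end Riesz

/-! ### The Hilbert space of Hilbert-Schmidt operators and symmetric logarithmic derivatives -/

section HilbertSchmidt

variable {H : Type*} [NormedAddCommGroup H] [InnerProductSpace ℂ H]

theorem memℓp_two_iff {ι F : Type*} [NormedAddCommGroup F] {f : ι → F} :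
    Memℓp f 2 ↔ Summable fun i => ‖f i‖ ^ 2 := by
  rw [memℓp_gen_iff (by norm_num)]
  norm_num

variable [CompleteSpace H]

variable (H) in
/-- The Hilbert space of square-summable families indexed by the fixed orthonormal basis; the
Hilbert-Schmidt operator `Z` corresponds to the family `(Z eᵢ)`. -/
def HSFamily : Type _ := lp (fun _ : (exists_hilbertBasis ℂ H).choose => H) 2

namespace HSFamily

noncomputable instance : NormedAddCommGroup (HSFamily H) :=
  inferInstanceAs (NormedAddCommGroup (lp (fun _ : (exists_hilbertBasis ℂ H).choose => H) 2))

noncomputable instance : InnerProductSpace ℂ (HSFamily H) :=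
  inferInstanceAs (InnerProductSpace ℂ (lp (fun _ : (exists_hilbertBasis ℂ H).choose => H) 2))

instance : CompleteSpace (HSFamily H) :=
  inferInstanceAs (CompleteSpace (lp (fun _ : (exists_hilbertBasis ℂ H).choose => H) 2))

noncomputable instance : InnerProductSpace ℝ (HSFamily H) := InnerProductSpace.complexToReal

/-- The members of the family. -/
def coord (Z : HSFamily H) (i : (exists_hilbertBasis ℂ H).choose) : H := Z.1 i

theorem coord_add (Z W : HSFamily H) (i : (exists_hilbertBasis ℂ H).choose) :
    (Z + W).coord i = Z.coord i + W.coord i := rfl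

theorem coord_smul (c : ℂ) (Z : HSFamily H) (i : (exists_hilbertBasis ℂ H).choose) :
    (c • Z).coord i = c • Z.coord i := rfl

theorem ext_coord {Z W : HSFamily H} (h : ∀ i, Z.coord i = W.coord i) : Z = W :=
  lp.ext (funext h)

theorem continuous_coord (i : (exists_hilbertBasis ℂ H).choose) :
    Continuous fun Z : HSFamily H => Z.coord i :=
  (lp.lipschitzWith_one_eval (E := fun _ : (exists_hilbertBasis ℂ H).choose => H) 2 i).continuous

theorem summable_coord (Z : HSFamily H) : Summable fun i => ‖Z.coord i‖ ^ 2 := memℓp_two_iff.1 Z.2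

theorem norm_sq (Z : HSFamily H) : ‖Z‖ ^ 2 = ∑' i, ‖Z.coord i‖ ^ 2 := by
  have := lp.norm_rpow_eq_tsum (E := fun _ : (exists_hilbertBasis ℂ H).choose => H) (p := 2)
    (by norm_num) Z
  simp only [ENNReal.toReal_ofNat, Real.rpow_ofNat] at this
  exact this

theorem hasSum_real_inner (Z W : HSFamily H) :
    HasSum (fun i => (⟪Z.coord i, W.coord i⟫_ℂ).re) ⟪Z, W⟫_ℝ :=
  (lp.hasSum_inner (𝕜 := ℂ) (G := fun _ : (exists_hilbertBasis ℂ H).choose => H) Z W).mapL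
    Complex.reCLM

/-- The family `(Z eᵢ)` of a Hilbert-Schmidt operator `Z`. -/
noncomputable def ofOperator {Z : H →L[ℂ] H} (hZ : hsNormSq Z ≠ ⊤) : HSFamily H :=
  ⟨fun i => Z (onb H i), memℓp_two_iff.2 (hsNormSq_ne_top_iff.1 hZ)⟩

theorem coord_ofOperator {Z : H →L[ℂ] H} (hZ : hsNormSq Z ≠ ⊤)
    (i : (exists_hilbertBasis ℂ H).choose) : (ofOperator hZ).coord i = Z (onb H i) := rfl

end HSFamily

/-- A square-summable family `(Zᵢ)` is `(Y eᵢ)` for a Hilbert-Schmidt operator `Y`. -/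
theorem exists_operator_of_family (Z : HSFamily H) :
    ∃ Y : H →L[ℂ] H, (∀ i, Y (onb H i) = Z.coord i) ∧
      ∀ z, HasSum (fun i => ⟪onb H i, z⟫_ℂ • Z.coord i) (Y z) := by
  have hZ : Summable fun i => ‖Z.coord i‖ ^ 2 := Z.summable_coord
  have hb : ∀ (z : H) (F : Finset _), ∑ i ∈ F, ‖⟪onb H i, z⟫_ℂ • Z.coord i‖ ≤ ‖Z‖ * ‖z‖ := by
    intro z F
    have h1 := (onb H).orthonormal.sum_inner_products_le z (s := F)
    have h2 := hZ.sum_le_tsum F fun i _ => by positivity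
    rw [← HSFamily.norm_sq] at h2
    calc ∑ i ∈ F, ‖⟪onb H i, z⟫_ℂ • Z.coord i‖ = ∑ i ∈ F, ‖⟪onb H i, z⟫_ℂ‖ * ‖Z.coord i‖ := by
          simp_rw [norm_smul]
      _ ≤ √(∑ i ∈ F, ‖⟪onb H i, z⟫_ℂ‖ ^ 2) * √(∑ i ∈ F, ‖Z.coord i‖ ^ 2) :=
          Real.sum_mul_le_sqrt_mul_sqrt _ _ _
      _ ≤ √(‖z‖ ^ 2) * √(‖Z‖ ^ 2) := by gcongr
      _ = _ := by
        rw [Real.sqrt_sq (norm_nonneg _), Real.sqrt_sq (norm_nonneg _), mul_comm]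
  have hs : ∀ z, Summable fun i => ‖⟪onb H i, z⟫_ℂ • Z.coord i‖ := fun z =>
    summable_of_sum_le (fun _ => norm_nonneg _) (hb z)
  have hs' : ∀ z, Summable fun i => ⟪onb H i, z⟫_ℂ • Z.coord i := fun z => (hs z).of_norm
  let Y₀ : H →ₗ[ℂ] H :=
    { toFun := fun z => ∑' i, ⟪onb H i, z⟫_ℂ • Z.coord i
      map_add' := fun x y => by
        rw [← (hs' x).tsum_add (hs' y)]
        simp_rw [inner_add_right, add_smul]
      map_smul' := fun c x => by
        rw [RingHom.id_apply, ← (hs' x).tsum_const_smul c]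
        simp_rw [inner_smul_right, mul_smul] }
  refine ⟨Y₀.mkContinuous ‖Z‖ fun z => ?_, fun i => ?_, fun z => (hs' z).hasSum⟩
  · exact (norm_tsum_le_tsum_norm (hs z)).trans (Real.tsum_le_of_sum_le (fun _ => norm_nonneg _) (hb z))
  · change ∑' j, ⟪onb H j, onb H i⟫_ℂ • Z.coord j = Z.coord i
    rw [tsum_eq_single i]
    · rw [inner_self_eq_norm_sq_to_K, (onb H).orthonormal.1]
      simp
    · intro j hj
      rw [(onb H).orthonormal.2 hj, zero_smul]

/-- The family `(X √σ eᵢ)` of a bounded self-adjoint operator `X`. -/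
noncomputable def sqrtFamily {σ : H →L[ℂ] H} (hσ : hsNormSq (CFC.sqrt σ) ≠ ⊤) :
    selfAdjoint (H →L[ℂ] H) →ₗ[ℝ] HSFamily H where
  toFun X := HSFamily.ofOperator (hsNormSq_mul_left (X : H →L[ℂ] H) hσ)
  map_add' X Y := HSFamily.ext_coord fun i => by
    rw [HSFamily.coord_add, HSFamily.coord_ofOperator, HSFamily.coord_ofOperator,
      HSFamily.coord_ofOperator, AddSubgroup.coe_add, add_mul, add_apply]
  map_smul' c X := HSFamily.ext_coord fun i => by
    rw [RingHom.id_apply, ← Complex.coe_smul c, HSFamily.coord_smul, HSFamily.coord_ofOperator,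
      HSFamily.coord_ofOperator, selfAdjoint.val_smul, smul_mul_assoc, Complex.coe_smul]
    rfl

theorem sqrtFamily_apply {σ : H →L[ℂ] H} (hσ : hsNormSq (CFC.sqrt σ) ≠ ⊤)
    (X : selfAdjoint (H →L[ℂ] H)) (i : (exists_hilbertBasis ℂ H).choose) :
    (sqrtFamily hσ X).coord i = (X : H →L[ℂ] H) (CFC.sqrt σ (onb H i)) := rfl

theorem norm_sqrtFamily_sq {σ : H →L[ℂ] H} (hσ0 : 0 ≤ σ) (hσ : hsNormSq (CFC.sqrt σ) ≠ ⊤)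
    (X : selfAdjoint (H →L[ℂ] H)) :
    ‖sqrtFamily hσ X‖ ^ 2 = (trace ((X : H →L[ℂ] H) * σ * (X : H →L[ℂ] H))).re := by
  have h := tsum_norm_sq_eq_trace (hsNormSq_mul_left (X : H →L[ℂ] H) hσ)
  rw [star_mul, star_sqrt, X.2.star_eq, mul_assoc (X : H →L[ℂ] H), ← mul_assoc (CFC.sqrt σ),
    CFC.sqrt_mul_sqrt_self σ hσ0, ← mul_assoc] at h
  rw [HSFamily.norm_sq, ← h]
  rfl

theorem isSelfAdjoint_ext_inner {S T : H →L[ℂ] H} (hS : IsSelfAdjoint S) (hT : IsSelfAdjoint T)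
    (h : ∀ x, (⟪x, S x⟫_ℂ).re = (⟪x, T x⟫_ℂ).re) : S = T := by
  refine le_antisymm ?_ ?_ <;> rw [← sub_nonneg, nonneg_iff_re_inner]
  · refine ⟨hT.sub hS, fun x => ?_⟩
    rw [sub_apply, inner_sub_right, Complex.sub_re, h, sub_self]
  · refine ⟨hS.sub hT, fun x => ?_⟩
    rw [sub_apply, inner_sub_right, Complex.sub_re, h, sub_self]

/-- A representative of `X ↦ Tr[X τ]` in the closure of `{X √σ}` is a symmetric logarithmic
derivative. -/
theorem sldInfo_le_of_riesz {σ τ : H →L[ℂ] H} (hσ : hsNormSq (CFC.sqrt σ) ≠ ⊤)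
    (hτ : IsSelfAdjoint τ) {Z : HSFamily H}
    (hZ : Z ∈ (LinearMap.range (sqrtFamily hσ)).topologicalClosure)
    (h : ∀ X : selfAdjoint (H →L[ℂ] H),
      ⟪Z, sqrtFamily hσ X⟫_ℝ = (trace ((X : H →L[ℂ] H) * τ)).re) :
    sldInfo σ τ ≤ ENNReal.ofReal (‖Z‖ ^ 2) := by
  obtain ⟨Y, hY, hYs⟩ := exists_operator_of_family Z
  have hYn : hsNormSq Y = ENNReal.ofReal (‖Z‖ ^ 2) := by
    have : Summable fun i => ‖Y (onb H i)‖ ^ 2 := by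
      simp_rw [hY]
      exact Z.summable_coord
    rw [hsNormSq_eq_ofReal (hsNormSq_ne_top_iff.2 this), HSFamily.norm_sq]
    simp_rw [hY]
  rw [← hYn]
  refine iInf₂_le Y ⟨?_, ?_⟩
  -- Self-adjointness of √σ Y is a closed condition on the columns and holds for Y = X√σ, hence on
  -- the whole closure. This is why `Z` is required to lie there.
  · have hsym : ∀ i j, ⟪CFC.sqrt σ (onb H j), Z.coord i⟫_ℂ = ⟪Z.coord j, CFC.sqrt σ (onb H i)⟫_ℂ := by
      intro i j
      have hcl : IsClosed {W : HSFamily H |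
          ⟪CFC.sqrt σ (onb H j), W.coord i⟫_ℂ = ⟪W.coord j, CFC.sqrt σ (onb H i)⟫_ℂ} := by
        have hc : ∀ k, Continuous fun W : HSFamily H => W.coord k :=
          HSFamily.continuous_coord
        exact isClosed_eq (continuous_const.inner (hc i)) ((hc j).inner continuous_const)
      refine hcl.closure_subset_iff.2 ?_ hZ
      rintro _ ⟨X, rfl⟩
      exact ((ContinuousLinearMap.isSelfAdjoint_iff_isSymmetric.1 X.2) _ _).symm
    have hd : Dense (Submodule.span ℂ (Set.range (onb H)) : Set H) :=
      Submodule.dense_iff_topologicalClosure_eq_top.2 (onb H).dense_span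
    refine ContinuousLinearMap.ext_on (s := Set.range (onb H)) hd ?_
    rintro _ ⟨i, rfl⟩
    refine (onb H).repr.injective (lp.ext (funext fun j => ?_))
    rw [HilbertBasis.repr_apply_apply, HilbertBasis.repr_apply_apply,
      ContinuousLinearMap.star_eq_adjoint, ContinuousLinearMap.adjoint_inner_right,
      mul_apply_eq_comp, mul_apply_eq_comp, ← inner_sqrt_left, hY, hY, hsym, inner_sqrt_left]
  · refine isSelfAdjoint_ext_inner ?_ hτ fun u => ?_
    · have h1 : star (Y * CFC.sqrt σ + CFC.sqrt σ * star Y) =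
          Y * CFC.sqrt σ + CFC.sqrt σ * star Y := by
        rw [star_add, star_mul, star_mul, star_star, star_sqrt, add_comm]
      rw [isSelfAdjoint_iff, star_smul, h1]
      congr 1
      simp
    -- Testing with X = |u⟩⟨u| recovers the quadratic form of τ, which determines a self-adjoint
    -- operator.
    · have h1 := h ⟨_, isSelfAdjoint_rankOne u⟩
      have h2 : (trace ((InnerProductSpace.rankOne ℂ u u : H →L[ℂ] H) * τ)).re = (⟪u, τ u⟫_ℂ).re :=
        re_trace_ketBra_mul u τ
      simp only at h1
      rw [h2] at h1
      rw [← h1]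
      have h3 := HSFamily.hasSum_real_inner Z (sqrtFamily hσ ⟨_, isSelfAdjoint_rankOne u⟩)
      have h4 := ((hYs (CFC.sqrt σ u)).mapL (innerSL ℂ u)).mapL Complex.reCLM
      have h5 : (⟪u, Y (CFC.sqrt σ u)⟫_ℂ).re =
          ⟪Z, sqrtFamily hσ ⟨_, isSelfAdjoint_rankOne u⟩⟫_ℝ := by
        refine HasSum.unique h4 ?_
        convert h3 using 2 with i
        rw [sqrtFamily_apply, InnerProductSpace.rankOne_apply, inner_smul_right]
        simp only [map_smul, innerSL_apply_apply, smul_eq_mul, Complex.reCLM_apply]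
        rw [← inner_sqrt_left, ← inner_conj_symm (CFC.sqrt σ (onb H i)), ← inner_conj_symm u (Z.coord i),
          ← map_mul, Complex.conj_re]
      rw [← h5, smul_apply, inner_smul_right, add_apply, inner_add_right, mul_apply_eq_comp,
        mul_apply_eq_comp, ← inner_sqrt_left, ContinuousLinearMap.star_eq_adjoint,
        ContinuousLinearMap.adjoint_inner_right, ← inner_conj_symm (Y _), Complex.add_conj]
      simp

end HilbertSchmidt

/-! ### Riesz representation along a linear relation -/

section Relation

/-- Linearity is asked of `b` only along `V`, because the derivative of an expectation value is
linear only on the admissible directions. Working with pairs (φ, Z_φ) avoids having to select Z_φ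
linearly in φ. -/
theorem exists_riesz_of_relation {W F : Type*} [AddCommGroup W] [Module ℝ W] [NormedAddCommGroup F]
    [InnerProductSpace ℝ F] [CompleteSpace F] (V : Submodule ℝ (W × F)) (b : W → ℝ)
    (badd : ∀ p q, p ∈ V → q ∈ V → b (p.1 + q.1) = b p.1 + b q.1)
    (bsmul : ∀ (a : ℝ) p, p ∈ V → b (a • p.1) = a * b p.1) {C : ℝ} (hC : 0 ≤ C)
    (h : ∀ p ∈ V, |b p.1| ≤ C * ‖p.2‖) {U : Submodule ℝ F} (hU : IsClosed (U : Set F))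
    (hV : ∀ p ∈ V, p.2 ∈ U) :
    ∃ Z ∈ U, ‖Z‖ ≤ C ∧ ∀ p ∈ V, ⟪Z, p.2⟫_ℝ = b p.1 := by
  let l : V →ₗ[ℝ] ℝ :=
    { toFun := fun p => b p.1.1
      map_add' := fun p q => badd p q p.2 q.2
      map_smul' := fun a p => bsmul a p p.2 }
  let K : V →ₗ[ℝ] F := (LinearMap.snd ℝ W F).comp V.subtype
  obtain ⟨Z, hZ, hZn, hZb⟩ := exists_riesz_of_le_norm K l hC fun p => h p p.2
  refine ⟨Z, ?_, hZn, fun p hp => hZb ⟨p, hp⟩⟩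
  refine Submodule.topologicalClosure_minimal _ ?_ hU hZ
  rintro _ ⟨p, rfl⟩
  exact hV p p.2

end Relation

/-! ### The directions form a real vector space on which the derivative is linear -/

section Directions

variable {H : Type*} [NormedAddCommGroup H] [InnerProductSpace ℂ H] [CompleteSpace H]

/-- A bounded operator is determined on the dense domain, so the choice in `expVal` is immaterial.
-/
theorem expVal_eq_trace {A : H →ₗ.[ℂ] H} (hA : Dense (A.domain : Set H)) {R : H →L[ℂ] H}
    {T : traceClass H} (hT : ∀ x : A.domain, (T : H →L[ℂ] H) x = R (A x)) :
    expVal R A = trace (T : H →L[ℂ] H) := by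
  have h : MulMemTraceClass R A := ⟨T, hT⟩
  unfold expVal
  rw [dif_pos h]
  congr 1
  refine ContinuousLinearMap.coeFn_injective (Continuous.ext_on hA (map_continuous _) (map_continuous _) fun x hx => ?_)
  rw [hT ⟨x, hx⟩]
  exact h.choose_spec ⟨x, hx⟩

theorem sldInfo_lt_top_iff {σ τ : H →L[ℂ] H} :
    sldInfo σ τ < ⊤ ↔ ∃ Y, IsSLD σ τ Y ∧ hsNormSq Y ≠ ⊤ := by
  unfold sldInfo
  simp only [iInf_lt_iff, exists_prop]
  simp only [lt_top_iff_ne_top]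

theorem IsSLD.add {σ τ τ' Y Y' : H →L[ℂ] H} (h : IsSLD σ τ Y) (h' : IsSLD σ τ' Y') :
    IsSLD σ (τ + τ') (Y + Y') := by
  refine ⟨?_, ?_⟩
  · rw [mul_add]
    exact h.1.add h'.1
  · rw [← h.2, ← h'.2, star_add, add_mul, mul_add, ← smul_add]
    congr 1
    abel

theorem IsSLD.smul {σ τ Y : H →L[ℂ] H} (h : IsSLD σ τ Y) (c : ℝ) :
    IsSLD σ ((c : ℂ) • τ) ((c : ℂ) • Y) := by
  refine ⟨?_, ?_⟩
  · rw [mul_smul_comm, isSelfAdjoint_iff, star_smul, h.1.star_eq]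
    simp
  · rw [← h.2, star_smul, smul_mul_assoc, mul_smul_comm, smul_comm (c : ℂ), smul_add]
    simp

theorem real_smul_eq (c : ℝ) (φ : traceClass H) : c • φ = (c : ℂ) • φ :=
  Subtype.ext (Complex.coe_smul c (φ : H →L[ℂ] H)).symm

theorem directions_add {ρ : FaithfulState H} {A : H →ₗ.[ℂ] H} {φ ψ : traceClass H}
    (hφ : φ ∈ directions ρ A) (hψ : ψ ∈ directions ρ A) : φ + ψ ∈ directions ρ A := by
  obtain ⟨h1, h2, h3, T, hT⟩ := hφ
  obtain ⟨h1', h2', h3', T', hT'⟩ := hψ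
  refine ⟨h1.add h1', ?_, ?_, T + T', fun x => ?_⟩
  · rw [Submodule.coe_add, trace_add φ.2 ψ.2, h2, h2', add_zero]
  · rw [sldInfo_lt_top_iff] at h3 h3' ⊢
    obtain ⟨Y, hY, hn⟩ := h3
    obtain ⟨Y', hY', hn'⟩ := h3'
    exact ⟨Y + Y', hY.add hY', hsNormSq_add hn hn'⟩
  · rw [Submodule.coe_add, Submodule.coe_add, add_apply, add_apply, hT, hT']

theorem directions_smul {ρ : FaithfulState H} {A : H →ₗ.[ℂ] H} {φ : traceClass H}
    (hφ : φ ∈ directions ρ A) (c : ℝ) : c • φ ∈ directions ρ A := by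
  obtain ⟨h1, h2, h3, T, hT⟩ := hφ
  rw [real_smul_eq]
  refine ⟨?_, ?_, ?_, (c : ℂ) • T, fun x => ?_⟩
  · rw [Submodule.coe_smul, isSelfAdjoint_iff, star_smul, h1.star_eq]
    simp
  · rw [Submodule.coe_smul, trace_smul, h2, mul_zero]
  · rw [sldInfo_lt_top_iff] at h3 ⊢
    obtain ⟨Y, hY, hn⟩ := h3
    exact ⟨_, hY.smul c, hsNormSq_smul _ hn⟩
  · rw [Submodule.coe_smul, Submodule.coe_smul, smul_apply, smul_apply, hT]

theorem directions_zero (ρ : FaithfulState H) (A : H →ₗ.[ℂ] H) : 0 ∈ directions ρ A := by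
  refine ⟨IsSelfAdjoint.zero _, by simp [trace], ?_, 0, fun x => by simp⟩
  rw [sldInfo_lt_top_iff]
  exact ⟨0, ⟨by simp, by simp⟩, by simp [hsNormSq]⟩

theorem expDeriv_add {ρ : FaithfulState H} {A : H →ₗ.[ℂ] H} (hA : Dense (A.domain : Set H))
    {φ ψ : traceClass H} (hφ : φ ∈ directions ρ A) (hψ : ψ ∈ directions ρ A) :
    expDeriv A (φ + ψ) = expDeriv A φ + expDeriv A ψ := by
  obtain ⟨-, -, -, T, hT⟩ := hφ
  obtain ⟨-, -, -, T', hT'⟩ := hψ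
  unfold expDeriv
  rw [expVal_eq_trace hA hT, expVal_eq_trace hA hT', expVal_eq_trace hA (T := T + T') fun x => by
    rw [Submodule.coe_add, Submodule.coe_add, add_apply, add_apply, hT, hT'], Submodule.coe_add,
    trace_add T.2 T'.2, Complex.add_re]

theorem expDeriv_smul {ρ : FaithfulState H} {A : H →ₗ.[ℂ] H} (hA : Dense (A.domain : Set H))
    {φ : traceClass H} (hφ : φ ∈ directions ρ A) (c : ℝ) :
    expDeriv A (c • φ) = c * expDeriv A φ := by
  obtain ⟨-, -, -, T, hT⟩ := hφ
  unfold expDeriv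
  rw [real_smul_eq, expVal_eq_trace hA hT, expVal_eq_trace hA (T := (c : ℂ) • T) fun x => by
    rw [Submodule.coe_smul, Submodule.coe_smul, smul_apply, smul_apply, hT], Submodule.coe_smul,
    trace_smul, Complex.re_ofReal_mul]

end Directions

/-! ### Fisher information of the channel output and approximate optimal estimators -/

section Channel

variable {H : Type*} [NormedAddCommGroup H] [InnerProductSpace ℂ H] [CompleteSpace H]
  {E : traceClass H →ₗ[ℂ] traceClass H}

theorem IsCompletelyPositive.map_nonneg (hE : IsCompletelyPositive E) {T : traceClass H}
    (hT : 0 ≤ (T : H →L[ℂ] H)) : 0 ≤ (E T : H →L[ℂ] H) := by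
  refine nonneg_of_inner_eq fun x => ?_
  have h := hE 1 (fun _ _ => T) (fun v => by
    simpa using ((ContinuousLinearMap.nonneg_iff_isPositive _).1 hT).inner_nonneg_right (v 0))
    (fun _ => x)
  simp only [Finset.univ_unique, Finset.sum_singleton] at h
  exact ⟨_, (Complex.nonneg_iff.1 h).1, Complex.ext rfl (by simpa using (Complex.nonneg_iff.1 h).2.symm)⟩

/-- The product `Z W*` of Hilbert-Schmidt operators, as a trace-class operator. -/
noncomputable def hsMul [TopologicalSpace.SeparableSpace H] {Z W : H →L[ℂ] H} (hZ : hsNormSq Z ≠ ⊤)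
    (hW : hsNormSq W ≠ ⊤) : traceClass H :=
  ⟨Z * star W, isTraceClass_mul_star hZ hW⟩

variable [TopologicalSpace.SeparableSpace H]

/-- The Cauchy-Schwarz inequality for a 2-positive map. -/
theorem IsCompletelyPositive.sq_re_trace_le (hE : IsCompletelyPositive E) {Y R : H →L[ℂ] H}
    (hY : hsNormSq Y ≠ ⊤) (hR : hsNormSq R ≠ ⊤) {X : H →L[ℂ] H} (hX : IsSelfAdjoint X) :
    (trace (X * (E (hsMul hY hR + hsMul hR hY) : H →L[ℂ] H))).re ^ 2 ≤
      4 * (trace (E (hsMul hY hY) : H →L[ℂ] H)).re *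
        (trace (X * (E (hsMul hR hR) : H →L[ℂ] H) * X)).re := by
  -- The positive block matrix C C* for the column C = (Y, R).
  set T : Fin 2 → Fin 2 → traceClass H := ![![hsMul hY hY, hsMul hY hR], ![hsMul hR hY, hsMul hR hR]]
    with hT
  have hpos : ∀ v : Fin 2 → H, 0 ≤ ∑ i, ∑ j, ⟪v i, (T i j : H →L[ℂ] H) (v j)⟫_ℂ := by
    intro v
    have h1 : ∑ i, ∑ j, ⟪v i, (T i j : H →L[ℂ] H) (v j)⟫_ℂ =
        ⟪star Y (v 0) + star R (v 1), star Y (v 0) + star R (v 1)⟫_ℂ := by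
      simp only [Fin.sum_univ_two, hT, hsMul, Matrix.cons_val_zero, Matrix.cons_val_one,
        mul_apply_eq_comp, inner_add_left, inner_add_right, ContinuousLinearMap.star_eq_adjoint,
        ContinuousLinearMap.adjoint_inner_left]
      ring
    rw [h1, inner_self_eq_norm_sq_to_K]
    have h2 : (0 : ℝ) ≤ ‖star Y (v 0) + star R (v 1)‖ ^ 2 := sq_nonneg _
    simpa using Complex.zero_le_real.2 h2
  -- The image of the block matrix is tested on the vectors (a eᵢ, X eᵢ) and summed over i. The
  -- discriminant of this quadratic in `a` is the claim.
  have hq : ∀ a : ℝ, 0 ≤ (trace (E (hsMul hY hY) : H →L[ℂ] H)).re * (a * a) +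
      (trace (X * (E (hsMul hY hR + hsMul hR hY) : H →L[ℂ] H))).re * a +
        (trace (X * (E (hsMul hR hR) : H →L[ℂ] H) * X)).re := by
    intro a
    have s1 := (E (hsMul hY hY)).2.hasSum_re_inner
    have s2 := ((E (hsMul hY hR)).2.mul_right X).hasSum_re_inner
    have s3 := ((E (hsMul hR hY)).2.mul_left X).hasSum_re_inner
    have s4 := (((E (hsMul hR hR)).2.mul_left X).mul_right X).hasSum_re_inner
    rw [trace_mul_comm (E (hsMul hY hR)).2] at s2
    have s := ((s1.mul_right (a * a)).add ((s2.add s3).mul_right a)).add s4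
    rw [map_add, Submodule.coe_add, mul_add,
      trace_add ((E (hsMul hY hR)).2.mul_left X) ((E (hsMul hR hY)).2.mul_left X), Complex.add_re]
    refine s.nonneg fun i => ?_
    have h := hE 2 T hpos ![(a : ℂ) • onb H i, X (onb H i)]
    have hX' : ∀ x y, ⟪X x, y⟫_ℂ = ⟪x, X y⟫_ℂ :=
      ContinuousLinearMap.isSelfAdjoint_iff_isSymmetric.1 hX
    have h2 := (Complex.nonneg_iff.1 h).1
    simp only [Fin.sum_univ_two, hT, Matrix.cons_val_zero, Matrix.cons_val_one, map_smul,
      inner_smul_left, inner_smul_right, Complex.conj_ofReal, hX', Complex.add_re,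
      Complex.re_ofReal_mul] at h2
    simp only [mul_apply_eq_comp]
    linarith
  have h := discrim_le_zero hq
  unfold discrim at h
  linarith

theorem hsMul_self_nonneg {Z : H →L[ℂ] H} (hZ : hsNormSq Z ≠ ⊤) :
    0 ≤ (hsMul hZ hZ : H →L[ℂ] H) :=
  mul_star_self_nonneg Z

theorem hsNormSq_sub {Z W : H →L[ℂ] H} (hZ : hsNormSq Z ≠ ⊤) (hW : hsNormSq W ≠ ⊤) :
    hsNormSq (Z - W) ≠ ⊤ := by
  have := hsNormSq_add hZ (hsNormSq_smul (-1) hW)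
  rwa [neg_one_smul, ← sub_eq_add_neg] at this

theorem FaithfulState.hsNormSq_sqrt (ρ : FaithfulState H) :
    hsNormSq (CFC.sqrt (ρ.op : H →L[ℂ] H)) ≠ ⊤ := ρ.op.2.hsNormSq_sqrt ρ.nonneg'

theorem FaithfulState.hsMul_sqrt (ρ : FaithfulState H) :
    hsMul ρ.hsNormSq_sqrt ρ.hsNormSq_sqrt = ρ.op := Subtype.ext (by
  change CFC.sqrt (ρ.op : H →L[ℂ] H) * star (CFC.sqrt (ρ.op : H →L[ℂ] H)) = _
  rw [star_sqrt, CFC.sqrt_mul_sqrt_self _ ρ.nonneg'])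

theorem IsSLD.two_smul_eq {ρ : FaithfulState H} {φ : traceClass H} {Y : H →L[ℂ] H}
    (hY : IsSLD (ρ.op : H →L[ℂ] H) φ Y) (hYn : hsNormSq Y ≠ ⊤) :
    hsMul hYn ρ.hsNormSq_sqrt + hsMul ρ.hsNormSq_sqrt hYn = (2 : ℂ) • φ := Subtype.ext (by
  change Y * star (CFC.sqrt (ρ.op : H →L[ℂ] H)) + CFC.sqrt (ρ.op : H →L[ℂ] H) * star Y =
    (2 : ℂ) • (φ : H →L[ℂ] H)
  rw [star_sqrt, ← hY.2, smul_smul]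
  norm_num)

theorem hsMul_add_sub {Z W : H →L[ℂ] H} (hZ : hsNormSq Z ≠ ⊤) (hW : hsNormSq W ≠ ⊤) :
    hsMul (hsNormSq_add hZ hW) (hsNormSq_add hZ hW) =
      hsMul (hsNormSq_sub hZ hW) (hsNormSq_sub hZ hW) + (2 : ℂ) • (hsMul hZ hW + hsMul hW hZ) :=
  Subtype.ext (by
  change (Z + W) * star (Z + W) = (Z - W) * star (Z - W) + (2 : ℂ) • (Z * star W + W * star Z)
  rw [two_smul, star_add, star_sub]
  noncomm_ring)

/-- `T₊ = T₋ + 4 φ` with `T₊, T₋ ≥ 0`. -/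
theorem IsSLD.hsMul_eq {ρ : FaithfulState H} {φ : traceClass H} {Y : H →L[ℂ] H}
    (hY : IsSLD (ρ.op : H →L[ℂ] H) φ Y) (hYn : hsNormSq Y ≠ ⊤) :
    hsMul (hsNormSq_add hYn ρ.hsNormSq_sqrt) (hsNormSq_add hYn ρ.hsNormSq_sqrt) =
      hsMul (hsNormSq_sub hYn ρ.hsNormSq_sqrt) (hsNormSq_sub hYn ρ.hsNormSq_sqrt) +
        (4 : ℂ) • φ := by
  rw [hsMul_add_sub hYn ρ.hsNormSq_sqrt, hY.two_smul_eq hYn, smul_smul]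
  norm_num

/-- The map is only known to preserve positivity, so φ is written through 4φ = T₊ - T₋ with positive
T₊, T₋ built from the SLD. -/
theorem IsCompletelyPositive.isSelfAdjoint_map (hE : IsCompletelyPositive E) {ρ : FaithfulState H}
    {φ : traceClass H} {Y : H →L[ℂ] H} (hY : IsSLD (ρ.op : H →L[ℂ] H) φ Y)
    (hYn : hsNormSq Y ≠ ⊤) : IsSelfAdjoint (E φ : H →L[ℂ] H) := by
  have h5 : IsSelfAdjoint (E ((4 : ℂ) • φ) : H →L[ℂ] H) := by
    rw [eq_sub_of_add_eq' (hY.hsMul_eq hYn).symm, map_sub, Submodule.coe_sub]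
    refine IsSelfAdjoint.sub ?_ ?_ <;>
    exact IsSelfAdjoint.of_nonneg (hE.map_nonneg (hsMul_self_nonneg _))
  have h6 : (E φ : H →L[ℂ] H) = (4⁻¹ : ℝ) • (E ((4 : ℂ) • φ) : H →L[ℂ] H) := by
    rw [map_smul, Submodule.coe_smul, ← Complex.coe_smul, smul_smul]
    norm_num
  rw [h6]
  exact (IsSelfAdjoint.all _).smul h5

/-- The functional `X ↦ Tr[X ℰ(φ)]` on bounded observables. -/
noncomputable def outputMean (E : traceClass H →ₗ[ℂ] traceClass H) (φ : traceClass H) :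
    selfAdjoint (H →L[ℂ] H) →ₗ[ℝ] ℝ where
  toFun X := (trace ((X : H →L[ℂ] H) * (E φ : H →L[ℂ] H))).re
  map_add' X X' := by
    rw [AddSubgroup.coe_add, add_mul, trace_add ((E φ).2.mul_left _) ((E φ).2.mul_left _),
      Complex.add_re]
  map_smul' a X := by
    rw [selfAdjoint.val_smul, ← Complex.coe_smul, smul_mul_assoc, trace_smul,
      Complex.re_ofReal_mul]
    rfl

theorem outputMean_apply (φ : traceClass H) (X : selfAdjoint (H →L[ℂ] H)) :
    outputMean E φ X = (trace ((X : H →L[ℂ] H) * (E φ : H →L[ℂ] H))).re := rfl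

theorem outputMean_add (φ ψ : traceClass H) (X : selfAdjoint (H →L[ℂ] H)) :
    outputMean E (φ + ψ) X = outputMean E φ X + outputMean E ψ X := by
  rw [outputMean_apply, outputMean_apply, outputMean_apply, map_add, Submodule.coe_add, mul_add,
    trace_add ((E φ).2.mul_left _) ((E ψ).2.mul_left _), Complex.add_re]

theorem outputMean_smul (a : ℝ) (φ : traceClass H) (X : selfAdjoint (H →L[ℂ] H)) :
    outputMean E (a • φ) X = a * outputMean E φ X := by
  rw [outputMean_apply, outputMean_apply, real_smul_eq, map_smul, Submodule.coe_smul,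
    mul_smul_comm, trace_smul, Complex.re_ofReal_mul]

/-- The output of the channel has a square-integrable symmetric logarithmic derivative if the input
has one. -/
theorem IsCompletelyPositive.exists_output_riesz (hE : IsCompletelyPositive E) {ρ : FaithfulState H}
    (hσ : hsNormSq (CFC.sqrt (E ρ.op : H →L[ℂ] H)) ≠ ⊤) {φ : traceClass H} {Y : H →L[ℂ] H}
    (hY : IsSLD (ρ.op : H →L[ℂ] H) φ Y) (hYn : hsNormSq Y ≠ ⊤) :
    ∃ Z ∈ (LinearMap.range (sqrtFamily hσ)).topologicalClosure,
      ∀ X, ⟪Z, sqrtFamily hσ X⟫_ℝ = outputMean E φ X := by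
  -- C = Tr ℰ(YY*), and the 2-positive Cauchy-Schwarz inequality with R = √ρ reads |Tr[X ℰ(φ)]|² ≤ C
  -- ‖X√σ‖² for the real part of the trace.
  set C := (trace (E (hsMul hYn hYn) : H →L[ℂ] H)).re
  have hC : 0 ≤ C := (Complex.nonneg_iff.1 (trace_nonneg (hE.map_nonneg (hsMul_self_nonneg hYn)))).1
  obtain ⟨Z, hZU, -, hZ⟩ := exists_riesz_of_le_norm (sqrtFamily hσ) (outputMean E φ)
    (Real.sqrt_nonneg C) (fun X => by
      have h := hE.sq_re_trace_le hYn ρ.hsNormSq_sqrt X.2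
      rw [hY.two_smul_eq, ρ.hsMul_sqrt, map_smul, Submodule.coe_smul, mul_smul_comm, trace_smul,
        ← norm_sqrtFamily_sq (hE.map_nonneg ρ.nonneg') hσ] at h
      have h1 : ((2 : ℂ) * trace ((X : H →L[ℂ] H) * (E φ : H →L[ℂ] H))).re =
          2 * outputMean E φ X := by
        rw [outputMean_apply]
        simp
      rw [h1] at h
      refine abs_le_of_sq_le_sq ?_ (by positivity)
      rw [mul_pow, Real.sq_sqrt hC]
      linarith)
  exact ⟨Z, hZU, hZ⟩

/-- The directions `φ` together with a representative of `X ↦ Tr[X ℰ(φ)]`. -/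
noncomputable def outputRelation (E : traceClass H →ₗ[ℂ] traceClass H) (ρ : FaithfulState H)
    (A : H →ₗ.[ℂ] H) (hσ : hsNormSq (CFC.sqrt (E ρ.op : H →L[ℂ] H)) ≠ ⊤) :
    Submodule ℝ (traceClass H × HSFamily H) where
  carrier := {p | p.1 ∈ directions ρ A ∧
    p.2 ∈ (LinearMap.range (sqrtFamily hσ)).topologicalClosure ∧
    ∀ X, ⟪p.2, sqrtFamily hσ X⟫_ℝ = outputMean E p.1 X}
  add_mem' := by
    rintro p q ⟨h1, h2, h3⟩ ⟨h1', h2', h3'⟩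
    refine ⟨directions_add h1 h1', Submodule.add_mem _ h2 h2', fun X => ?_⟩
    rw [Prod.snd_add, Prod.fst_add, inner_add_left, outputMean_add, h3, h3']
  zero_mem' := by
    refine ⟨directions_zero ρ A, Submodule.zero_mem _, fun X => ?_⟩
    have := outputMean_smul (E := E) 0 0 X
    rw [zero_smul, zero_mul] at this
    rw [Prod.snd_zero, Prod.fst_zero, inner_zero_left, this]
  smul_mem' := by
    rintro a p ⟨h1, h2, h3⟩
    refine ⟨directions_smul h1 a, Submodule.smul_mem _ a h2, fun X => ?_⟩
    rw [Prod.smul_snd, Prod.smul_fst, real_inner_smul_left, outputMean_smul, h3]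

/-- A representative `Z` of the output mean is an SLD of the output, so J(φ) ≤ ‖Z‖² and b(φ)² ≤ c₀
J(φ) ≤ c₀ ‖Z‖². This boundedness is what Riesz needs. -/
theorem abs_expDeriv_le (hE : IsCompletelyPositive E) {ρ : FaithfulState H} {A : H →ₗ.[ℂ] H}
    (hσ : hsNormSq (CFC.sqrt (E ρ.op : H →L[ℂ] H)) ≠ ⊤)
    (hker : ∀ φ ∈ directions ρ A, sldInfo (E ρ.op : H →L[ℂ] H) (E φ) = 0 → expDeriv A φ = 0)
    (hfin : inverseForm (directions ρ A) (fun φ => sldInfo (E ρ.op : H →L[ℂ] H) (E φ))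
      (expDeriv A) ≠ ⊤) {p : traceClass H × HSFamily H} (hp : p ∈ outputRelation E ρ A hσ) :
    |expDeriv A p.1| ≤ √(inverseForm (directions ρ A)
      (fun φ => sldInfo (E ρ.op : H →L[ℂ] H) (E φ)) (expDeriv A)).toReal * ‖p.2‖ := by
  obtain ⟨φ, Z⟩ := p
  obtain ⟨hφ, hZU, hZX⟩ := hp
  simp only at hφ hZU hZX ⊢
  set σ := (E ρ.op : H →L[ℂ] H) with hσdef
  set c₀ := inverseForm (directions ρ A) (fun φ => sldInfo σ (E φ)) (expDeriv A) with hc₀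
  obtain ⟨Y, hY, hYn⟩ := sldInfo_lt_top_iff.1 hφ.2.2.1
  have h1 : sldInfo σ (E φ) ≤ ENNReal.ofReal (‖Z‖ ^ 2) :=
    sldInfo_le_of_riesz hσ (hE.isSelfAdjoint_map hY hYn) hZU hZX
  have h2 : ENNReal.ofReal (expDeriv A φ ^ 2) / sldInfo σ (E φ) ≤ c₀ :=
    le_iSup₂ (f := fun φ (_ : φ ∈ directions ρ A) => ENNReal.ofReal (expDeriv A φ ^ 2) /
      sldInfo σ (E φ)) φ hφ
  have h3 : ENNReal.ofReal (expDeriv A φ ^ 2) ≤ c₀ * ENNReal.ofReal (‖Z‖ ^ 2) := by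
    -- The denominator cannot be cleared when it is 0; there the kernel condition gives b(φ) = 0.
    by_cases h0 : sldInfo σ (E φ) = 0
    · rw [hker φ hφ h0]
      simp
    · rw [ENNReal.div_le_iff_le_mul (Or.inl h0)
        (Or.inl (h1.trans_lt ENNReal.ofReal_lt_top).ne)] at h2
      exact h2.trans (by gcongr)
  rw [← ENNReal.ofReal_toReal hfin, ← ENNReal.ofReal_mul ENNReal.toReal_nonneg,
    ENNReal.ofReal_le_ofReal_iff (by positivity)] at h3
  refine abs_le_of_sq_le_sq ?_ (by positivity)
  rwa [mul_pow, Real.sq_sqrt ENNReal.toReal_nonneg]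

/-- Bounded observables of the output of a channel whose means approximate `b` on all directions,
with second moments bounded by `(∇b, J⁺ ∇b)` in the limit. -/
theorem exists_tendsto_of_inverseForm_ne_top (hE : IsCompletelyPositive E) (ρ : FaithfulState H)
    {A : H →ₗ.[ℂ] H} (hA : Dense (A.domain : Set H))
    (hker : ∀ φ ∈ directions ρ A, sldInfo (E ρ.op : H →L[ℂ] H) (E φ) = 0 → expDeriv A φ = 0)
    (hfin : inverseForm (directions ρ A) (fun φ => sldInfo (E ρ.op : H →L[ℂ] H) (E φ))
      (expDeriv A) ≠ ⊤) :
    ∃ (X : ℕ → selfAdjoint (H →L[ℂ] H)) (c : ℝ),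
      (∀ φ ∈ directions ρ A, Filter.Tendsto
        (fun n => (trace ((X n : H →L[ℂ] H) * (E φ : H →L[ℂ] H))).re) Filter.atTop
          (nhds (expDeriv A φ))) ∧
      Filter.Tendsto (fun n => (trace ((X n : H →L[ℂ] H) * (E ρ.op : H →L[ℂ] H) *
        (X n : H →L[ℂ] H))).re) Filter.atTop (nhds c) ∧
      ENNReal.ofReal c ≤ inverseForm (directions ρ A)
        (fun φ => sldInfo (E ρ.op : H →L[ℂ] H) (E φ)) (expDeriv A) := by
  have hσ0 : 0 ≤ (E ρ.op : H →L[ℂ] H) := hE.map_nonneg ρ.nonneg'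
  have hσ : hsNormSq (CFC.sqrt (E ρ.op : H →L[ℂ] H)) ≠ ⊤ := (E ρ.op).2.hsNormSq_sqrt hσ0
  obtain ⟨Z₀, hZ₀, hZ₀n, hZ₀b⟩ := exists_riesz_of_relation (outputRelation E ρ A hσ) (expDeriv A)
    (fun p q hp hq => expDeriv_add hA hp.1 hq.1) (fun a p hp => expDeriv_smul hA hp.1 a)
    (Real.sqrt_nonneg _) (fun p hp => abs_expDeriv_le hE hσ hker hfin hp)
    (Submodule.isClosed_topologicalClosure (LinearMap.range (sqrtFamily hσ))) (fun p hp => hp.2.1)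
  have hZ₀U : Z₀ ∈ closure (Set.range (sqrtFamily hσ)) := hZ₀
  -- The ideal estimator `Z₀` need not be X√σ for a bounded X, but it is a limit of such vectors.
  obtain ⟨W, hW, hWlim⟩ := mem_closure_iff_seq_limit.1 hZ₀U
  choose X hX using hW
  refine ⟨X, ‖Z₀‖ ^ 2, fun φ hφ => ?_, ?_, ?_⟩
  · obtain ⟨Y, hY, hYn⟩ := sldInfo_lt_top_iff.1 hφ.2.2.1
    obtain ⟨Z, hZU, hZX⟩ := hE.exists_output_riesz hσ hY hYn
    have h1 : ⟪Z₀, Z⟫_ℝ = expDeriv A φ := hZ₀b (φ, Z) ⟨hφ, hZU, hZX⟩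
    have h2 : Filter.Tendsto (fun n => ⟪Z, W n⟫_ℝ) Filter.atTop (nhds ⟪Z, Z₀⟫_ℝ) :=
      tendsto_const_nhds.inner hWlim
    rw [real_inner_comm, h1] at h2
    refine h2.congr fun n => ?_
    rw [← hX, hZX, outputMean_apply]
  · refine ((hWlim.norm).pow 2).congr fun n => ?_
    rw [← hX, norm_sqrtFamily_sq hσ0 hσ]
  · rw [← ENNReal.ofReal_toReal hfin]
    refine ENNReal.ofReal_le_ofReal ?_
    have := pow_le_pow_left₀ (norm_nonneg _) hZ₀n 2
    rwa [Real.sq_sqrt ENNReal.toReal_nonneg] at this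

end Channel

/-! ### Measuring a bounded self-adjoint operator with finitely many values -/

section Discretization

/-- Linear interpolation at the integers. -/
theorem sum_hat_mul {u : ℝ} {K : ℤ} (hK : |u| + 1 ≤ K) (f : ℤ → ℝ) :
    ∑ j ∈ Finset.Icc (-K) K, f j * max 0 (1 - |u - j|) =
      f ⌊u⌋ * (1 - Int.fract u) + f (⌊u⌋ + 1) * Int.fract u := by
  have h0 := Int.fract_nonneg u
  have h1 := Int.fract_lt_one u
  have hu := Int.self_sub_floor u
  obtain ⟨hu1, hu2⟩ := abs_le.1 (show |u| ≤ K - 1 by linarith)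
  -- Only the hats at ⌊u⌋ and ⌊u⌋ + 1 are nonzero at `u`; the slack 1 in `hK` keeps the upper node
  -- in range.
  have hsub : ({⌊u⌋, ⌊u⌋ + 1} : Finset ℤ) ⊆ Finset.Icc (-K) K := by
    intro j hj
    have h2 : ⌊u⌋ ≤ K - 1 := by
      have : (⌊u⌋ : ℝ) ≤ ((K - 1 : ℤ) : ℝ) := by push_cast; linarith
      exact_mod_cast this
    have h3 : -K ≤ ⌊u⌋ := by
      have : ((-K : ℤ) : ℝ) ≤ (⌊u⌋ : ℝ) := by push_cast; linarith
      exact_mod_cast this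
    simp only [Finset.mem_insert, Finset.mem_singleton] at hj
    rw [Finset.mem_Icc]
    omega
  rw [← Finset.sum_subset hsub, Finset.sum_pair (by omega)]
  · congr 2
    · rw [hu, abs_of_nonneg h0, max_eq_right (by linarith)]
    · rw [Int.cast_add, Int.cast_one, abs_of_nonpos (by linarith), max_eq_right (by linarith)]
      linarith
  · intro j _ hj
    rw [max_eq_left, mul_zero]
    simp only [Finset.mem_insert, Finset.mem_singleton, not_or] at hj
    rcases lt_or_gt_of_ne hj.1 with h | h
    · have : (j : ℝ) ≤ ((⌊u⌋ - 1 : ℤ) : ℝ) := by exact_mod_cast (by omega : j ≤ ⌊u⌋ - 1)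
      push_cast at this
      rw [abs_of_nonneg (by linarith)]
      linarith
    · have : ((⌊u⌋ + 2 : ℤ) : ℝ) ≤ (j : ℝ) := by exact_mod_cast (by omega : ⌊u⌋ + 2 ≤ j)
      push_cast at this
      rw [abs_of_nonpos (by linarith)]
      linarith

/-- A measurement of a real quantity with finitely many possible values. -/
structure FiniteObservable (H : Type*) [NormedAddCommGroup H] [InnerProductSpace ℂ H]
    [CompleteSpace H] where
  values : Finset ℝ
  effect : ℝ → H →L[ℂ] H
  nonneg : ∀ y, 0 ≤ effect y
  sum_effect : ∑ y ∈ values, effect y = 1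

variable {H : Type*} [NormedAddCommGroup H] [InnerProductSpace ℂ H] [CompleteSpace H]

/-- A bounded self-adjoint operator is the mean of a finite observable whose second moment exceeds
that of the operator by an arbitrarily small constant. -/
theorem exists_finiteObservable {X : H →L[ℂ] H} (hX : IsSelfAdjoint X) {δ : ℝ} (hδ : 0 < δ) :
    ∃ G : FiniteObservable H, ∑ y ∈ G.values, (y : ℂ) • G.effect y = X ∧
      ∑ y ∈ G.values, ((y ^ 2 : ℝ) : ℂ) • G.effect y ≤ X * X + ((δ ^ 2 : ℝ) : ℂ) • 1 := by
  obtain ⟨K, hK⟩ := exists_int_ge (‖X‖ / δ + 1)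
  have hinj : Set.InjOn (fun j : ℤ => (j : ℝ) * δ) (Finset.Icc (-K) K) := fun i _ j _ h => by
    simpa [hδ.ne'] using h
  -- Tent functions on the grid δℤ form a continuous partition of unity on the spectrum that
  -- reproduces the identity function, so the continuous functional calculus suffices and the mean
  -- is exactly `X`.
  set hat : ℝ → ℝ → ℝ := fun y x => max 0 (1 - |x / δ - y / δ|) with hhat
  have hcont : ∀ y, Continuous (hat y) := fun y => by fun_prop
  have hint : ∀ f : ℝ → ℝ, ∀ x ∈ spectrum ℝ X,
      ∑ y ∈ (Finset.Icc (-K) K).image (fun j : ℤ => (j : ℝ) * δ), f y * hat y x =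
      f (⌊x / δ⌋ * δ) * (1 - Int.fract (x / δ)) + f ((⌊x / δ⌋ + 1) * δ) * Int.fract (x / δ) := by
    intro f x hx
    rw [Finset.sum_image hinj]
    have hx1 : |x| ≤ ‖X‖ := by
      rcases subsingleton_or_nontrivial H with h | h
      · simp at hx
      · exact spectrum.norm_le_norm_of_mem hx
    have h := sum_hat_mul (u := x / δ) (K := K) (hK.trans' (by
      rw [abs_div, abs_of_pos hδ]
      gcongr)) (fun j => f (j * δ))
    push_cast at h
    rw [← h]
    refine Finset.sum_congr rfl fun j _ => ?_
    simp only [hhat]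
    rw [mul_div_cancel_right₀ _ hδ.ne']
  have hcfc : ∀ f : ℝ → ℝ, ∑ y ∈ (Finset.Icc (-K) K).image (fun j : ℤ => (j : ℝ) * δ),
      ((f y : ℝ) : ℂ) • cfc (hat y) X = cfc (fun x =>
        ∑ y ∈ (Finset.Icc (-K) K).image (fun j : ℤ => (j : ℝ) * δ), f y * hat y x) X := by
    intro f
    have h : ∀ y, ((f y : ℝ) : ℂ) • cfc (hat y) X = cfc (fun x => f y * hat y x) X := fun y => by
      rw [cfc_const_mul (f y) (hat y) X (hcont y).continuousOn, Complex.coe_smul]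
    simp_rw [h]
    rw [← cfc_sum (fun y x => f y * hat y x) X _
      fun y _ => (continuous_const.mul (hcont y)).continuousOn]
    congr 1
    ext x
    simp
  refine ⟨⟨(Finset.Icc (-K) K).image (fun j : ℤ => (j : ℝ) * δ), fun y => cfc (hat y) X,
    fun y => cfc_nonneg fun x _ => le_max_left _ _, ?_⟩, ?_, ?_⟩
  · have h := hcfc fun _ => 1
    simp only [Complex.ofReal_one, one_smul] at h
    rw [h, cfc_congr (hint fun _ => 1), ← cfc_one ℝ X]
    refine cfc_congr fun x _ => ?_
    simp
  · refine (hcfc fun y => y).trans ?_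
    rw [cfc_congr (hint fun y => y)]
    conv_rhs => rw [← cfc_id ℝ X]
    refine cfc_congr fun x _ => ?_
    have := Int.floor_add_fract (x / δ)
    simp only [id]
    have h2 : ⌊x / δ⌋ * δ * (1 - Int.fract (x / δ)) + (⌊x / δ⌋ + 1) * δ * Int.fract (x / δ) =
      δ * (⌊x / δ⌋ + Int.fract (x / δ)) := by ring
    rw [h2, this, mul_div_cancel₀ _ hδ.ne']
  · refine ((hcfc fun y => y ^ 2).trans ?_).trans_le ((cfc_mono (a := X) (f := fun x =>
      ∑ y ∈ (Finset.Icc (-K) K).image (fun j : ℤ => (j : ℝ) * δ), y ^ 2 * hat y x)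
      (g := fun x => x ^ 2 + δ ^ 2) fun x hx => ?_).trans_eq ?_)
    · rfl
    -- With t the fractional part of x/δ, interpolation raises x² by δ² t(1 - t) ≤ δ².
    · rw [hint (fun y => y ^ 2) x hx]
      have h1 := Int.floor_add_fract (x / δ)
      have h3 : x = δ * (⌊x / δ⌋ + Int.fract (x / δ)) := by rw [h1, mul_div_cancel₀ _ hδ.ne']
      have h4 := Int.fract_nonneg (x / δ)
      have h5 := Int.fract_lt_one (x / δ)
      generalize (⌊x / δ⌋ : ℝ) = a at *
      generalize Int.fract (x / δ) = t at *
      rw [h3]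
      nlinarith [mul_nonneg (sq_nonneg δ) (sub_nonneg.2 h5.le), mul_nonneg (sq_nonneg δ) (sq_nonneg t)]
    · rw [cfc_add_const (δ ^ 2) (fun x => x ^ 2) X, cfc_pow_id X 2, sq X,
        Algebra.algebraMap_eq_smul_one, Complex.coe_smul]

end Discretization

/-! ### Joint law of the instrument and a subsequent observable -/

section JointMeasure

open MeasureTheory

variable {H : Type*} [NormedAddCommGroup H] [InnerProductSpace ℂ H] [CompleteSpace H]

theorem sum_re_trace_mul {ι : Type*} (s : Finset ι) (a : ι → H →L[ℂ] H) {T : H →L[ℂ] H}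
    (hT : IsTraceClass T) :
    ∑ i ∈ s, (trace (a i * T)).re = (trace ((∑ i ∈ s, a i) * T)).re := by
  rw [Finset.sum_mul, trace_sum s fun i _ => hT.mul_left (a i), Complex.re_sum]

theorem sum_mul_re_trace_mul {ι : Type*} (s : Finset ι) (f : ι → ℝ) (a : ι → H →L[ℂ] H)
    {T : H →L[ℂ] H} (hT : IsTraceClass T) :
    ∑ i ∈ s, f i * (trace (a i * T)).re = (trace ((∑ i ∈ s, (f i : ℂ) • a i) * T)).re := by
  rw [← sum_re_trace_mul s _ hT]
  refine Finset.sum_congr rfl fun i _ => ?_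
  rw [smul_mul_assoc, trace_smul, Complex.re_ofReal_mul]

theorem re_trace_mul_mono {a b T : H →L[ℂ] H} (hT : IsTraceClass T) (h : 0 ≤ T) (hab : a ≤ b) :
    (trace (a * T)).re ≤ (trace (b * T)).re := by
  have := (Complex.nonneg_iff.1 (trace_mul_nonneg hT h (sub_nonneg.2 hab))).1
  rw [mul_sub, trace_sub (hT.mul_right b) (hT.mul_right a), trace_mul_comm hT, trace_mul_comm hT,
    Complex.sub_re] at this
  linarith

namespace CPInstrument

variable {Ω : Type*} [MeasurableSpace Ω] (I : CPInstrument Ω H)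

theorem re_trace_mul_nonneg {s : Set Ω} (hs : MeasurableSet s) {a : H →L[ℂ] H} (ha : 0 ≤ a)
    {T : traceClass H} (hT : 0 ≤ (T : H →L[ℂ] H)) :
    0 ≤ (trace (a * (I.toFun s T : H →L[ℂ] H))).re := by
  rw [← trace_mul_comm (I.toFun s T).2]
  exact (Complex.nonneg_iff.1 (trace_mul_nonneg (I.toFun s T).2
    ((I.completelyPositive' s hs).map_nonneg hT) ha)).1

theorem trace_mul_empty (a : H →L[ℂ] H) (T : traceClass H) :
    trace (a * (I.toFun ∅ T : H →L[ℂ] H)) = 0 := by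
  have h := (I.iUnion' (fun _ => ∅) (fun _ => .empty) (fun _ _ _ => disjoint_bot_left) T a).summable
  exact (summable_const_iff (β := ℕ) _).1 (by simpa using h)

/-- The measure `s ↦ Tr[a ℐ(s)(T)]`. -/
noncomputable def outcomeMeasure {a : H →L[ℂ] H} (ha : 0 ≤ a) {T : traceClass H}
    (hT : 0 ≤ (T : H →L[ℂ] H)) : Measure Ω :=
  Measure.ofMeasurable (fun s _ => ENNReal.ofReal (trace (a * (I.toFun s T : H →L[ℂ] H))).re)
    (by rw [trace_mul_empty, Complex.zero_re, ENNReal.ofReal_zero])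
    (fun f hf hd => by
      have h := (I.iUnion' f hf hd T a).mapL Complex.reCLM
      simp only [Complex.reCLM_apply] at h
      rw [← h.tsum_eq, ENNReal.ofReal_tsum_of_nonneg
        (fun i => I.re_trace_mul_nonneg (hf i) ha hT) h.summable])

variable {a : H →L[ℂ] H} (ha : 0 ≤ a) {T : traceClass H} (hT : 0 ≤ (T : H →L[ℂ] H))

theorem outcomeMeasure_apply {s : Set Ω} (hs : MeasurableSet s) :
    I.outcomeMeasure ha hT s = ENNReal.ofReal (trace (a * (I.toFun s T : H →L[ℂ] H))).re :=
  Measure.ofMeasurable_apply s hs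

instance : IsFiniteMeasure (I.outcomeMeasure ha hT) :=
  ⟨by simp [I.outcomeMeasure_apply ha hT .univ]⟩

theorem outcomeMeasure_real {s : Set Ω} (hs : MeasurableSet s) :
    (I.outcomeMeasure ha hT).real s = (trace (a * (I.toFun s T : H →L[ℂ] H))).re := by
  rw [measureReal_def, I.outcomeMeasure_apply ha hT hs,
    ENNReal.toReal_ofReal (I.re_trace_mul_nonneg hs ha hT)]

open Classical in
/-- The joint law of the outcome of the instrument and of a subsequent measurement of the observable
`G`, for the unnormalized initial state `T`. -/
noncomputable def jointMeasure (G : FiniteObservable H) (T : traceClass H) : Measure (Ω × ℝ) :=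
  if hT : 0 ≤ (T : H →L[ℂ] H) then
    ∑ y ∈ G.values, (I.outcomeMeasure (G.nonneg y) hT).map (fun ω => (ω, y))
  else 0

instance (G : FiniteObservable H) (T : traceClass H) : IsFiniteMeasure (I.jointMeasure G T) := by
  unfold jointMeasure
  split_ifs <;> infer_instance

/-- `jointMeasure` as a finite measure. -/
noncomputable def jointLaw (G : FiniteObservable H) (T : traceClass H) : FiniteMeasure (Ω × ℝ) :=
  ⟨I.jointMeasure G T, inferInstance⟩

variable (G : FiniteObservable H) {T : traceClass H}

theorem jointLaw_toMeasure (hT : 0 ≤ (T : H →L[ℂ] H)) : (I.jointLaw G T : Measure (Ω × ℝ)) =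
    ∑ y ∈ G.values, (I.outcomeMeasure (G.nonneg y) hT).map (fun ω => (ω, y)) := by
  change I.jointMeasure G T = _
  rw [jointMeasure, dif_pos hT]

theorem jointLaw_real (hT : 0 ≤ (T : H →L[ℂ] H)) {S : Set (Ω × ℝ)} (hS : MeasurableSet S) :
    (I.jointLaw G T : Measure (Ω × ℝ)).real S = ∑ y ∈ G.values,
      (trace (G.effect y * (I.toFun ((fun ω => (ω, y)) ⁻¹' S) T : H →L[ℂ] H))).re := by
  rw [I.jointLaw_toMeasure G hT, measureReal_def, Measure.finsetSum_apply,
    ENNReal.toReal_sum fun y _ => measure_ne_top _ _]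
  refine Finset.sum_congr rfl fun y _ => ?_
  have hm : Measurable fun ω : Ω => (ω, y) := by fun_prop
  rw [Measure.map_apply hm hS, ← measureReal_def, I.outcomeMeasure_real _ hT (hm hS)]

theorem finiteMeasure_ext_real {Ω : Type*} [MeasurableSpace Ω]
    {μ ν : FiniteMeasure Ω} (h : ∀ S, MeasurableSet S →
      (μ : Measure Ω).real S = (ν : Measure Ω).real S) : μ = ν :=
  FiniteMeasure.eq_of_forall_toMeasure_apply_eq _ _ fun S hS =>
    (measureReal_eq_measureReal_iff).1 (h S hS)

theorem jointLaw_add {T T' : traceClass H} (hT : 0 ≤ (T : H →L[ℂ] H)) (hT' : 0 ≤ (T' : H →L[ℂ] H)) :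
    I.jointLaw G (T + T') = I.jointLaw G T + I.jointLaw G T' := by
  refine finiteMeasure_ext_real fun S hS => ?_
  rw [FiniteMeasure.toMeasure_add, measureReal_add_apply, I.jointLaw_real G hT hS,
    I.jointLaw_real G hT' hS, I.jointLaw_real G (T := T + T') (add_nonneg hT hT') hS,
    ← Finset.sum_add_distrib]
  refine Finset.sum_congr rfl fun y _ => ?_
  rw [map_add, Submodule.coe_add, mul_add, trace_add ((I.toFun _ T).2.mul_left _)
    ((I.toFun _ T').2.mul_left _), Complex.add_re]

theorem jointLaw_smul (c : NNReal) {T : traceClass H} (hT : 0 ≤ (T : H →L[ℂ] H)) :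
    I.jointLaw G (((c : ℝ) : ℂ) • T) = c • I.jointLaw G T := by
  refine finiteMeasure_ext_real fun S hS => ?_
  have h : (c • I.jointLaw G T : FiniteMeasure (Ω × ℝ)).toMeasure.real S =
      c * (I.jointLaw G T).toMeasure.real S := by
    simp
  rw [h, I.jointLaw_real G hT hS,
    I.jointLaw_real G (T := ((c : ℝ) : ℂ) • T) (smul_ofReal_nonneg c.2 hT) hS, Finset.mul_sum]
  refine Finset.sum_congr rfl fun y _ => ?_
  rw [map_smul, Submodule.coe_smul, mul_smul_comm, trace_smul, Complex.re_ofReal_mul]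

/-- The later effects sum to 1, so the first marginal does not depend on `G`. It therefore survives
every limit of the joint laws. -/
theorem jointLaw_real_fst (hT : 0 ≤ (T : H →L[ℂ] H)) {S : Set Ω} (hS : MeasurableSet S) :
    (I.jointLaw G T : Measure (Ω × ℝ)).real (Prod.fst ⁻¹' S) =
      (trace (I.toFun S T : H →L[ℂ] H)).re := by
  rw [I.jointLaw_real G hT (measurable_fst hS)]
  change ∑ y ∈ G.values, (trace (G.effect y * (I.toFun S T : H →L[ℂ] H))).re = _
  rw [sum_re_trace_mul _ _ (I.toFun S T).2, G.sum_effect, one_mul]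

theorem jointLaw_mass (hT : 0 ≤ (T : H →L[ℂ] H)) :
    ((I.jointLaw G T).mass : ℝ) = (trace (T : H →L[ℂ] H)).re := by
  rw [← I.trace_univ', ← I.jointLaw_real_fst G hT .univ]
  simp [FiniteMeasure.mass]

/-- The bound may depend on `y`, since the second outcome takes finitely many values; this covers
the unbounded function y². -/
theorem integrable_jointLaw (hT : 0 ≤ (T : H →L[ℂ] H)) {f : Ω × ℝ → ℝ} (hf : Measurable f)
    (hb : ∀ y, ∃ C, ∀ ω, |f (ω, y)| ≤ C) : Integrable f (I.jointLaw G T : Measure (Ω × ℝ)) := by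
  rw [I.jointLaw_toMeasure G hT, integrable_finsetSum_measure]
  intro y _
  have hm : Measurable fun ω : Ω => (ω, y) := by fun_prop
  rw [integrable_map_measure hf.aestronglyMeasurable hm.aemeasurable]
  obtain ⟨C, hC⟩ := hb y
  exact Integrable.of_bound (hf.comp hm).aestronglyMeasurable C (ae_of_all _ hC)

theorem integral_jointLaw (hT : 0 ≤ (T : H →L[ℂ] H)) {f : ℝ → ℝ} (hf : Measurable f) :
    ∫ p, f p.2 ∂(I.jointLaw G T : Measure (Ω × ℝ)) = ∑ y ∈ G.values,
      f y * (trace (G.effect y * (I.toFun Set.univ T : H →L[ℂ] H))).re := by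
  have hf2 : Measurable fun p : Ω × ℝ => f p.2 := hf.comp measurable_snd
  rw [I.jointLaw_toMeasure G hT, integral_finsetSum_measure]
  · refine Finset.sum_congr rfl fun y _ => ?_
    have hm : Measurable fun ω : Ω => (ω, y) := by fun_prop
    rw [integral_map hm.aemeasurable hf2.aestronglyMeasurable]
    simp only [integral_const, smul_eq_mul]
    rw [I.outcomeMeasure_real _ hT .univ, mul_comm]
  · intro y _
    have hm : Measurable fun ω : Ω => (ω, y) := by fun_prop
    rw [integrable_map_measure hf2.aestronglyMeasurable hm.aemeasurable]
    exact integrable_const (f y)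

theorem isEffect_jointLaw {S : Set (Ω × ℝ)} :
    IsEffect fun T => (I.jointLaw G T : Measure (Ω × ℝ)).real S where
  add T T' hT hT' := by
    rw [I.jointLaw_add G hT hT', FiniteMeasure.toMeasure_add, measureReal_add_apply]
  smul c T hc hT := by
    have := I.jointLaw_smul G (NNReal.mk c hc) hT
    rw [NNReal.coe_mk] at this
    rw [this, FiniteMeasure.toMeasure_smul, measureReal_nnreal_smul_apply, NNReal.coe_mk]
  nonneg T _ := measureReal_nonneg
  le_trace T hT := by
    rw [← I.jointLaw_mass G hT]
    simp

end CPInstrument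

end JointMeasure

/-! ### Tightness and the limit POVM -/

section LimitPOVM

open MeasureTheory Filter Topology

/-- Prokhorov's theorem: convergence along `⊤ ×ˢ atTop` says that the tails vanish uniformly in n. A
fixed ultrafilter selects limits for all trace-class operators simultaneously, with no diagonal
argument. -/
theorem exists_tendsto_of_tight {μ : ℕ → FiniteMeasure (ℝ × ℝ)} {C : NNReal}
    (hC : ∀ n, (μ n).mass ≤ C)
    (ht : Tendsto (fun q : ℕ × ℕ => (μ q.1 : Measure (ℝ × ℝ)).real (Metric.closedBall 0 (q.2 : ℝ))ᶜ)
      (⊤ ×ˢ atTop) (𝓝 0)) (U : Ultrafilter ℕ) : ∃ ν, Tendsto μ U (𝓝 ν) := by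
  set K : ℕ → Set (ℝ × ℝ) := fun k => Metric.closedBall 0 (k : ℝ) with hK
  set u : ℕ → NNReal := fun k => ⨆ n, μ n (K k)ᶜ with hu
  have hb : ∀ k, BddAbove (Set.range fun n => μ n (K k)ᶜ) := fun k =>
    ⟨C, by rintro _ ⟨n, rfl⟩; exact (FiniteMeasure.apply_le_mass _ _).trans (hC n)⟩
  have hu0 : Tendsto u atTop (𝓝 0) := by
    refine tendsto_order.2 ⟨fun a ha => absurd ha not_lt_zero, fun ε hε => ?_⟩
    have h := ht.eventually_lt_const (u := ((ε / 2 : NNReal) : ℝ)) (NNReal.coe_pos.2 (half_pos hε))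
    obtain ⟨pa, hpa, pb, hpb, hp⟩ := eventually_prod_iff.1 h
    rw [eventually_top] at hpa
    filter_upwards [hpb] with k hk
    refine (ciSup_le fun n => ?_).trans_lt (NNReal.half_lt_self hε.ne')
    have h1 := (hp (hpa n) hk).le
    rw [FiniteMeasure.measureReal_eq_coe_coeFn] at h1
    exact_mod_cast h1
  have hcomp := isCompact_setOfPred_finiteMeasure_mass_le_compl_isCompact_le (E := ℝ × ℝ) C hu0
    (K := K) (fun k => isCompact_closedBall _ _) (Or.inl inferInstance)
  obtain ⟨ν, -, hν⟩ := isCompact_iff_ultrafilter_le_nhds.1 hcomp (U.map μ) (by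
    rw [le_principal_iff, Ultrafilter.coe_map, mem_map]
    exact Filter.univ_mem' fun n => ⟨hC n, fun k => le_ciSup (hb k) n⟩)
  exact ⟨ν, hν⟩

variable {H : Type*} [NormedAddCommGroup H] [InnerProductSpace ℂ H] [CompleteSpace H]

theorem eq_of_re_inner_eq {N N' : H →L[ℂ] H} (hN : IsSelfAdjoint N) (hN' : IsSelfAdjoint N')
    (h : ∀ x, (⟪x, N x⟫_ℂ).re = (⟪x, N' x⟫_ℂ).re) : N = N' := by
  refine le_antisymm (sub_nonneg.1 (nonneg_iff_re_inner.2 ⟨hN'.sub hN, fun x => ?_⟩))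
    (sub_nonneg.1 (nonneg_iff_re_inner.2 ⟨hN.sub hN', fun x => ?_⟩)) <;>
  simp [h]

namespace CPInstrument

variable (I : CPInstrument ℝ H)

theorem jointLaw_map_fst (G : FiniteObservable H) {T : traceClass H} (hT : 0 ≤ (T : H →L[ℂ] H)) :
    (I.jointLaw G T).map Prod.fst =
      ⟨I.outcomeMeasure (zero_le_one (α := H →L[ℂ] H)) hT, inferInstance⟩ := by
  refine finiteMeasure_ext_real fun S hS => ?_
  rw [FiniteMeasure.toMeasure_map, map_measureReal_apply measurable_fst hS,
    I.jointLaw_real_fst G hT hS, FiniteMeasure.toMeasure_mk, I.outcomeMeasure_real _ hT hS, one_mul]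

/-- A bound on the second moments for one faithful state makes the joint laws tight for all
states. -/
theorem tendsto_jointLaw_compl_closedBall (ρ : FaithfulState H) {G : ℕ → FiniteObservable H}
    {C : ℝ} (hC : ∀ n, ∫ p, p.2 ^ 2 ∂(I.jointLaw (G n) ρ.op : Measure (ℝ × ℝ)) ≤ C)
    {T : traceClass H} (hT : 0 ≤ (T : H →L[ℂ] H)) :
    Tendsto (fun q : ℕ × ℕ => (I.jointLaw (G q.1) T : Measure (ℝ × ℝ)).real
      (Metric.closedBall 0 (q.2 : ℝ))ᶜ) (⊤ ×ˢ atTop) (𝓝 0) := by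
  -- The mass outside a ball is an effect functional indexed by (n, k), so uniform smallness in ρ
  -- passes to `T`.
  refine IsEffect.tendsto_zero ρ
    (p := fun (q : ℕ × ℕ) T => (I.jointLaw (G q.1) T : Measure (ℝ × ℝ)).real
      (Metric.closedBall 0 (q.2 : ℝ))ᶜ) (fun q => I.isEffect_jointLaw (G q.1)) ?_ hT
  set ν := I.outcomeMeasure (zero_le_one (α := H →L[ℂ] H)) ρ.nonneg' with hν
  have h1 : Tendsto (fun k : ℕ => ν.real (Metric.closedBall 0 (k : ℝ))ᶜ) atTop (𝓝 0) := by
    have h := (tendsto_measure_compl_closedBall_of_isTightMeasureSet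
      (isTightMeasureSet_singleton (μ := ν)) 0).comp tendsto_natCast_atTop_atTop
    simp only [Function.comp_def, Set.mem_singleton_iff, iSup_iSup_eq_left] at h
    exact (ENNReal.tendsto_toReal ENNReal.zero_ne_top).comp h
  have h2 : Tendsto (fun k : ℕ => C / (k : ℝ) ^ 2) atTop (𝓝 0) :=
    tendsto_const_nhds.div_atTop ((tendsto_pow_atTop two_ne_zero).comp tendsto_natCast_atTop_atTop)
  have h3 := (h1.add h2).comp (tendsto_snd (f := (⊤ : Filter ℕ)))
  rw [add_zero] at h3
  refine squeeze_zero' (Eventually.of_forall fun q => measureReal_nonneg) ?_ h3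
  have h4 : ∀ᶠ q : ℕ × ℕ in ⊤ ×ˢ atTop, 0 < q.2 := tendsto_snd.eventually (eventually_gt_atTop 0)
  filter_upwards [h4] with q hq
  have hk : (0 : ℝ) < (q.2 : ℝ) := by exact_mod_cast hq
  set μ := (I.jointLaw (G q.1) ρ.op : Measure (ℝ × ℝ)) with hμ
  -- In the maximum norm one coordinate must be large. The law of the first is independent of n, and
  -- the Chebyshev inequality gives C/k² for the second.
  have h5 : (Metric.closedBall (0 : ℝ × ℝ) (q.2 : ℝ))ᶜ ⊆
      Prod.fst ⁻¹' (Metric.closedBall (0 : ℝ) (q.2 : ℝ))ᶜ ∪ {p | (q.2 : ℝ) ^ 2 ≤ p.2 ^ 2} := by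
    intro p hp
    by_contra h
    simp only [Set.mem_union, Set.mem_preimage, Set.mem_compl_iff, Metric.mem_closedBall,
      dist_zero_right, not_or, Set.mem_ofPred_eq, not_le] at h
    refine hp ?_
    rw [Metric.mem_closedBall, dist_zero_right, Prod.norm_def, max_le_iff]
    exact ⟨not_lt.1 h.1, by rw [Real.norm_eq_abs]; exact (abs_lt_of_sq_lt_sq h.2 hk.le).le⟩
  refine (measureReal_mono h5).trans ((measureReal_union_le _ _).trans (add_le_add ?_ ?_))
  · have hm : MeasurableSet (Metric.closedBall (0 : ℝ) (q.2 : ℝ))ᶜ :=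
      Metric.isClosed_closedBall.measurableSet.compl
    rw [hμ, I.jointLaw_real_fst _ ρ.nonneg' hm, hν, I.outcomeMeasure_real _ _ hm, one_mul]
  · rw [le_div_iff₀ (by positivity), mul_comm]
    refine (mul_meas_ge_le_integral_of_nonneg (ae_of_all _ fun p => sq_nonneg _) ?_ _).trans (hC q.1)
    exact I.integrable_jointLaw _ ρ.nonneg' (by fun_prop) fun y => ⟨|y ^ 2|, fun ω => le_rfl⟩

theorem exists_tendsto_jointLaw (ρ : FaithfulState H) {G : ℕ → FiniteObservable H}
    {C : ℝ} (hC : ∀ n, ∫ p, p.2 ^ 2 ∂(I.jointLaw (G n) ρ.op : Measure (ℝ × ℝ)) ≤ C)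
    (U : Ultrafilter ℕ) (T : traceClass H) :
    ∃ ν : FiniteMeasure (ℝ × ℝ), 0 ≤ (T : H →L[ℂ] H) →
      Tendsto (fun n => I.jointLaw (G n) T) U (𝓝 ν) := by
  by_cases hT : 0 ≤ (T : H →L[ℂ] H)
  · have hb : ∀ n, (I.jointLaw (G n) T).mass ≤ (trace (T : H →L[ℂ] H)).re.toNNReal := fun n => by
      rw [← NNReal.coe_le_coe, I.jointLaw_mass (G n) hT]
      exact Real.le_coe_toNNReal _
    obtain ⟨ν, hν⟩ := exists_tendsto_of_tight (μ := fun n => I.jointLaw (G n) T) hb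
      (I.tendsto_jointLaw_compl_closedBall ρ hC hT) U
    exact ⟨ν, fun _ => hν⟩
  · exact ⟨0, fun h => absurd h hT⟩

/-- The joint laws of the instrument and of a sequence of subsequent measurements with bounded
second moments converge along an ultrafilter to a POVM whose first marginal is the one induced by
the instrument. -/
theorem exists_limit_povm (ρ : FaithfulState H) {G : ℕ → FiniteObservable H}
    {C : ℝ} (hC : ∀ n, ∫ p, p.2 ^ 2 ∂(I.jointLaw (G n) ρ.op : Measure (ℝ × ℝ)) ≤ C)
    (U : Ultrafilter ℕ) :
    ∃ (M : POVM (ℝ × ℝ) H) (m : traceClass H → FiniteMeasure (ℝ × ℝ)),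
      (∀ S, MeasurableSet S → I.inducedPOVM.toFun S = M.toFun (Prod.fst ⁻¹' S)) ∧
      (∀ T : traceClass H, 0 ≤ (T : H →L[ℂ] H) → ∀ S, MeasurableSet S →
        (trace ((T : H →L[ℂ] H) * M.toFun S)).re = (m T : Measure (ℝ × ℝ)).real S) ∧
      ∀ T : traceClass H, 0 ≤ (T : H →L[ℂ] H) →
        Tendsto (fun n => I.jointLaw (G n) T) U (𝓝 (m T)) := by
  choose m hm using I.exists_tendsto_jointLaw ρ hC U
  obtain ⟨M, hM⟩ := exists_povm_of_measures (fun T => (m T : Measure (ℝ × ℝ)))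
    (fun T => inferInstance)
    (fun S T hS hT => by
      have h := tendsto_nhds_unique (((hm S hS).add (hm T hT)).congr fun n =>
        (I.jointLaw_add (G n) hS hT).symm) (hm (S + T) (add_nonneg hS hT))
      rw [← h, FiniteMeasure.toMeasure_add])
    (fun c T hc hT => by
      have h := tendsto_nhds_unique (((hm T hT).const_smul (NNReal.mk c hc)).congr fun n =>
        (I.jointLaw_smul (G n) (NNReal.mk c hc) hT).symm)
        (hm ((c : ℂ) • T) (smul_ofReal_nonneg hc hT))
      rw [← h, FiniteMeasure.toMeasure_smul, ENNReal.ofReal_eq_coe_nnreal hc]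
      rfl)
    (fun T hT => by
      have h := tendsto_nhds_unique ((NNReal.continuous_coe.tendsto _).comp (hm T hT).mass)
        (tendsto_const_nhds.congr fun n => (I.jointLaw_mass (G n) hT).symm)
      rw [← h, FiniteMeasure.measureReal_eq_coe_coeFn]
      rfl)
  refine ⟨M, m, fun S hS => ?_, hM, hm⟩
  refine eq_of_re_inner_eq (IsSelfAdjoint.of_nonneg (I.inducedPOVM.nonneg' S hS))
    (IsSelfAdjoint.of_nonneg (M.nonneg' _ (measurable_fst hS))) fun x => ?_
  have hx := ketBra_self_nonneg x
  -- The first marginals are constant along the sequence, so the limit has the same one.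
  have h := tendsto_nhds_unique
    (FiniteMeasure.tendsto_map_of_tendsto_of_continuous _ _ (hm _ hx) continuous_fst)
    (tendsto_const_nhds.congr fun n => (I.jointLaw_map_fst (G n) hx).symm)
  have h1 := hM _ hx _ (measurable_fst hS)
  rw [re_trace_ketBra_mul, ← map_measureReal_apply measurable_fst hS,
    ← FiniteMeasure.toMeasure_map, h, FiniteMeasure.toMeasure_mk, I.outcomeMeasure_real _ hx hS] at h1
  rw [h1, ← I.isDual_dualMap hS x x]
  rfl

end CPInstrument

end LimitPOVM

/-! ### Truncation of the second outcome -/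

section Moments

open MeasureTheory Filter Topology

/-- Truncation of a real number to `[-R, R]`. -/
noncomputable def clamp (R y : ℝ) : ℝ := max (-R) (min y R)

theorem continuous_clamp (R : ℝ) : Continuous (clamp R) := by
  unfold clamp
  fun_prop

theorem abs_clamp_le {R : ℝ} (hR : 0 ≤ R) (y : ℝ) : |clamp R y| ≤ R := by
  unfold clamp
  rw [abs_le]
  exact ⟨le_max_left _ _, max_le (by linarith) (min_le_right _ _)⟩

theorem clamp_sq_le {R : ℝ} (hR : 0 ≤ R) (y : ℝ) : clamp R y ^ 2 ≤ y ^ 2 := by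
  rw [sq_le_sq]
  unfold clamp
  rcases le_total y R with h | h <;> rcases le_total (-R) y with h' | h' <;>
    rcases le_total 0 y with h0 | h0 <;> rw [abs_le] <;> grind [abs_of_nonneg, abs_of_nonpos]

/-- Unlike an indicator of |y| > R, the factor is continuous as well as bounded, so its integral
passes to weak limits; it tends to 0 as R grows. -/
theorem abs_sub_clamp_le {R : ℝ} (hR : 0 < R) (y : ℝ) :
    |y - clamp R y| ≤ min 1 (|y| / R) * |y| := by
  rcases le_or_gt |y| R with h | h
  · have : clamp R y = y := by
      unfold clamp
      rw [min_eq_left (abs_le.1 h).2, max_eq_right (abs_le.1 h).1]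
    rw [this, sub_self, abs_zero]
    positivity
  · rw [min_eq_left ((one_le_div hR).2 h.le), one_mul]
    unfold clamp
    rcases le_total 0 y with h0 | h0
    · rw [abs_of_nonneg h0] at h ⊢
      rw [min_eq_right h.le, max_eq_right (by linarith), abs_of_nonneg (by linarith)]
      linarith
    · rw [abs_of_nonpos h0] at h ⊢
      rw [min_eq_left (by linarith), max_eq_left (by linarith), abs_of_nonpos (by linarith)]
      linarith

theorem tendsto_integral_snd {ι : Type*} {l : Filter ι} {μ : ι → FiniteMeasure (ℝ × ℝ)}
    {ν : FiniteMeasure (ℝ × ℝ)} (h : Tendsto μ l (𝓝 ν)) {f : ℝ → ℝ} (hf : Continuous f) {C : ℝ}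
    (hC : ∀ y, |f y| ≤ C) :
    Tendsto (fun i => ∫ p, f p.2 ∂(μ i : Measure (ℝ × ℝ))) l
      (𝓝 (∫ p, f p.2 ∂(ν : Measure (ℝ × ℝ)))) :=
  FiniteMeasure.tendsto_iff_forall_integral_tendsto.1 h
    (BoundedContinuousFunction.ofNormedAddCommGroup (fun p : ℝ × ℝ => f p.2)
      (hf.comp continuous_snd) C fun p => hC p.2)

theorem tendsto_integral_tail (ν : Measure (ℝ × ℝ)) [IsFiniteMeasure ν] :
    Tendsto (fun n : ℕ => ∫ p, min 1 (|p.2| / (n + 1 : ℝ)) ∂ν) atTop (𝓝 0) := by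
  have h := tendsto_integral_of_dominated_convergence (μ := ν) (F := fun (n : ℕ) (p : ℝ × ℝ) =>
    min 1 (|p.2| / (n + 1 : ℝ))) (f := fun _ => 0) (fun _ => 1)
    (fun n => by fun_prop) (integrable_const 1)
    (fun n => ae_of_all _ fun p => by
      rw [Real.norm_of_nonneg (by positivity)]
      exact min_le_left _ _)
    (ae_of_all _ fun p => by
      have h1 : Tendsto (fun n : ℕ => |p.2| / (n + 1 : ℝ)) atTop (𝓝 0) :=
        tendsto_const_nhds.div_atTop (tendsto_atTop_add_const_right _ _ tendsto_natCast_atTop_atTop)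
      simpa using (tendsto_const_nhds (x := (1 : ℝ))).min h1)
  simpa using h

variable {H : Type*} [NormedAddCommGroup H] [InnerProductSpace ℂ H] [CompleteSpace H]

/-- Joint laws are meaningful only for positive operators, so a direction φ enters as a difference
of two of them. -/
theorem CPInstrument.integral_jointLaw_sub (I : CPInstrument ℝ H) (G : FiniteObservable H) {φ Tp Tm : traceClass H}
    (hp : 0 ≤ (Tp : H →L[ℂ] H)) (hm : 0 ≤ (Tm : H →L[ℂ] H)) (h : Tp = Tm + φ) {f : ℝ → ℝ}
    (hf : Measurable f) :
    ∫ p, f p.2 ∂(I.jointLaw G Tp : Measure (ℝ × ℝ)) - ∫ p, f p.2 ∂(I.jointLaw G Tm : Measure (ℝ × ℝ))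
      = ∑ y ∈ G.values, f y * (trace (G.effect y * (I.toFun Set.univ φ : H →L[ℂ] H))).re := by
  rw [I.integral_jointLaw G hp hf, I.integral_jointLaw G hm hf, ← Finset.sum_sub_distrib]
  refine Finset.sum_congr rfl fun y _ => ?_
  rw [h, map_add, Submodule.coe_add, mul_add, trace_add ((I.toFun _ Tm).2.mul_left _)
    ((I.toFun _ φ).2.mul_left _), Complex.add_re]
  ring

variable [TopologicalSpace.SeparableSpace H]

/-- The witnesses are (Y ± √ρ)(Y ± √ρ)*/4, whose difference is (Y√ρ + √ρY*)/2 = φ. -/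
theorem IsSLD.exists_eq_add {ρ : FaithfulState H} {φ : traceClass H} {Y : H →L[ℂ] H}
    (hY : IsSLD (ρ.op : H →L[ℂ] H) φ Y) (hYn : hsNormSq Y ≠ ⊤) :
    ∃ Tp Tm : traceClass H, 0 ≤ (Tp : H →L[ℂ] H) ∧ 0 ≤ (Tm : H →L[ℂ] H) ∧ Tp = Tm + φ := by
  refine ⟨((1 / 4 : ℝ) : ℂ) • hsMul (hsNormSq_add hYn ρ.hsNormSq_sqrt)
      (hsNormSq_add hYn ρ.hsNormSq_sqrt),
    ((1 / 4 : ℝ) : ℂ) • hsMul (hsNormSq_sub hYn ρ.hsNormSq_sqrt)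
      (hsNormSq_sub hYn ρ.hsNormSq_sqrt), ?_, ?_, ?_⟩
  · exact smul_ofReal_nonneg (by norm_num) (hsMul_self_nonneg _)
  · exact smul_ofReal_nonneg (by norm_num) (hsMul_self_nonneg _)
  · rw [hY.hsMul_eq hYn, smul_add, smul_smul]
    norm_num

theorem IsSLD.hsMul_smul_add {ρ : FaithfulState H} {φ : traceClass H} {Y : H →L[ℂ] H}
    (hY : IsSLD (ρ.op : H →L[ℂ] H) φ Y) (hYn : hsNormSq Y ≠ ⊤) (u : ℝ) :
    hsMul (hsNormSq_add (hsNormSq_smul (u : ℂ) hYn) ρ.hsNormSq_sqrt)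
      (hsNormSq_add (hsNormSq_smul (u : ℂ) hYn) ρ.hsNormSq_sqrt) =
      ((u * u : ℝ) : ℂ) • hsMul hYn hYn + ((2 * u : ℝ) : ℂ) • φ + ρ.op := by
  have h : ((2 * u : ℝ) : ℂ) • φ = (u : ℂ) • (hsMul hYn ρ.hsNormSq_sqrt + hsMul ρ.hsNormSq_sqrt hYn) := by
    rw [hY.two_smul_eq, smul_smul]
    push_cast
    rw [mul_comm]
  rw [h]
  refine Eq.trans (Subtype.ext ?_) (congrArg (_ + ·) ρ.hsMul_sqrt)
  change ((u : ℂ) • Y + CFC.sqrt (ρ.op : H →L[ℂ] H)) *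
    star ((u : ℂ) • Y + CFC.sqrt (ρ.op : H →L[ℂ] H)) = ((u * u : ℝ) : ℂ) • (Y * star Y) +
      (u : ℂ) • (Y * star (CFC.sqrt (ρ.op : H →L[ℂ] H)) + CFC.sqrt (ρ.op : H →L[ℂ] H) * star Y) +
      CFC.sqrt (ρ.op : H →L[ℂ] H) * star (CFC.sqrt (ρ.op : H →L[ℂ] H))
  rw [star_add, star_smul, add_mul, mul_add, mul_add, smul_mul_smul_comm, smul_mul_assoc,
    mul_smul_comm, smul_add]
  simp only [Complex.star_def, Complex.conj_ofReal, Complex.ofReal_mul]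
  abel

/-- The Cauchy-Schwarz inequality for the effect `a` after a positive map. -/
theorem IsCompletelyPositive.sq_re_trace_mul_le {E : traceClass H →ₗ[ℂ] traceClass H}
    (hE : IsCompletelyPositive E) {ρ : FaithfulState H} {φ : traceClass H} {Y : H →L[ℂ] H}
    (hY : IsSLD (ρ.op : H →L[ℂ] H) φ Y) (hYn : hsNormSq Y ≠ ⊤) {a : H →L[ℂ] H} (ha : 0 ≤ a) :
    (trace (a * (E φ : H →L[ℂ] H))).re ^ 2 ≤
      (trace (a * (E (hsMul hYn hYn) : H →L[ℂ] H))).re * (trace (a * (E ρ.op : H →L[ℂ] H))).re := by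
  -- The quadratic is Tr[a ℰ((uY + √ρ)(uY + √ρ)*)], whose cross term is 2uφ by the SLD equation.
  have hq : ∀ u : ℝ, 0 ≤ (trace (a * (E (hsMul hYn hYn) : H →L[ℂ] H))).re * (u * u) +
      2 * (trace (a * (E φ : H →L[ℂ] H))).re * u + (trace (a * (E ρ.op : H →L[ℂ] H))).re := by
    intro u
    have h := (Complex.nonneg_iff.1 (trace_mul_nonneg (E _).2 (hE.map_nonneg (hsMul_self_nonneg
      (hsNormSq_add (hsNormSq_smul (u : ℂ) hYn) ρ.hsNormSq_sqrt))) ha)).1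
    rw [trace_mul_comm (E _).2, hY.hsMul_smul_add hYn, map_add, map_add, map_smul, map_smul,
      Submodule.coe_add, Submodule.coe_add, Submodule.coe_smul, Submodule.coe_smul, mul_add, mul_add,
      mul_smul_comm, mul_smul_comm, trace_add, trace_add, trace_smul, trace_smul, Complex.add_re,
      Complex.add_re, Complex.re_ofReal_mul, Complex.re_ofReal_mul] at h
    · linarith
    · exact (traceClass H).smul_mem _ ((E _).2.mul_left a)
    · exact (traceClass H).smul_mem _ ((E _).2.mul_left a)
    · exact (traceClass H).add_mem ((traceClass H).smul_mem _ ((E _).2.mul_left a))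
        ((traceClass H).smul_mem _ ((E _).2.mul_left a))
    · exact (E _).2.mul_left a
  have h := discrim_le_zero hq
  unfold discrim at h
  linarith

namespace CPInstrument

variable (I : CPInstrument ℝ H)

/-- Truncation changes the mean of the second outcome in the direction `φ` by a small amount. -/
theorem abs_sum_sub_clamp_le (G : FiniteObservable H) {ρ : FaithfulState H} {φ : traceClass H}
    {Y : H →L[ℂ] H} (hY : IsSLD (ρ.op : H →L[ℂ] H) φ Y) (hYn : hsNormSq Y ≠ ⊤) {R t : ℝ}
    (hR : 0 < R) (ht : 0 < t) :
    |∑ y ∈ G.values, y * (trace (G.effect y * (I.toFun Set.univ φ : H →L[ℂ] H))).re -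
      ∑ y ∈ G.values, clamp R y * (trace (G.effect y * (I.toFun Set.univ φ : H →L[ℂ] H))).re| ≤
      (t⁻¹ * ∫ p, min 1 (|p.2| / R) ∂(I.jointLaw G (hsMul hYn hYn) : Measure (ℝ × ℝ)) +
        t * ∫ p, p.2 ^ 2 ∂(I.jointLaw G ρ.op : Measure (ℝ × ℝ))) / 2 := by
  rw [I.integral_jointLaw G (hsMul_self_nonneg hYn) (f := fun y => min 1 (|y| / R)) (by fun_prop),
    I.integral_jointLaw G ρ.nonneg' (f := fun y => y ^ 2) (by fun_prop), ← Finset.sum_sub_distrib,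
    Finset.mul_sum, Finset.mul_sum, ← Finset.sum_add_distrib, Finset.sum_div]
  refine (Finset.abs_sum_le_sum_abs _ _).trans (Finset.sum_le_sum fun y _ => ?_)
  have h1 := (I.completelyPositive' Set.univ .univ).sq_re_trace_mul_le hY hYn (G.nonneg y)
  have ha := I.re_trace_mul_nonneg .univ (G.nonneg y) (hsMul_self_nonneg hYn)
  have hr := I.re_trace_mul_nonneg .univ (G.nonneg y) ρ.nonneg'
  have h2 := abs_sub_clamp_le hR y
  generalize (trace (G.effect y * (I.toFun Set.univ φ : H →L[ℂ] H))).re = x at *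
  generalize (trace (G.effect y * (I.toFun Set.univ (hsMul hYn hYn) : H →L[ℂ] H))).re = a at *
  generalize (trace (G.effect y * (I.toFun Set.univ ρ.op : H →L[ℂ] H))).re = r at *
  have hk0 : 0 ≤ min 1 (|y| / R) := by positivity
  have hk1 : min 1 (|y| / R) ≤ 1 := min_le_left _ _
  generalize min 1 (|y| / R) = k at *
  -- Weighted arithmetic-geometric mean after |x| ≤ √(a r). The weight t is free and will be chosen
  -- small.
  have h3 : |y| * |x| ≤ (t⁻¹ * a + t * (y ^ 2 * r)) / 2 := by
    rw [← abs_mul]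
    refine abs_le_of_sq_le_sq ?_ (by positivity)
    have h4 : t⁻¹ * t = 1 := inv_mul_cancel₀ ht.ne'
    have h5 : (y * x) ^ 2 ≤ (t⁻¹ * a) * (t * (y ^ 2 * r)) := by
      calc (y * x) ^ 2 = y ^ 2 * x ^ 2 := by ring
        _ ≤ y ^ 2 * (a * r) := by gcongr
        _ = (t⁻¹ * t) * (y ^ 2 * (a * r)) := by rw [h4, one_mul]
        _ = _ := by ring
    nlinarith [sq_nonneg (t⁻¹ * a - t * (y ^ 2 * r))]
  calc |y * x - clamp R y * x| = |y - clamp R y| * |x| := by rw [← sub_mul, abs_mul]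
    _ ≤ k * |y| * |x| := by gcongr
    _ = k * (|y| * |x|) := by ring
    _ ≤ k * ((t⁻¹ * a + t * (y ^ 2 * r)) / 2) := by gcongr
    _ = (t⁻¹ * (k * a) + k * (t * (y ^ 2 * r))) / 2 := by ring
    -- The factor `k` is kept only on the YY* term, which a large R makes small; the second-moment
    -- term is made small by t.
    _ ≤ (t⁻¹ * (k * a) + 1 * (t * (y ^ 2 * r))) / 2 := by gcongr
    _ = _ := by ring

end CPInstrument

end Moments

/-! ### The limit POVM attains the bound -/

section MainTheorem

open MeasureTheory Filter Topology

variable {H : Type*} [NormedAddCommGroup H] [InnerProductSpace ℂ H] [CompleteSpace H]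

/-- The square of the mean of a bounded function in the direction `φ` is bounded by the second
moment times the Fisher information. -/
theorem POVM.ofReal_sq_integral_sub_le {Ω : Type*} [MeasurableSpace Ω] (M : POVM Ω H)
    (ρ : FaithfulState H) {m : traceClass H → FiniteMeasure Ω}
    (hM : ∀ T : traceClass H, 0 ≤ (T : H →L[ℂ] H) → ∀ S, MeasurableSet S →
      (trace ((T : H →L[ℂ] H) * M.toFun S)).re = (m T : Measure Ω).real S)
    {φ Tp Tm : traceClass H} (hp : 0 ≤ (Tp : H →L[ℂ] H)) (hm : 0 ≤ (Tm : H →L[ℂ] H))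
    (h : Tp = Tm + φ) {g : Ω → ℝ} (hg : Measurable g) {C : ℝ} (hC : ∀ x, |g x| ≤ C) :
    ENNReal.ofReal ((∫ x, g x ∂(m Tp : Measure Ω) - ∫ x, g x ∂(m Tm : Measure Ω)) ^ 2) ≤
      ENNReal.ofReal (∫ x, g x ^ 2 ∂(m ρ.op : Measure Ω)) * fisherInfo M ρ φ := by
  have hlaw : M.law ρ = (m ρ.op : Measure Ω) := Measure.ext fun S hS => by
    rw [M.law_apply ρ hS, hM _ ρ.nonneg' S hS, ofReal_measureReal]
  have hs : ∀ S, MeasurableSet S →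
      M.signedLaw φ S = (m Tp : Measure Ω).real S - (m Tm : Measure Ω).real S := fun S hS => by
    rw [M.signedLaw_apply φ hS, ← hM _ hp S hS, ← hM _ hm S hS, h, Submodule.coe_add, add_mul,
      trace_add (Tm.2.mul_right _) (φ.2.mul_right _), Complex.add_re]
    ring
  have hi : Integrable (fun x => g x ^ 2) (m ρ.op : Measure Ω) :=
    Integrable.of_bound (by fun_prop) (C ^ 2) (ae_of_all _ fun x => by
      rw [Real.norm_of_nonneg (sq_nonneg _), ← sq_abs]
      exact pow_le_pow_left₀ (abs_nonneg _) (hC x) 2)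
  rw [← integral_mul_rnDeriv (M.signedLaw_absolutelyContinuous ρ φ) hs hg hC,
    ofReal_integral_eq_lintegral_ofReal hi (ae_of_all _ fun x => sq_nonneg _), ← hlaw]
  exact sq_integral_mul_le hg (SignedMeasure.measurable_rnDeriv _ _)

theorem CPInstrument.integral_sq_jointLaw_le (I : CPInstrument ℝ H) (ρ : FaithfulState H)
    {X : H →L[ℂ] H} {δ : ℝ} {G : FiniteObservable H}
    (hG : ∑ y ∈ G.values, ((y ^ 2 : ℝ) : ℂ) • G.effect y ≤ X * X + ((δ ^ 2 : ℝ) : ℂ) • 1) :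
    ∫ p, p.2 ^ 2 ∂(I.jointLaw G ρ.op : Measure (ℝ × ℝ)) ≤
      (trace (X * (I.toFun Set.univ ρ.op : H →L[ℂ] H) * X)).re + δ ^ 2 := by
  have hσ := (I.toFun Set.univ ρ.op).2
  have h := re_trace_mul_mono hσ ((I.completelyPositive' _ .univ).map_nonneg ρ.nonneg') hG
  rw [I.integral_jointLaw G ρ.nonneg' (f := fun y => y ^ 2) (by fun_prop),
    sum_mul_re_trace_mul _ _ _ hσ]
  refine h.trans_eq ?_
  rw [add_mul, trace_add (hσ.mul_left _) (hσ.mul_left _), smul_mul_assoc, trace_smul, one_mul,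
    I.trace_univ', ρ.trace', mul_one, Complex.add_re, Complex.ofReal_re, mul_assoc,
    ← trace_mul_comm (hσ.mul_left X)]

variable [TopologicalSpace.SeparableSpace H]

/-- If the observables `G n` have means converging to `b` in the direction `φ` and second moments
converging to `c`, then `b² ≤ c J` for the limit POVM. -/
theorem CPInstrument.ofReal_sq_le_mul_fisherInfo (I : CPInstrument ℝ H) (ρ : FaithfulState H)
    {G : ℕ → FiniteObservable H} {U : Ultrafilter ℕ} {M : POVM (ℝ × ℝ) H}
    {m : traceClass H → FiniteMeasure (ℝ × ℝ)}
    (hM : ∀ T : traceClass H, 0 ≤ (T : H →L[ℂ] H) → ∀ S, MeasurableSet S →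
      (trace ((T : H →L[ℂ] H) * M.toFun S)).re = (m T : Measure (ℝ × ℝ)).real S)
    (hlim : ∀ T : traceClass H, 0 ≤ (T : H →L[ℂ] H) →
      Tendsto (fun n => I.jointLaw (G n) T) U (𝓝 (m T)))
    {d : ℕ → ℝ} {c : ℝ} (hd : ∀ n, ∫ p, p.2 ^ 2 ∂(I.jointLaw (G n) ρ.op : Measure (ℝ × ℝ)) ≤ d n)
    (hdc : Tendsto d U (𝓝 c)) {φ : traceClass H} {Y : H →L[ℂ] H}
    (hY : IsSLD (ρ.op : H →L[ℂ] H) φ Y) (hYn : hsNormSq Y ≠ ⊤) {b : ℝ}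
    (hb : Tendsto (fun n => ∑ y ∈ (G n).values,
      y * (trace ((G n).effect y * (I.toFun Set.univ φ : H →L[ℂ] H))).re) U (𝓝 b)) :
    ENNReal.ofReal (b ^ 2) ≤ ENNReal.ofReal c * fisherInfo M ρ φ := by
  obtain ⟨Tp, Tm, hp, hm, hT⟩ := hY.exists_eq_add hYn
  -- The truncated mean of the second outcome of the limit POVM in the direction φ.
  set s : ℕ → ℝ := fun k => ∫ p, clamp (k + 1) p.2 ∂(m Tp : Measure (ℝ × ℝ)) -
    ∫ p, clamp (k + 1) p.2 ∂(m Tm : Measure (ℝ × ℝ)) with hs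
  have hk : ∀ k : ℕ, (0 : ℝ) < k + 1 := fun k => by positivity
  -- Truncated second moments converge weakly and are dominated by the full ones, which gives the
  -- bound c in the limit.
  have hsec : ∀ k : ℕ, ∫ p, clamp (k + 1) p.2 ^ 2 ∂(m ρ.op : Measure (ℝ × ℝ)) ≤ c := by
    intro k
    refine le_of_tendsto_of_tendsto (tendsto_integral_snd (hlim _ ρ.nonneg')
      (f := fun y => clamp (k + 1) y ^ 2) ((continuous_clamp _).pow 2) (C := (k + 1 : ℝ) ^ 2)
      fun y => ?_) hdc (Eventually.of_forall fun n => (integral_mono ?_ ?_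
        fun p : ℝ × ℝ => clamp_sq_le (hk k).le p.2).trans (hd n))
    · rw [abs_of_nonneg (sq_nonneg _), ← sq_abs]
      exact pow_le_pow_left₀ (abs_nonneg _) (abs_clamp_le (hk k).le y) 2
    · exact I.integrable_jointLaw _ ρ.nonneg'
        (((continuous_clamp _).measurable.comp measurable_snd).pow_const 2)
        fun y => ⟨|clamp (k + 1) y ^ 2|, fun _ => le_rfl⟩
    · exact I.integrable_jointLaw _ ρ.nonneg' (by fun_prop) fun y => ⟨|y ^ 2|, fun _ => le_rfl⟩
  -- The truncation estimate holds for every n and its bound passes to the limit, which permits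
  -- exchanging the limits in n and k.
  have hclose : ∀ t : ℝ, 0 < t → ∀ k : ℕ, |b - s k| ≤
      (t⁻¹ * ∫ p, min 1 (|p.2| / (k + 1 : ℝ)) ∂(m (hsMul hYn hYn) : Measure (ℝ × ℝ)) + t * c) / 2 := by
    intro t ht k
    have h1 : Tendsto (fun n => ∑ y ∈ (G n).values, clamp (k + 1) y *
        (trace ((G n).effect y * (I.toFun Set.univ φ : H →L[ℂ] H))).re) U (𝓝 (s k)) := by
      refine ((tendsto_integral_snd (hlim _ hp) (continuous_clamp (k + 1))
        (abs_clamp_le (hk k).le)).sub (tendsto_integral_snd (hlim _ hm) (continuous_clamp (k + 1))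
        (abs_clamp_le (hk k).le))).congr fun n => ?_
      exact I.integral_jointLaw_sub (G n) hp hm hT (continuous_clamp _).measurable
    have h2 := tendsto_integral_snd (hlim _ (hsMul_self_nonneg hYn))
      (f := fun y => min 1 (|y| / (k + 1 : ℝ))) (by fun_prop) (C := 1) fun y => by
        rw [abs_of_nonneg (by positivity)]
        exact min_le_left _ _
    refine le_of_tendsto_of_tendsto (hb.sub h1).abs
      (((h2.const_mul t⁻¹).add (hdc.const_mul t)).div_const 2) (Eventually.of_forall fun n => ?_)
    refine (I.abs_sum_sub_clamp_le (G n) hY hYn (hk k) ht).trans ?_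
    have := hd n
    dsimp only
    gcongr
  have hslim : Tendsto s atTop (𝓝 b) := by
    have htail := tendsto_integral_tail (m (hsMul hYn hYn) : Measure (ℝ × ℝ))
    refine Metric.tendsto_nhds.2 fun ε hε => ?_
    -- With t = ε/(|c| + 1) the second-moment term is at most ε/2 for every k, and the tail term
    -- falls below ε/2 for large k.
    have ht : 0 < ε / (|c| + 1) := by positivity
    have htc : ε / (|c| + 1) * c ≤ ε := by
      rw [div_mul_eq_mul_div, div_le_iff₀ (by positivity)]
      have := le_abs_self c
      gcongr
      linarith
    have h0 := htail.const_mul (ε / (|c| + 1))⁻¹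
    rw [mul_zero] at h0
    filter_upwards [h0.eventually_lt_const hε] with k hkε
    rw [dist_comm, Real.dist_eq]
    refine (hclose _ ht k).trans_lt ?_
    linarith
  refine le_of_tendsto' ((ENNReal.continuous_ofReal.tendsto _).comp (hslim.pow 2)) fun k => ?_
  refine (M.ofReal_sq_integral_sub_le ρ hM hp hm hT (g := fun p => clamp (k + 1) p.2)
    ((continuous_clamp _).measurable.comp measurable_snd) fun p => abs_clamp_le (hk k).le p.2).trans ?_
  gcongr
  exact hsec k

/-- The single bound b² ≤ c J' yields both the kernel condition for J' and sup b²/J' ≤ c. -/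
theorem excessError_le_of_forall {V : Type*} {D : Set V} {J J' : V → ℝ≥0∞} {b : V → ℝ} {c : ℝ≥0∞}
    (hker : ∀ φ ∈ D, J φ = 0 → b φ = 0) (hc : c ≤ inverseForm D J b)
    (h : ∀ φ ∈ D, ENNReal.ofReal (b φ ^ 2) ≤ c * J' φ) (v : ℝ) :
    excessError D J' b v ≤ excessError D J b v := by
  have hker' : ∀ φ ∈ D, J' φ = 0 → b φ = 0 := fun φ hφ h0 => by
    have := h φ hφ
    rw [h0, mul_zero, nonpos_iff_eq_zero, ENNReal.ofReal_eq_zero] at this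
    exact pow_eq_zero_iff two_ne_zero |>.1 (le_antisymm this (sq_nonneg _))
  unfold excessError
  rw [if_pos hker, if_pos hker']
  refine EReal.sub_le_sub (EReal.coe_ennreal_le_coe_ennreal_iff.2 ?_) le_rfl
  exact (iSup₂_le fun φ hφ => ENNReal.div_le_of_le_mul (h φ hφ)).trans hc

/-- The marginal condition is all that the inequality for `A` will need, so this POVM can be built
from `B` alone. -/
theorem CPInstrument.exists_povm_error_le (I : CPInstrument ℝ H) (ρ : FaithfulState H)
    {B : H →ₗ.[ℂ] H} (hB : Dense (B.domain : Set H)) :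
    ∃ M : POVM (ℝ × ℝ) H,
      (∀ S, MeasurableSet S → I.inducedPOVM.toFun S = M.toFun (Prod.fst ⁻¹' S)) ∧
      M.error ρ B ≤ I.disturbance ρ B := by
  set E := I.toFun Set.univ with hE
  by_cases hker : ∀ φ ∈ directions ρ B, sldInfo (E ρ.op : H →L[ℂ] H) (E φ) = 0 → expDeriv B φ = 0
  swap
  -- The disturbance is infinite, so any POVM with the right first marginal works; the second
  -- outcome is the constant 0.
  · refine ⟨I.inducedPOVM.map (g := fun ω => (ω, 0)) (by fun_prop), fun S _ => rfl, ?_⟩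
    have : I.disturbance ρ B = ⊤ := if_neg hker
    rw [this]
    exact le_top
  by_cases hfin : inverseForm (directions ρ B) (fun φ => sldInfo (E ρ.op : H →L[ℂ] H) (E φ))
      (expDeriv B) = ⊤
  · refine ⟨I.inducedPOVM.map (g := fun ω => (ω, 0)) (by fun_prop), fun S _ => rfl, ?_⟩
    have : I.disturbance ρ B = ⊤ := by
      unfold CPInstrument.disturbance QEst.disturbance excessError
      rw [if_pos hker, hfin]
      exact EReal.top_sub_coe _
    rw [this]
    exact le_top
  have hCP : IsCompletelyPositive E := I.completelyPositive' _ .univ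
  obtain ⟨X, c, hXb, hXc, hc⟩ := exists_tendsto_of_inverseForm_ne_top hCP ρ hB hker hfin
  have hδ : ∀ n : ℕ, (0 : ℝ) < 1 / (n + 1) := fun n => by positivity
  choose G hG1 hG2 using fun n : ℕ => exists_finiteObservable (X n).2 (hδ n)
  have hd := fun n => I.integral_sq_jointLaw_le ρ (hG2 n)
  have hdlim : Tendsto (fun n : ℕ => (trace ((X n : H →L[ℂ] H) * (E ρ.op : H →L[ℂ] H) *
      (X n : H →L[ℂ] H))).re + (1 / ((n : ℝ) + 1)) ^ 2) atTop (𝓝 c) := by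
    simpa using hXc.add (tendsto_one_div_add_atTop_nhds_zero_nat.pow 2)
  obtain ⟨C, hC⟩ := hdlim.bddAbove_range
  -- The hyperfilter is finer than `atTop`, so the limits of means and second moments persist along
  -- it.
  obtain ⟨M, m, hfst, hM, hlim⟩ := I.exists_limit_povm ρ (G := G)
    (fun n => (hd n).trans (hC ⟨n, rfl⟩)) (hyperfilter ℕ)
  refine ⟨M, hfst, excessError_le_of_forall hker hc (fun φ hφ => ?_) _⟩
  obtain ⟨Y, hY, hYn⟩ := sldInfo_lt_top_iff.1 hφ.2.2.1
  refine I.ofReal_sq_le_mul_fisherInfo ρ hM hlim hd (hdlim.mono_left Nat.hyperfilter_le_atTop) hY hYn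
    (((hXb φ hφ).mono_left Nat.hyperfilter_le_atTop).congr fun n => ?_)
  rw [sum_mul_re_trace_mul _ _ _ (I.toFun _ φ).2, hG1]

end MainTheorem

end QEst

theorem mainTheorem3 {H : Type*} [NormedAddCommGroup H] [InnerProductSpace ℂ H] [CompleteSpace H]
    [TopologicalSpace.SeparableSpace H] (ρ : QEst.FaithfulState H) (A B : H →ₗ.[ℂ] H)
    (hA : QEst.IsObservable ρ A) (hB : QEst.IsObservable ρ B)
    (hAA : QEst.MulMemTraceClass (ρ.op : H →L[ℂ] H) (QEst.opMul A A))
    (hBB : QEst.MulMemTraceClass (ρ.op : H →L[ℂ] H) (QEst.opMul B B))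
    (hAB : QEst.MulMemTraceClass (ρ.op : H →L[ℂ] H) (QEst.opMul A B))
    (I : QEst.CPInstrument ℝ H) :
    ∃ M : QEst.POVM (ℝ × ℝ) H,
      I.error ρ A ≥ M.error ρ A ∧ I.disturbance ρ B ≥ M.error ρ B := by
  obtain ⟨M, hfst, hM⟩ := I.exists_povm_error_le ρ hB.1.dense_domain
  exact ⟨M, QEst.excessError_anti _ _ fun φ _ =>
    QEst.fisherInfo_le_of_preimage measurable_fst hfst ρ φ, hM⟩
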